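/- **Model.** Algorithms are programs of a random access machine whose memory cells hold natural numbers, with the instructions $+$, truncated $-$, $\times$, integer division, indirect addressing, conditionals and while loops, and with logarithmic cost: each operation is charged the bit lengths of the numbers and addresses it handles. A program may also read a tape of bits from left to right. The input consists of rationals $0<\rho,\varepsilon<1$, given by numerators and denominators, of the number $n$ of vertices, and of the adjacency matrix of a graph $G=(V,E)$ with $|V|=n$. Write $b$ for the total bit length of the numerators and denominators of $\rho$ and $\varepsilon$, and, for a constant $C$, $$T_C(n,\rho,\varepsilon)=\Big\lfloor C\big(n^2\cdot 2^{C/(\rho^3\varepsilon^2)}\cdot(\log_2(n+2))^{C}+b\big)\Big\rfloor ,$$ that is, $\tilde O(|V|^2\,2^{O(1/(\rho^3\varepsilon^2))})$ plus the time to read $\rho$ and $\varepsilon$. A set $D\subseteq V$ has density at least $1-\varepsilon$ if at least $(1-\varepsilon)\binom{|D|}{2}$ edges of $G$ have both endpoints in $D$. **Theorem 1.2.** 1. There are a single program (a Las Vegas algorithm) and constants $C$ and $c>0$ such that, for all $n,\rho,\varepsilon$ and every graph $G$ on $n$ vertices that contains a clique on at least $\rho n$ vertices, the following holds when the tape holds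 $T_C(n,\rho,\varepsilon)$ independent uniform bits. For every value of these bits the program halts in time at most $T_C(n,\rho,\varepsilon)$ and either reports failure or outputs a set of exactly $\lceil\rho n\rceil$ vertices of density at least $1-\varepsilon$; and it reports failure with probability at most $2^{-cn}$. 2. There are a single deterministic program, a constant $C$, and for every $n$ an infinite bit string $a_n$ (the advice, which depends on $n$ only), such that, for all $n,\rho,\varepsilon$ and every graph $G$ on $n$ vertices that contains a clique on at least $\rho n$ vertices, the program, when the tape holds the first $T_C(n,\rho,\varepsilon)$ bits of $a_n$, halts in time at most $T_C(n,\rho,\varepsilon)$ and outputs a set of exactly $\lceil\rho n\rceil$ vertices of density at least $1-\varepsilon$. That is, there is a non-uniform deterministic algorithm with the same running time. -/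

import Mathlib

/-!
# Random access machines with logarithmic cost, and the approximate clique problem

The machine model is the random access machine (RAM) under the logarithmic cost criterion: memory
cells hold natural numbers, the arithmetic instructions are addition, truncated subtraction,
multiplication and integer division, addressing is indirect, and every operation is charged
the bit lengths of the numbers and of the addresses that it handles.  A program is a finite piece
of syntax; its memory is divided into banks (arrays), of which a program names only finitely many.
Besides the memory there is a read-only tape of bits, read from left to right.  The tape holds the
coin flips of a randomized algorithm, or the advice of a non-uniform deterministic algorithm.
-/

namespace RAM

/-- Arithmetic operations. -/
inductive Op where
  | add
  | sub
  | mul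
  | div

/-- The value of an operation; subtraction is truncated, and a quotient by `0` is `0`. -/
def Op.apply : Op → ℕ → ℕ → ℕ
  | .add, x, y => x + y
  | .sub, x, y => x - y
  | .mul, x, y => x * y
  | .div, x, y => x / y

/-- Expressions: numerals, `get a e` (the content of the cell of bank `a` whose address is the
value of `e`), and arithmetic operations. -/
inductive Expr where
  | lit (c : ℕ)
  | get (a : ℕ) (e : Expr)
  | bin (op : Op) (e₁ e₂ : Expr)

/-- Programs. -/
inductive Prog where
  /-- do nothing -/
  | skip
  /-- cell `i` of bank `a` becomes the value of `e` -/
  | set (a : ℕ) (i e : Expr)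
  /-- cell `i` of bank `a` becomes the next bit of the tape -/
  | read (a : ℕ) (i : Expr)
  /-- first `p`, then `q` -/
  | seq (p q : Prog)
  /-- if `e ≠ 0` then `p` else `q` -/
  | ite (e : Expr) (p q : Prog)
  /-- while `e ≠ 0` do `p` -/
  | loop (e : Expr) (p : Prog)

/-- Memory: the content of cell `i` of bank `a`. -/
abbrev Mem := ℕ → ℕ → ℕ

/-- A state of the machine: the memory, and the number of tape bits read so far. -/
@[ext] structure State where
  mem : Mem
  pos : ℕ

/-- The charge for handling the number `x`: its bit length plus one. -/
def len (x : ℕ) : ℕ := Nat.size x + 1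

/-- The value of an expression. -/
def Expr.val (m : Mem) : Expr → ℕ
  | .lit c => c
  | .get a e => m a (e.val m)
  | .bin op e₁ e₂ => op.apply (e₁.val m) (e₂.val m)

/-- The time to evaluate an expression: every node is charged the lengths of the numbers and
addresses that it handles. -/
def Expr.cost (m : Mem) : Expr → ℕ
  | .lit c => len c
  | .get a e => e.cost m + len (e.val m) + len (m a (e.val m))
  | .bin _ e₁ e₂ => e₁.cost m + e₂.cost m + len (e₁.val m) + len (e₂.val m)

/-- Writing `x` into cell `i` of bank `a`. -/
def Mem.write (m : Mem) (a i x : ℕ) : Mem :=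
  fun a' i' => if a' = a ∧ i' = i then x else m a' i'

/-- `Exec ω p s t s'`: with the tape `ω`, the program `p` started in the state `s` halts in the
state `s'` after time `t`. -/
inductive Exec (ω : ℕ → Bool) : Prog → State → ℕ → State → Prop where
  | skip (s : State) : Exec ω .skip s 1 s
  | set (a : ℕ) (i e : Expr) (s : State) :
      Exec ω (.set a i e) s
        (i.cost s.mem + e.cost s.mem + len (i.val s.mem) + len (e.val s.mem))
        ⟨s.mem.write a (i.val s.mem) (e.val s.mem), s.pos⟩
  | read (a : ℕ) (i : Expr) (s : State) :
      Exec ω (.read a i) s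
        (i.cost s.mem + len (i.val s.mem) + 1)
        ⟨s.mem.write a (i.val s.mem) (ω s.pos).toNat, s.pos + 1⟩
  | seq {p q : Prog} {s s' s'' : State} {t t' : ℕ} :
      Exec ω p s t s' → Exec ω q s' t' s'' → Exec ω (.seq p q) s (t + t') s''
  | ite_true {e : Expr} {p : Prog} (q : Prog) {s s' : State} {t : ℕ} :
      e.val s.mem ≠ 0 → Exec ω p s t s' →
        Exec ω (.ite e p q) s (e.cost s.mem + len (e.val s.mem) + t) s'
  | ite_false {e : Expr} (p : Prog) {q : Prog} {s s' : State} {t : ℕ} :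
      e.val s.mem = 0 → Exec ω q s t s' →
        Exec ω (.ite e p q) s (e.cost s.mem + len (e.val s.mem) + t) s'
  | loop_done {e : Expr} (p : Prog) {s : State} :
      e.val s.mem = 0 → Exec ω (.loop e p) s (e.cost s.mem + len (e.val s.mem)) s
  | loop_step {e : Expr} {p : Prog} {s s' s'' : State} {t t' : ℕ} :
      e.val s.mem ≠ 0 → Exec ω p s t s' → Exec ω (.loop e p) s' t' s'' →
        Exec ω (.loop e p) s (e.cost s.mem + len (e.val s.mem) + t + t') s''

/-- For a given tape, the time and the final state of a halting run are determined. -/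
theorem Exec.unique {ω : ℕ → Bool} {p : Prog} {s : State} {t₁ : ℕ} {s₁ : State}
    (h₁ : Exec ω p s t₁ s₁) :
    ∀ {t₂ : ℕ} {s₂ : State}, Exec ω p s t₂ s₂ → t₁ = t₂ ∧ s₁ = s₂ := by
  induction h₁ with
  | skip s => intro _ _ h₂; cases h₂; exact ⟨rfl, rfl⟩
  | set a i e s => intro _ _ h₂; cases h₂; exact ⟨rfl, rfl⟩
  | read a i s => intro _ _ h₂; cases h₂; exact ⟨rfl, rfl⟩
  | seq _ _ ih ih' =>
    intro _ _ h₂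
    cases h₂ with
    | seq g g' =>
      obtain ⟨rfl, rfl⟩ := ih g
      obtain ⟨rfl, rfl⟩ := ih' g'
      exact ⟨rfl, rfl⟩
  | ite_true q h _ ih =>
    intro _ _ h₂
    cases h₂ with
    | ite_true _ _ g => obtain ⟨rfl, rfl⟩ := ih g; exact ⟨rfl, rfl⟩
    | ite_false _ h' _ => exact absurd h' h
  | ite_false p h _ ih =>
    intro _ _ h₂
    cases h₂ with
    | ite_true _ h' _ => exact absurd h h'
    | ite_false _ _ g => obtain ⟨rfl, rfl⟩ := ih g; exact ⟨rfl, rfl⟩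
  | loop_done p h =>
    intro _ _ h₂
    cases h₂ with
    | loop_done _ _ => exact ⟨rfl, rfl⟩
    | loop_step h' _ _ => exact absurd h h'
  | loop_step h _ _ ih ih' =>
    intro _ _ h₂
    cases h₂ with
    | loop_done _ h' => exact absurd h' h
    | loop_step _ g g' =>
      obtain ⟨rfl, rfl⟩ := ih g
      obtain ⟨rfl, rfl⟩ := ih' g'
      exact ⟨rfl, rfl⟩

/-- The tape that holds the `m` bits `r` (followed by blanks, which read as `false`). -/
def tape {m : ℕ} (r : Fin m → Bool) : ℕ → Bool :=
  fun i => if h : i < m then r ⟨i, h⟩ else false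

/-- A run that starts in `s₀` on an input for which the correct outputs are described by `Correct`,
and in which `Bot` describes the final states that report failure, is *Las Vegas with time `T` and
error `δ`*: whatever the outcome `r` of `T` coin flips (which are as many as can be used in time
`T`), the program halts in time at most `T`, and it reports failure or has a correct output; and it
reports failure with probability at most `δ`. -/
def LasVegas (p : Prog) (s₀ : State) (Bot Correct : State → Prop) (T : ℕ) (δ : ℝ) : Prop :=
  (∀ r : Fin T → Bool, ∃ t s, Exec (tape r) p s₀ t s ∧ t ≤ T ∧ (Bot s ∨ Correct s)) ∧
  (({r : Fin T → Bool | ∃ t s, Exec (tape r) p s₀ t s ∧ Bot s}.ncard : ℝ) / 2 ^ T ≤ δ)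

end RAM

namespace ApproxClique

open RAM

/-- The promise: some set of at least `ρ |V|` vertices spans a clique. -/
def HasClique {n : ℕ} (G : SimpleGraph (Fin n)) (ρ : ℚ) : Prop :=
  ∃ K : Finset (Fin n), G.IsClique (K : Set (Fin n)) ∧ ρ * n ≤ K.card

/-- The number of edges of `G` with both endpoints in `D`. -/
noncomputable def edgesIn {n : ℕ} (G : SimpleGraph (Fin n)) (D : Finset (Fin n)) : ℕ :=
  {e : Sym2 (Fin n) | e ∈ G.edgeSet ∧ ∀ v ∈ e, v ∈ D}.ncard

/-- `D` consists of `ρ |V|` vertices (rounded up) and has edge density at least `1 - ε`. -/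
def IsApproxClique {n : ℕ} (G : SimpleGraph (Fin n)) (ρ ε : ℚ) (D : Finset (Fin n)) : Prop :=
  D.card = ⌈ρ * n⌉₊ ∧ (1 - ε) * (D.card.choose 2 : ℚ) ≤ edgesIn G D

open Classical in
/-- The initial state.  Bank `0` holds the number of vertices and the numerators and denominators
of `ρ` and `ε`; bank `1` holds the adjacency matrix, row by row; all other cells are `0`. -/
noncomputable def initial {n : ℕ} (G : SimpleGraph (Fin n)) (ρ ε : ℚ) : State where
  mem := fun a i =>
    if a = 0 then
      (if i = 0 then n
      else if i = 1 then ρ.num.natAbs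
      else if i = 2 then ρ.den
      else if i = 3 then ε.num.natAbs
      else if i = 4 then ε.den
      else 0)
    else if a = 1 then
      (if ∃ u v : Fin n, G.Adj u v ∧ i = u * n + v then 1 else 0)
    else 0
  pos := 0

/-- Failure is reported by a `0` in cell `0` of bank `2`. -/
def Bot (s : State) : Prop := s.mem 2 0 = 0

/-- The output set: the vertices whose cells in bank `3` are not `0`. -/
def output (n : ℕ) (s : State) : Finset (Fin n) :=
  Finset.univ.filter fun v => s.mem 3 v ≠ 0

/-- Failure is not reported, and the output is an approximate clique. -/
def Correct {n : ℕ} (G : SimpleGraph (Fin n)) (ρ ε : ℚ) (s : State) : Prop :=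
  ¬ Bot s ∧ IsApproxClique G ρ ε (output n s)

/-- The number of bits in which a fraction is written. -/
def ratBits (q : ℚ) : ℕ := Nat.size q.num.natAbs + Nat.size q.den

/-- The time bound `Õ(n² · 2^(O(1/(ρ³ε²))))`, plus linear time for reading `ρ` and `ε`.  Powers of
`1/(ρ³ε²)` need not be written, as they are absorbed by the exponential. -/
noncomputable def timeBound (C n : ℕ) (ρ ε : ℚ) : ℕ :=
  ⌊(C : ℝ) * ((n : ℝ) ^ 2 * (2 : ℝ) ^ ((C : ℝ) / ((ρ : ℝ) ^ 3 * (ε : ℝ) ^ 2))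
      * Real.logb 2 ((n : ℝ) + 2) ^ C + (ratBits ρ + ratBits ε : ℕ))⌋₊

end ApproxClique

/-! No randomness is needed: one deterministic program is correct with every tape, so its failure
probability is zero and its advice may be constant. Let K = ⌈ρn⌉, let A be a clique on K vertices,
and put E = ⌊1/ε⌋ + 1, P = ⌊n/K⌋ + 1, a = PE.

Sampling. Let S be the common neighbourhood of s sampled vertices of A. It contains A, and a vertex
with many non-neighbours in A rarely survives in S, so on average there are only about nK/s
non-edges between A and S. For s of order a, K vertices of S with nearly the fewest non-neighbours
in S then span few non-edges. Independent samples would be too numerous to enumerate. They are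
replaced by walks of s vertices on an explicit expander on the torus (ℤ/m)² with n ≤ m² ≤ 4n, whose
degree does not depend on n; there are O(n)·2^O(a²) of them. A spectral gap
(`Torus.sum_sq_le_energy`) shows that walks confined to A behave like independent samples of A
(`IsMixing.card_sub_mul_walk_le`, `IsMixing.exists_walk`, `exists_good_walk`).

Time. Counting non-neighbours afresh takes order n² for each candidate S, hence n³ in all. Instead S
borrows the counts of a stored representative R for which the vectors of counts are close in ℓ²
(`dist2`). By the spectral gap again, this distance is approximated by a sum of codegrees along the
edges of the expander only, which takes time linear in n (`corr_bounds`). Sets that are pairwise far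
apart number at most 2^O(P³E²), independently of n (`packing`), so the quadratic work is done for
few sets. The choice of K vertices takes a bounded number of passes over the vertices
(`select_spec`). Borrowed counts do no harm, by the Cauchy–Schwarz inequality (`select_succeeds`,
`dense_of_close`).

Cost. The remainder implements this on the machine by a small program logic (`Runs`), in which time
is measured in ticks of O(log n + P³E²) units, and new representatives are paid for by a potential
(`Runs.count_potential`). -/

/-! ### A spectral gap for the affine action on the discrete torus -/

namespace Torus

open Finset

variable {m : ℕ} [NeZero m]

/-- The Fourier transform on the discrete torus. -/
noncomputable def fourier (f : ZMod m × ZMod m → ℝ) (a : ZMod m × ZMod m) : ℂ :=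
  ∑ z : ZMod m × ZMod m, (f z : ℂ) * ZMod.stdAddChar (a.1 * z.1 + a.2 * z.2)

theorem conj_stdAddChar (x : ZMod m) :
    (starRingEnd ℂ) (ZMod.stdAddChar x) = ZMod.stdAddChar (-x) := by
  rw [ZMod.stdAddChar_apply, ZMod.stdAddChar_apply, AddChar.map_neg_eq_inv, Circle.coe_inv_eq_conj]

theorem sum_stdAddChar_prod (t : ZMod m × ZMod m) :
    ∑ a : ZMod m × ZMod m, (ZMod.stdAddChar (a.1 * t.1 + a.2 * t.2) : ℂ)
      = if t = 0 then (m : ℂ) ^ 2 else 0 := by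
  have h1 : ∀ b : ZMod m, ∑ x : ZMod m, (ZMod.stdAddChar (x * b) : ℂ)
      = if b = 0 then (m : ℂ) else 0 := by
    intro b
    have := AddChar.sum_mulShift b (ZMod.isPrimitive_stdAddChar m)
    rw [this, ZMod.card]
    split_ifs <;> simp
  simp_rw [AddChar.map_add_eq_mul]
  rw [Fintype.sum_prod_type]
  simp_rw [← Finset.mul_sum]
  rw [← Finset.sum_mul, h1, h1]
  obtain ⟨t1, t2⟩ := t
  simp only [Prod.mk_eq_zero]
  by_cases h : t1 = 0 <;> by_cases h' : t2 = 0 <;> simp [h, h', sq]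

/-- Parseval's identity; the factor `m ^ 2` is there because the transform is not normalised. -/
theorem sum_norm_fourier_sq (f : ZMod m × ZMod m → ℝ) :
    ∑ a, ‖fourier f a‖ ^ 2 = (m : ℝ) ^ 2 * ∑ z, f z ^ 2 := by
  have key : ∑ a, fourier f a * (starRingEnd ℂ) (fourier f a)
      = (m : ℂ) ^ 2 * ∑ z, (f z : ℂ) ^ 2 := by
    have h1 : ∀ a, fourier f a * (starRingEnd ℂ) (fourier f a) = ∑ z, ∑ w,
        (f z : ℂ) * f w * ZMod.stdAddChar (a.1 * (z - w).1 + a.2 * (z - w).2) := by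
      intro a
      unfold fourier
      rw [map_sum, Finset.sum_mul_sum]
      refine Finset.sum_congr rfl fun z _ => Finset.sum_congr rfl fun w _ => ?_
      rw [map_mul, Complex.conj_ofReal, conj_stdAddChar]
      have : a.1 * (z - w).1 + a.2 * (z - w).2
          = (a.1 * z.1 + a.2 * z.2) + -(a.1 * w.1 + a.2 * w.2) := by
        simp only [Prod.fst_sub, Prod.snd_sub]; ring
      rw [this, AddChar.map_add_eq_mul _ (a.1 * z.1 + a.2 * z.2)]
      generalize (ZMod.stdAddChar (a.1 * z.1 + a.2 * z.2) : ℂ) = p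
      generalize (ZMod.stdAddChar (-(a.1 * w.1 + a.2 * w.2)) : ℂ) = q
      ring
    simp_rw [h1]
    rw [Finset.sum_comm, Finset.mul_sum]
    refine Finset.sum_congr rfl fun z _ => ?_
    rw [Finset.sum_comm]
    simp_rw [← Finset.mul_sum, sum_stdAddChar_prod, sub_eq_zero]
    simp
    ring
  have h2 : ∀ a, fourier f a * (starRingEnd ℂ) (fourier f a) = ((‖fourier f a‖ ^ 2 : ℝ) : ℂ) := by
    intro a
    rw [Complex.mul_conj, Complex.normSq_eq_norm_sq]
  simp_rw [h2] at key
  exact_mod_cast key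

theorem fourier_zero (f : ZMod m × ZMod m → ℝ) (hf : ∑ z, f z = 0) : fourier f 0 = 0 := by
  simp only [fourier, Prod.fst_zero, Prod.snd_zero, zero_mul, add_zero, AddChar.map_zero_eq_one,
    mul_one]
  exact_mod_cast hf

theorem fourier_sub (f g : ZMod m × ZMod m → ℝ) (a : ZMod m × ZMod m) :
    fourier (fun z => f z - g z) a = fourier f a - fourier g a := by
  simp [fourier, sub_mul, Finset.sum_sub_distrib]

/-- The shear `(x, y) ↦ (x + y, y)`. -/
def shearFst : ZMod m × ZMod m ≃ ZMod m × ZMod m where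
  toFun z := (z.1 + z.2, z.2)
  invFun z := (z.1 - z.2, z.2)
  left_inv z := by simp
  right_inv z := by simp

/-- The shear `(x, y) ↦ (x, y + x)`. -/
def shearSnd : ZMod m × ZMod m ≃ ZMod m × ZMod m where
  toFun z := (z.1, z.2 + z.1)
  invFun z := (z.1, z.2 - z.1)
  left_inv z := by simp
  right_inv z := by simp

/-- The translation `(x, y) ↦ (x + 1, y)`. -/
def shiftFst : ZMod m × ZMod m ≃ ZMod m × ZMod m where
  toFun z := (z.1 + 1, z.2)
  invFun z := (z.1 - 1, z.2)
  left_inv z := by simp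
  right_inv z := by simp

/-- The translation `(x, y) ↦ (x, y + 1)`. -/
def shiftSnd : ZMod m × ZMod m ≃ ZMod m × ZMod m where
  toFun z := (z.1, z.2 + 1)
  invFun z := (z.1, z.2 - 1)
  left_inv z := by simp
  right_inv z := by simp

theorem fourier_comp_equiv (f : ZMod m × ZMod m → ℝ) (σ : ZMod m × ZMod m ≃ ZMod m × ZMod m)
    (a : ZMod m × ZMod m) : fourier (fun z => f (σ z)) a
      = ∑ z, (f z : ℂ) * ZMod.stdAddChar (a.1 * (σ.symm z).1 + a.2 * (σ.symm z).2) := by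
  unfold fourier
  rw [← Equiv.sum_comp σ (fun z => (f z : ℂ) *
    ZMod.stdAddChar (a.1 * (σ.symm z).1 + a.2 * (σ.symm z).2))]
  simp

/-- On the dual torus a linear map acts by its inverse transpose, so the two shears change places.
-/
theorem fourier_shearFst (f : ZMod m × ZMod m → ℝ) (a : ZMod m × ZMod m) :
    fourier (fun z => f (shearFst z)) a = fourier f (shearSnd.symm a) := by
  rw [fourier_comp_equiv]
  refine Finset.sum_congr rfl fun z _ => ?_
  congr 2
  simp [shearFst, shearSnd]; ring

theorem fourier_shearSnd (f : ZMod m × ZMod m → ℝ) (a : ZMod m × ZMod m) :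
    fourier (fun z => f (shearSnd z)) a = fourier f (shearFst.symm a) := by
  rw [fourier_comp_equiv]
  refine Finset.sum_congr rfl fun z _ => ?_
  congr 2
  simp [shearFst, shearSnd]; ring

theorem fourier_shiftFst (f : ZMod m × ZMod m → ℝ) (a : ZMod m × ZMod m) :
    fourier (fun z => f (shiftFst z)) a = ZMod.stdAddChar (-a.1) * fourier f a := by
  rw [fourier_comp_equiv, fourier, Finset.mul_sum]
  refine Finset.sum_congr rfl fun z _ => ?_
  have : a.1 * (shiftFst.symm z).1 + a.2 * (shiftFst.symm z).2
      = -a.1 + (a.1 * z.1 + a.2 * z.2) := by simp [shiftFst]; ring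
  rw [this, AddChar.map_add_eq_mul]; ring

theorem fourier_shiftSnd (f : ZMod m × ZMod m → ℝ) (a : ZMod m × ZMod m) :
    fourier (fun z => f (shiftSnd z)) a = ZMod.stdAddChar (-a.2) * fourier f a := by
  rw [fourier_comp_equiv, fourier, Finset.mul_sum]
  refine Finset.sum_congr rfl fun z _ => ?_
  have : a.1 * (shiftSnd.symm z).1 + a.2 * (shiftSnd.symm z).2
      = -a.2 + (a.1 * z.1 + a.2 * z.2) := by simp [shiftSnd]; ring
  rw [this, AddChar.map_add_eq_mul]; ring

/-- The squared distance between a function and its composition with a permutation. -/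
noncomputable def energy {ι : Type*} [Fintype ι] (σ : ι ≃ ι) (f : ι → ℝ) : ℝ :=
  ∑ z, (f (σ z) - f z) ^ 2

theorem energy_nonneg {ι : Type*} [Fintype ι] (σ : ι ≃ ι) (f : ι → ℝ) : 0 ≤ energy σ f :=
  Finset.sum_nonneg fun _ _ => sq_nonneg _

theorem energy_symm {ι : Type*} [Fintype ι] (σ : ι ≃ ι) (f : ι → ℝ) :
    energy σ.symm f = energy σ f := by
  unfold energy
  rw [← Equiv.sum_comp σ]
  refine Finset.sum_congr rfl fun z _ => ?_
  simp only [Equiv.symm_apply_apply]; ring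

theorem energy_eq_fourier (σ : ZMod m × ZMod m ≃ ZMod m × ZMod m) (f : ZMod m × ZMod m → ℝ) :
    (m : ℝ) ^ 2 * energy σ f = ∑ a, ‖fourier (fun z => f (σ z)) a - fourier f a‖ ^ 2 := by
  unfold energy
  rw [← sum_norm_fourier_sq (fun z => f (σ z) - f z)]
  simp_rw [fourier_sub (fun z => f (σ z)) f]

/-- Dropping the phases of the transform can only lower the energy, by the reverse triangle
inequality. The quadrant argument below needs only the absolute values. -/
theorem energy_norm_fourier_le {σ τ : ZMod m × ZMod m ≃ ZMod m × ZMod m}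
    {f : ZMod m × ZMod m → ℝ}
    (h : ∀ a, fourier (fun z => f (σ z)) a = fourier f (τ a)) :
    energy τ (fun a => ‖fourier f a‖) ≤ (m : ℝ) ^ 2 * energy σ f := by
  rw [energy_eq_fourier]
  refine Finset.sum_le_sum fun a _ => ?_
  rw [h]
  have := abs_norm_sub_norm_le (fourier f (τ a)) (fourier f a)
  rw [← sq_abs]
  exact pow_le_pow_left₀ (abs_nonneg _) this 2

/-- The argument of the character value lies between π/2 and π in absolute value, so its real part
is at most 0, and |z - 1|² = 2 - 2 Re z. Thus translations control all frequencies outside a central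
box. -/
theorem two_le_norm_stdAddChar_sub_one_sq (x : ZMod m) (hx : (m : ℤ) ≤ 4 * |x.valMinAbs|) :
    2 ≤ ‖(ZMod.stdAddChar (-x) : ℂ) - 1‖ ^ 2 := by
  have hm : (0 : ℝ) < m := Nat.cast_pos.mpr (NeZero.pos m)
  have e : (ZMod.stdAddChar (-x) : ℂ)
      = Complex.exp (((2 * Real.pi * (-(x.valMinAbs : ℝ)) / m : ℝ) : ℂ) * Complex.I) := by
    have : -x = ((-x.valMinAbs : ℤ) : ZMod m) := by
      rw [Int.cast_neg, ZMod.coe_valMinAbs]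
    rw [this, ZMod.stdAddChar_coe]
    congr 1; push_cast; ring
  rw [e]
  set θ : ℝ := 2 * Real.pi * (-(x.valMinAbs : ℝ)) / m with hθ
  rw [← Complex.normSq_eq_norm_sq, Complex.normSq_apply]
  rw [Complex.exp_mul_I, ← Complex.ofReal_cos, ← Complex.ofReal_sin]
  simp only [Complex.sub_re, Complex.add_re, Complex.ofReal_re, Complex.mul_re, Complex.I_re,
    mul_zero, Complex.ofReal_im, Complex.I_im, mul_one, sub_self, add_zero, Complex.one_re,
    Complex.sub_im, Complex.add_im, Complex.mul_im, zero_add, Complex.one_im, sub_zero]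
  have hcos : Real.cos θ ≤ 0 := by
    rw [← Real.cos_abs]
    have habs : |θ| = 2 * Real.pi * |(x.valMinAbs : ℝ)| / m := by
      rw [hθ, abs_div, abs_mul, abs_neg, abs_of_pos hm, abs_of_pos Real.two_pi_pos]
    have h1 : (m : ℝ) ≤ 4 * |(x.valMinAbs : ℝ)| := by exact_mod_cast hx
    have h2 : 2 * |(x.valMinAbs : ℝ)| ≤ m := by
      have := ZMod.valMinAbs_mem_Ioc x
      have h3 : 2 * |x.valMinAbs| ≤ (m : ℤ) := by
        rcases abs_cases x.valMinAbs with h | h <;> [have := this.2; have := this.1] <;> linarith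
      exact_mod_cast h3
    apply Real.cos_nonpos_of_pi_div_two_le_of_le
    · rw [habs, le_div_iff₀ hm]; nlinarith [Real.pi_pos]
    · rw [habs, div_le_iff₀ hm]; nlinarith [Real.pi_pos]
  nlinarith [Real.sin_sq_add_cos_sq θ]

/-- Pairs of integers in the closed-open first or third quadrant. -/
def OddQuadrant (x y : ℤ) : Prop := (0 < x ∧ 0 ≤ y) ∨ (x < 0 ∧ y ≤ 0)

/-- Pairs of integers in the closed-open second or fourth quadrant. -/
def EvenQuadrant (x y : ℤ) : Prop := (x ≤ 0 ∧ 0 < y) ∨ (0 ≤ x ∧ y < 0)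

/-- If `h` were invariant under `σ` and `τ`, the mass of `P` would appear twice in `P ∪ R`, as the
two images are disjoint; it could then not exceed the mass of `R`. The energies measure the failure
of invariance. -/
theorem sum_le_of_disjoint_images {ι : Type*} [Fintype ι] [DecidableEq ι] (h : ι → ℝ) (σ τ : ι ≃ ι)
    (P Q R : Finset ι) (hQ : Q ⊆ P ∪ R) (hσ : ∀ a ∈ P, σ a ∈ Q) (hτ : ∀ a ∈ P, τ a ∈ Q)
    (hd : ∀ a ∈ P, ∀ b ∈ P, σ a ≠ τ b) :
    ∑ a ∈ P, h a ^ 2 ≤ 3 * ∑ a ∈ R, h a ^ 2 + 6 * energy σ h + 6 * energy τ h := by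
  -- The two disjoint images gain a factor 2, so any constant below 2 would serve in place of 3/2.
  have one : ∀ ρ : ι ≃ ι, ∑ a ∈ P, h a ^ 2
      ≤ 3 / 2 * ∑ a ∈ P.image ρ, h a ^ 2 + 3 * energy ρ h := by
    intro ρ
    rw [Finset.sum_image fun _ _ _ _ e => ρ.injective e]
    have hE : ∑ a ∈ P, (h (ρ a) - h a) ^ 2 ≤ energy ρ h :=
      Finset.sum_le_sum_of_subset_of_nonneg (Finset.subset_univ _) fun _ _ _ => sq_nonneg _
    calc ∑ a ∈ P, h a ^ 2 ≤ ∑ a ∈ P, (3 / 2 * h (ρ a) ^ 2 + 3 * (h (ρ a) - h a) ^ 2) := by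
          refine Finset.sum_le_sum fun a _ => ?_
          nlinarith [sq_nonneg (3 * h (ρ a) - 2 * h a)]
      _ = 3 / 2 * ∑ a ∈ P, h (ρ a) ^ 2 + 3 * ∑ a ∈ P, (h (ρ a) - h a) ^ 2 := by
          rw [Finset.sum_add_distrib, Finset.mul_sum, Finset.mul_sum]
      _ ≤ _ := by linarith
  have hdis : Disjoint (P.image σ) (P.image τ) := by
    rw [Finset.disjoint_left]
    intro x hx hx'
    obtain ⟨a, ha, rfl⟩ := Finset.mem_image.1 hx
    obtain ⟨b, hb, e⟩ := Finset.mem_image.1 hx'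
    exact hd a ha b hb e.symm
  have hsum : ∑ a ∈ P.image σ, h a ^ 2 + ∑ a ∈ P.image τ, h a ^ 2
      ≤ ∑ a ∈ P, h a ^ 2 + ∑ a ∈ R, h a ^ 2 := by
    rw [← Finset.sum_union hdis]
    refine le_trans (Finset.sum_le_sum_of_subset_of_nonneg (t := P ∪ R) ?_
      fun _ _ _ => sq_nonneg _) ?_
    · intro x hx
      rcases Finset.mem_union.1 hx with hx | hx <;>
        obtain ⟨a, ha, rfl⟩ := Finset.mem_image.1 hx
      · exact hQ (hσ a ha)
      · exact hQ (hτ a ha)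
    · have := Finset.sum_union_inter (s₁ := P) (s₂ := R) (f := fun a => h a ^ 2)
      have h0 : 0 ≤ ∑ a ∈ P ∩ R, h a ^ 2 := Finset.sum_nonneg fun _ _ => sq_nonneg _
      linarith
  have := one σ
  have := one τ
  linarith

/-- Inside the central box the shears do not wrap around, so the quadrants can be treated as sets of
integer pairs. -/
theorem valMinAbs_add_of_abs_lt {x y : ZMod m} (hx : 4 * |x.valMinAbs| < m)
    (hy : 4 * |y.valMinAbs| < m) : (x + y).valMinAbs = x.valMinAbs + y.valMinAbs := by
  rw [ZMod.valMinAbs_spec]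
  refine ⟨by push_cast; simp, ?_⟩
  have := abs_le.1 (le_refl |x.valMinAbs|)
  have := abs_le.1 (le_refl |y.valMinAbs|)
  constructor <;> linarith

theorem valMinAbs_sub_of_abs_lt {x y : ZMod m} (hx : 4 * |x.valMinAbs| < m)
    (hy : 4 * |y.valMinAbs| < m) : (x - y).valMinAbs = x.valMinAbs - y.valMinAbs := by
  rw [ZMod.valMinAbs_spec]
  refine ⟨by push_cast; simp, ?_⟩
  have := abs_le.1 (le_refl |x.valMinAbs|)
  have := abs_le.1 (le_refl |y.valMinAbs|)
  constructor <;> linarith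

/-- The spectral gap of Margulis, Gabber and Galil. On the frequency side, the mass outside the
central box is controlled by the translations. Inside the box, the two shears map an odd quadrant to
disjoint subsets of the odd quadrants, and the inverse shears do the same for the even ones. The
origin, the only frequency left over, carries no mass because `f` has mean zero. -/
theorem sum_sq_le_energy (f : ZMod m × ZMod m → ℝ) (hf : ∑ z, f z = 0) :
    ∑ z, f z ^ 2 ≤ 24 * (energy shearFst f + energy shearSnd f + energy shiftFst f
      + energy shiftSnd f) := by
  classical
  set h : ZMod m × ZMod m → ℝ := fun a => ‖fourier f a‖ with hh
  have hm : (0 : ℝ) < (m : ℝ) ^ 2 := by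
    have : (0 : ℝ) < m := Nat.cast_pos.mpr (NeZero.pos m)
    positivity
  have e1 : energy shearSnd h ≤ (m : ℝ) ^ 2 * energy shearFst f := by
    rw [← energy_symm]; exact energy_norm_fourier_le (fourier_shearFst f)
  have e2 : energy shearFst h ≤ (m : ℝ) ^ 2 * energy shearSnd f := by
    rw [← energy_symm]; exact energy_norm_fourier_le (fourier_shearSnd f)
  let box : ZMod m × ZMod m → Prop := fun a =>
    4 * |a.1.valMinAbs| < m ∧ 4 * |a.2.valMinAbs| < m
  let O : Finset (ZMod m × ZMod m) := univ.filter fun a => ¬ box a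
  have hO : ∑ a ∈ O, h a ^ 2 ≤ (m : ℝ) ^ 2 * (energy shiftFst f + energy shiftSnd f) := by
    rw [mul_add, energy_eq_fourier, energy_eq_fourier, ← Finset.sum_add_distrib]
    refine le_trans ?_ (Finset.sum_le_sum_of_subset_of_nonneg (Finset.subset_univ O)
      fun _ _ _ => by positivity)
    refine Finset.sum_le_sum fun a ha => ?_
    rw [fourier_shiftFst, fourier_shiftSnd]
    have r : ∀ c : ℂ, ‖c * fourier f a - fourier f a‖ ^ 2 = ‖c - 1‖ ^ 2 * h a ^ 2 := by
      intro c
      rw [show c * fourier f a - fourier f a = (c - 1) * fourier f a by ring, norm_mul, mul_pow]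
    rw [r, r]
    have hb : ¬ box a := (Finset.mem_filter.1 ha).2
    have hpos : 0 ≤ h a ^ 2 := sq_nonneg _
    rcases not_and_or.1 hb with hb | hb
    · have := two_le_norm_stdAddChar_sub_one_sq a.1 (not_lt.1 hb)
      nlinarith [mul_nonneg (sq_nonneg ‖(ZMod.stdAddChar (-a.2) : ℂ) - 1‖) hpos]
    · have := two_le_norm_stdAddChar_sub_one_sq a.2 (not_lt.1 hb)
      nlinarith [mul_nonneg (sq_nonneg ‖(ZMod.stdAddChar (-a.1) : ℂ) - 1‖) hpos]
  let P₁ : Finset (ZMod m × ZMod m) :=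
    univ.filter fun a => box a ∧ OddQuadrant a.1.valMinAbs a.2.valMinAbs
  let P₂ : Finset (ZMod m × ZMod m) :=
    univ.filter fun a => box a ∧ EvenQuadrant a.1.valMinAbs a.2.valMinAbs
  let Q₁ : Finset (ZMod m × ZMod m) :=
    univ.filter fun a => OddQuadrant a.1.valMinAbs a.2.valMinAbs
  let Q₂ : Finset (ZMod m × ZMod m) :=
    univ.filter fun a => EvenQuadrant a.1.valMinAbs a.2.valMinAbs
  have i1 : ∑ a ∈ P₁, h a ^ 2
      ≤ 3 * ∑ a ∈ O, h a ^ 2 + 6 * energy shearFst h + 6 * energy shearSnd h := by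
    refine sum_le_of_disjoint_images h _ _ P₁ Q₁ O ?_ ?_ ?_ ?_
    · intro a ha
      simp only [P₁, Q₁, O, mem_union, mem_filter, mem_univ, true_and] at ha ⊢
      tauto
    · intro a ha
      simp only [P₁, Q₁, box, mem_filter, mem_univ, true_and] at ha ⊢
      simp only [shearFst, Equiv.coe_fn_mk]
      rw [valMinAbs_add_of_abs_lt ha.1.1 ha.1.2]
      have := ha.2
      unfold OddQuadrant at *
      omega
    · intro a ha
      simp only [P₁, Q₁, box, mem_filter, mem_univ, true_and] at ha ⊢
      simp only [shearSnd, Equiv.coe_fn_mk]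
      rw [valMinAbs_add_of_abs_lt ha.1.2 ha.1.1]
      have := ha.2
      unfold OddQuadrant at *
      omega
    · intro a ha b hb e
      simp only [P₁, box, mem_filter, mem_univ, true_and] at ha hb
      simp only [shearFst, shearSnd, Equiv.coe_fn_mk, Prod.mk.injEq] at e
      have f1 := congrArg ZMod.valMinAbs e.1
      have f2 := congrArg ZMod.valMinAbs e.2
      rw [valMinAbs_add_of_abs_lt ha.1.1 ha.1.2] at f1
      rw [valMinAbs_add_of_abs_lt hb.1.2 hb.1.1] at f2
      have h1 := ha.2
      have h2 := hb.2
      unfold OddQuadrant at h1 h2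
      omega
  have i2 : ∑ a ∈ P₂, h a ^ 2
      ≤ 3 * ∑ a ∈ O, h a ^ 2 + 6 * energy shearFst h + 6 * energy shearSnd h := by
    -- The even quadrants are preserved by the inverse shears, which have the same energies.
    rw [← energy_symm shearFst, ← energy_symm shearSnd]
    refine sum_le_of_disjoint_images h _ _ P₂ Q₂ O ?_ ?_ ?_ ?_
    · intro a ha
      simp only [P₂, Q₂, O, mem_union, mem_filter, mem_univ, true_and] at ha ⊢
      tauto
    · intro a ha
      simp only [P₂, Q₂, box, mem_filter, mem_univ, true_and] at ha ⊢
      simp only [shearFst, Equiv.coe_fn_symm_mk]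
      rw [valMinAbs_sub_of_abs_lt ha.1.1 ha.1.2]
      have := ha.2
      unfold EvenQuadrant at *
      omega
    · intro a ha
      simp only [P₂, Q₂, box, mem_filter, mem_univ, true_and] at ha ⊢
      simp only [shearSnd, Equiv.coe_fn_symm_mk]
      rw [valMinAbs_sub_of_abs_lt ha.1.2 ha.1.1]
      have := ha.2
      unfold EvenQuadrant at *
      omega
    · intro a ha b hb e
      simp only [P₂, box, mem_filter, mem_univ, true_and] at ha hb
      simp only [shearFst, shearSnd, Equiv.coe_fn_symm_mk, Prod.mk.injEq] at e
      have f1 := congrArg ZMod.valMinAbs e.1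
      have f2 := congrArg ZMod.valMinAbs e.2
      rw [valMinAbs_sub_of_abs_lt ha.1.1 ha.1.2] at f1
      rw [valMinAbs_sub_of_abs_lt hb.1.2 hb.1.1] at f2
      have h1 := ha.2
      have h2 := hb.2
      unfold EvenQuadrant at h1 h2
      omega
  have htot : ∑ a, h a ^ 2 ≤ ∑ a ∈ P₁, h a ^ 2 + ∑ a ∈ P₂, h a ^ 2 + ∑ a ∈ O, h a ^ 2 := by
    rw [Finset.sum_filter, Finset.sum_filter, Finset.sum_filter, ← Finset.sum_add_distrib,
      ← Finset.sum_add_distrib]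
    refine Finset.sum_le_sum fun a _ => ?_
    have hpos : 0 ≤ h a ^ 2 := sq_nonneg _
    by_cases hb : box a
    · by_cases h0 : a = 0
      · have : h a = 0 := by rw [h0, hh]; simp [fourier_zero f hf]
        simp [this]
      · have : OddQuadrant a.1.valMinAbs a.2.valMinAbs
            ∨ EvenQuadrant a.1.valMinAbs a.2.valMinAbs := by
          have : a.1.valMinAbs ≠ 0 ∨ a.2.valMinAbs ≠ 0 := by
            by_contra hc
            push Not at hc
            rw [ZMod.valMinAbs_eq_zero, ZMod.valMinAbs_eq_zero] at hc
            exact h0 (Prod.ext hc.1 hc.2)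
          unfold OddQuadrant EvenQuadrant
          omega
        rcases this with h1 | h1 <;> simp only [hb, h1, and_self, if_true, not_true, if_false] <;>
          split_ifs <;> linarith
    · simp [hb]
  have hS := sum_norm_fourier_sq f
  have hle : (m : ℝ) ^ 2 * ∑ z, f z ^ 2 ≤ (m : ℝ) ^ 2 * (24 * (energy shearFst f
      + energy shearSnd f + energy shiftFst f + energy shiftSnd f)) := by
    rw [← hS]
    have n1 := mul_nonneg hm.le (energy_nonneg shearFst f)
    have n2 := mul_nonneg hm.le (energy_nonneg shearSnd f)
    have n3 := mul_nonneg hm.le (energy_nonneg shiftFst f)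
    have n4 := mul_nonneg hm.le (energy_nonneg shiftSnd f)
    linarith
  exact le_of_mul_le_mul_left hle hm

end Torus

/-! ### Mixing operators and random walks -/

namespace Mixing

open Finset

variable {ι : Type*} [Fintype ι]

/-- Symmetry of an operator with respect to the dot product. -/
def IsSymm (B : Module.End ℝ (ι → ℝ)) : Prop := ∀ f g, f ⬝ᵥ B g = B f ⬝ᵥ g

/-- Positive semidefiniteness of an operator with respect to the dot product. -/
def IsPSD (B : Module.End ℝ (ι → ℝ)) : Prop := ∀ f, 0 ≤ f ⬝ᵥ B f

theorem IsSymm.pow {B : Module.End ℝ (ι → ℝ)} (hB : IsSymm B) (k : ℕ) : IsSymm (B ^ k) := by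
  induction k with
  | zero => intro f g; simp
  | succ k ih =>
    intro f g
    rw [pow_succ', Module.End.mul_apply, hB, ih, ← Module.End.mul_apply, ← pow_succ, pow_succ']

/-- Cauchy–Schwarz for a semidefinite form: the quadratic polynomial x ↦ ⟨f + xg, B(f + xg)⟩ is
nonnegative, so its discriminant is at most 0. -/
theorem IsPSD.sq_le {B : Module.End ℝ (ι → ℝ)} (hS : IsSymm B) (hP : IsPSD B) (f g : ι → ℝ) :
    (f ⬝ᵥ B g) ^ 2 ≤ (f ⬝ᵥ B f) * (g ⬝ᵥ B g) := by
  have h : ∀ x : ℝ, 0 ≤ (g ⬝ᵥ B g) * (x * x) + (2 * (f ⬝ᵥ B g)) * x + f ⬝ᵥ B f := by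
    intro x
    have := hP (f + x • g)
    have e : g ⬝ᵥ B f = f ⬝ᵥ B g := by rw [hS, dotProduct_comm]
    simp only [map_add, map_smul, dotProduct_add, add_dotProduct, dotProduct_smul, smul_dotProduct,
      smul_eq_mul, e] at this
    linarith
  have := discrim_le_zero h
  rw [discrim] at this
  linarith

theorem dotProduct_self_sq_nonneg (f : ι → ℝ) : 0 ≤ f ⬝ᵥ f :=
  Finset.sum_nonneg fun i _ => mul_self_nonneg (f i)

theorem dotProduct_sq_le (f g : ι → ℝ) : (f ⬝ᵥ g) ^ 2 ≤ (f ⬝ᵥ f) * (g ⬝ᵥ g) := by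
  have := IsPSD.sq_le (B := (1 : Module.End ℝ (ι → ℝ))) (fun _ _ => rfl)
    (fun f => dotProduct_self_sq_nonneg f) f g
  simpa using this

theorem moment_even {B : Module.End ℝ (ι → ℝ)} (hS : IsSymm B) (f : ι → ℝ) (i j : ℕ) :
    f ⬝ᵥ (B ^ (i + j)) f = (B ^ i) f ⬝ᵥ (B ^ j) f := by
  rw [pow_add, Module.End.mul_apply, hS.pow]

theorem moment_nonneg {B : Module.End ℝ (ι → ℝ)} (hS : IsSymm B) (hP : IsPSD B) (f : ι → ℝ)
    (j : ℕ) : 0 ≤ f ⬝ᵥ (B ^ j) f := by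
  obtain ⟨i, hi | hi⟩ := Nat.even_or_odd' j
  · rw [hi, two_mul, moment_even hS]; exact dotProduct_self_sq_nonneg _
  · rw [hi, show 2 * i + 1 = i + (i + 1) by ring, moment_even hS, pow_succ' B i]
    exact hP _

/-- This replaces the spectral theorem. For even `j` the claim is the hypothesis for g = Bⁱf. For
odd `j`, Cauchy–Schwarz gives |Bg|⁴ ≤ ⟨g, Bg⟩⟨Bg, B(Bg)⟩ ≤ ⟨g, Bg⟩ · b|Bg|². The predicate `p`
stands for an invariant subspace: the functions of mean zero, or all functions. -/
theorem moment_succ_le {B : Module.End ℝ (ι → ℝ)} (hS : IsSymm B) (hP : IsPSD B)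
    {p : (ι → ℝ) → Prop} (hp : ∀ f, p f → p (B f)) {b : ℝ} (hb0 : 0 ≤ b)
    (hb : ∀ f, p f → f ⬝ᵥ B f ≤ b * (f ⬝ᵥ f)) {f : ι → ℝ} (hf : p f) (j : ℕ) :
    f ⬝ᵥ (B ^ (j + 1)) f ≤ b * (f ⬝ᵥ (B ^ j) f) := by
  have hpi : ∀ i, p ((B ^ i) f) := by
    intro i
    induction i with
    | zero => simpa using hf
    | succ i ih => rw [pow_succ', Module.End.mul_apply]; exact hp _ ih
  obtain ⟨i, hi | hi⟩ := Nat.even_or_odd' j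
  · rw [hi, show 2 * i + 1 = i + (i + 1) by ring, two_mul, moment_even hS, moment_even hS,
      pow_succ' B i]
    exact hb _ (hpi i)
  · rw [hi, show 2 * i + 1 + 1 = (i + 1) + (i + 1) by ring, show 2 * i + 1 = i + (i + 1) by ring,
      moment_even hS, moment_even hS, pow_succ' B i]
    set g := (B ^ i) f
    have hg : p (B g) := hp _ (hpi i)
    show B g ⬝ᵥ B g ≤ b * (g ⬝ᵥ B g)
    have h1 := hP.sq_le hS g (B g)
    have h2 := hb _ hg
    rw [hS g (B g)] at h1
    have h0 := dotProduct_self_sq_nonneg (B g)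
    have h3 := hP g
    rcases h0.eq_or_lt with h | h
    · rw [← h]; positivity
    · have : (B g ⬝ᵥ B g) * (B g ⬝ᵥ B g) ≤ (b * (g ⬝ᵥ B g)) * (B g ⬝ᵥ B g) := by
        nlinarith [mul_le_mul_of_nonneg_left h2 h3]
      exact le_of_mul_le_mul_right this h

theorem moment_le_pow {B : Module.End ℝ (ι → ℝ)} (hS : IsSymm B) (hP : IsPSD B)
    {p : (ι → ℝ) → Prop} (hp : ∀ f, p f → p (B f)) {b : ℝ} (hb0 : 0 ≤ b)
    (hb : ∀ f, p f → f ⬝ᵥ B f ≤ b * (f ⬝ᵥ f)) {f : ι → ℝ} (hf : p f) (j : ℕ) :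
    f ⬝ᵥ (B ^ j) f ≤ b ^ j * (f ⬝ᵥ f) := by
  induction j with
  | zero => simp
  | succ j ih =>
    refine (moment_succ_le hS hP hp hb0 hb hf j).trans ?_
    rw [pow_succ', mul_assoc]
    exact mul_le_mul_of_nonneg_left ih hb0

/-- The moments are log-convex by Cauchy–Schwarz, so their successive ratios do not decrease, and
the bound on the first ratio passes to all of them. -/
theorem pow_le_moment {B : Module.End ℝ (ι → ℝ)} (hS : IsSymm B) (hP : IsPSD B) {b : ℝ}
    (hb0 : 0 ≤ b) {f : ι → ℝ} (hf : b * (f ⬝ᵥ f) ≤ f ⬝ᵥ B f) (j : ℕ) :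
    b ^ j * (f ⬝ᵥ f) ≤ f ⬝ᵥ (B ^ j) f := by
  have hconv : ∀ j, (f ⬝ᵥ (B ^ (j + 1)) f) ^ 2
      ≤ (f ⬝ᵥ (B ^ j) f) * (f ⬝ᵥ (B ^ (j + 2)) f) := by
    intro j
    obtain ⟨i, hi | hi⟩ := Nat.even_or_odd' j
    · rw [hi, show 2 * i + 1 = i + (i + 1) by ring, two_mul,
        show i + i + 2 = (i + 1) + (i + 1) by ring, moment_even hS, moment_even hS, moment_even hS]
      exact dotProduct_sq_le _ _
    · rw [hi, show 2 * i + 1 + 1 = i + (i + 1 + 1) by ring, show 2 * i + 1 = i + (i + 1) by ring,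
        show i + (i + 1) + 2 = (i + 1) + (i + 1 + 1) by ring, moment_even hS, moment_even hS,
        moment_even hS, pow_succ' B (i + 1), pow_succ' B i]
      exact hP.sq_le hS _ _
  have step : ∀ j, b * (f ⬝ᵥ (B ^ j) f) ≤ f ⬝ᵥ (B ^ (j + 1)) f := by
    intro j
    induction j with
    | zero => simpa using hf
    | succ j ih =>
      have h0 := moment_nonneg hS hP f j
      have h1 := moment_nonneg hS hP f (j + 1)
      have h2 := moment_nonneg hS hP f (j + 2)
      have hc := hconv j
      rcases h1.eq_or_lt with h | h
      · rw [← h, mul_zero]; exact h2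
      · have hlt : 0 < f ⬝ᵥ (B ^ j) f := by
          rcases h0.eq_or_lt with h' | h'
          · rw [← h', zero_mul] at hc; nlinarith
          · exact h'
        have : (b * (f ⬝ᵥ (B ^ (j + 1)) f)) * (f ⬝ᵥ (B ^ j) f)
            ≤ (f ⬝ᵥ (B ^ (j + 2)) f) * (f ⬝ᵥ (B ^ j) f) := by nlinarith
        exact le_of_mul_le_mul_right this hlt
  induction j with
  | zero => simp
  | succ j ih =>
    rw [pow_succ', mul_assoc]
    exact (mul_le_mul_of_nonneg_left ih hb0).trans (step j)

/-- A doubly stochastic, symmetric, positive semidefinite operator whose spectrum on the functions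
of mean zero is bounded by `l`. -/
structure IsMixing (T : Module.End ℝ (ι → ℝ)) (l : ℝ) : Prop where
  symm : IsSymm T
  psd : IsPSD T
  one : T 1 = 1
  gap : ∀ f : ι → ℝ, ∑ z, f z = 0 → f ⬝ᵥ T f ≤ l * (f ⬝ᵥ f)

theorem IsMixing.sum_apply {T : Module.End ℝ (ι → ℝ)} {l : ℝ} (h : IsMixing T l) (f : ι → ℝ) :
    ∑ z, T f z = ∑ z, f z := by
  have := h.symm 1 f
  rwa [h.one, one_dotProduct, one_dotProduct] at this

theorem IsMixing.pow {T : Module.End ℝ (ι → ℝ)} {l : ℝ} (h : IsMixing T l) (hl : 0 ≤ l) (k : ℕ) :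
    IsMixing (T ^ k) (l ^ k) where
  symm := h.symm.pow k
  psd f := moment_nonneg h.symm h.psd f k
  one := by
    induction k with
    | zero => simp
    | succ k ih => rw [pow_succ, Module.End.mul_apply, h.one, ih]
  gap f hf := moment_le_pow (p := fun f => ∑ z, f z = 0) h.symm h.psd
    (fun f hf => by rw [h.sum_apply, hf]) hl h.gap hf k

/-- Split `f` into its mean, which `T` fixes, and a part of mean zero, on which the form of `T` lies
between 0 and `l` times the square of the norm. Positivity makes the lower bound free of error. -/
theorem IsMixing.bounds {T : Module.End ℝ (ι → ℝ)} {l : ℝ} (h : IsMixing T l) (hl : 0 ≤ l)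
    (f : ι → ℝ) : (∑ z, f z) ^ 2 / Fintype.card ι ≤ f ⬝ᵥ T f ∧
      f ⬝ᵥ T f ≤ (∑ z, f z) ^ 2 / Fintype.card ι + l * (f ⬝ᵥ f) := by
  rcases isEmpty_or_nonempty ι with hι | hι
  · simp [dotProduct]
  have hQ : (0 : ℝ) < Fintype.card ι := by exact_mod_cast Fintype.card_pos
  set c : ℝ := (∑ z, f z) / Fintype.card ι with hc
  set g : ι → ℝ := f - c • 1 with hg
  have hg0 : ∑ z, g z = 0 := by
    simp only [hg, Pi.sub_apply, Pi.smul_apply, Pi.one_apply, smul_eq_mul, mul_one,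
      Finset.sum_sub_distrib, Finset.sum_const, Finset.card_univ, nsmul_eq_mul, hc]
    field_simp; ring
  have hf : f = g + c • 1 := by simp [hg]
  have hTg := h.sum_apply g
  rw [hg0] at hTg
  have e1 : f ⬝ᵥ T f = g ⬝ᵥ T g + c ^ 2 * Fintype.card ι := by
    rw [hf, map_add, map_smul, h.one, add_dotProduct, dotProduct_add, dotProduct_add,
      smul_dotProduct, smul_dotProduct, dotProduct_smul, dotProduct_smul, dotProduct_one,
      one_dotProduct, dotProduct_one, hTg, hg0]
    simp; ring
  have e2 : f ⬝ᵥ f = g ⬝ᵥ g + c ^ 2 * Fintype.card ι := by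
    rw [hf, add_dotProduct, dotProduct_add, dotProduct_add,
      smul_dotProduct, smul_dotProduct, dotProduct_smul, dotProduct_smul, dotProduct_one,
      one_dotProduct, dotProduct_one, hg0]
    simp; ring
  have e3 : (∑ z, f z) ^ 2 / Fintype.card ι = c ^ 2 * Fintype.card ι := by
    rw [hc]; field_simp
  have h1 := h.psd g
  have h2 := h.gap g hg0
  refine ⟨by linarith, ?_⟩
  rw [e1, e3, e2]
  have : 0 ≤ l * (c ^ 2 * Fintype.card ι) := by positivity
  linarith

/-! ### Walks confined to a set. -/

/-- Restriction of functions to a set. -/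
def restr [DecidableEq ι] (X : Finset ι) : Module.End ℝ (ι → ℝ) where
  toFun f i := if i ∈ X then f i else 0
  map_add' f g := by ext i; simp only [Pi.add_apply]; split_ifs <;> simp
  map_smul' c f := by ext i; simp

section

variable [DecidableEq ι]

omit [Fintype ι] in
theorem restr_apply (X : Finset ι) (f : ι → ℝ) (i : ι) :
    restr X f i = if i ∈ X then f i else 0 := rfl

theorem restr_symm (X : Finset ι) : IsSymm (restr X) := by
  intro f g
  refine Finset.sum_congr rfl fun i _ => ?_
  simp only [restr_apply]
  split_ifs <;> simp

omit [Fintype ι] in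
theorem restr_idem (X : Finset ι) (f : ι → ℝ) : restr X (restr X f) = restr X f := by
  ext i; simp only [restr_apply]; split_ifs <;> rfl

theorem sum_restr_one (X : Finset ι) : ∑ i, restr X 1 i = X.card := by
  simp [restr_apply]

theorem restr_one_dotProduct_self (X : Finset ι) : restr X 1 ⬝ᵥ restr X 1 = X.card := by
  simp [dotProduct, restr_apply]

/-- The restriction of an operator to a set. -/
def compress (X : Finset ι) (T : Module.End ℝ (ι → ℝ)) : Module.End ℝ (ι → ℝ) :=
  restr X * T * restr X

theorem compress_dot (X : Finset ι) (T : Module.End ℝ (ι → ℝ)) (f g : ι → ℝ) :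
    f ⬝ᵥ compress X T g = restr X f ⬝ᵥ T (restr X g) := by
  rw [compress, Module.End.mul_apply, Module.End.mul_apply, restr_symm X f]

theorem IsMixing.compress_symm {T : Module.End ℝ (ι → ℝ)} {l : ℝ} (h : IsMixing T l)
    (X : Finset ι) : IsSymm (compress X T) := by
  intro f g
  rw [compress_dot, h.symm, dotProduct_comm, dotProduct_comm (compress X T f), compress_dot]

theorem IsMixing.compress_psd {T : Module.End ℝ (ι → ℝ)} {l : ℝ} (h : IsMixing T l)
    (X : Finset ι) : IsPSD (compress X T) := by
  intro f; rw [compress_dot]; exact h.psd _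

/-- By `bounds` and Cauchy–Schwarz the form of the compressed operator is at most the density of `X`
plus `l`; its moments grow by no more than this factor. -/
theorem IsMixing.walk_le {T : Module.End ℝ (ι → ℝ)} {l : ℝ} (h : IsMixing T l) (hl : 0 ≤ l)
    (X : Finset ι) (s : ℕ) : restr X 1 ⬝ᵥ (compress X T ^ s) (restr X 1)
      ≤ ((X.card : ℝ) / Fintype.card ι + l) ^ s * X.card := by
  have := moment_le_pow (p := fun _ => True) (h.compress_symm X) (h.compress_psd X)
    (fun _ _ => trivial) (b := (X.card : ℝ) / Fintype.card ι + l) (by positivity)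
    (fun f _ => ?_) (f := restr X 1) trivial s
  · rwa [restr_one_dotProduct_self] at this
  · rw [compress_dot]
    refine (h.bounds hl _).2.trans ?_
    have hle : restr X f ⬝ᵥ restr X f ≤ f ⬝ᵥ f := by
      refine Finset.sum_le_sum fun i _ => ?_
      simp only [restr_apply]
      split_ifs
      · rfl
      · simpa using mul_self_nonneg (f i)
    have hs : (∑ z, restr X f z) ^ 2 ≤ X.card * (f ⬝ᵥ f) := by
      have h1 : ∑ z, restr X f z = restr X 1 ⬝ᵥ f := by
        refine Finset.sum_congr rfl fun i _ => ?_
        simp only [restr_apply, Pi.one_apply]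
        split_ifs <;> simp
      rw [h1, ← restr_one_dotProduct_self]
      exact dotProduct_sq_le _ _
    rw [add_mul]
    refine add_le_add ?_ (mul_le_mul_of_nonneg_left hle hl)
    rw [div_mul_eq_mul_div]
    exact div_le_div_of_nonneg_right hs (by positivity)

/-- The Rayleigh quotient of the indicator of `X` is at least the density, and log-convexity of the
moments does the rest: a walk stays in `X` at least as often as independent samples would. -/
theorem IsMixing.le_walk {T : Module.End ℝ (ι → ℝ)} {l : ℝ} (h : IsMixing T l) (hl : 0 ≤ l)
    (X : Finset ι) (s : ℕ) : ((X.card : ℝ) / Fintype.card ι) ^ s * X.card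
      ≤ restr X 1 ⬝ᵥ (compress X T ^ s) (restr X 1) := by
  have := pow_le_moment (h.compress_symm X) (h.compress_psd X)
    (b := (X.card : ℝ) / Fintype.card ι) (by positivity) (f := restr X 1) ?_ s
  · rwa [restr_one_dotProduct_self] at this
  · rw [compress_dot, restr_idem, restr_one_dotProduct_self]
    refine le_trans (le_of_eq ?_) (h.bounds hl _).1
    rw [sum_restr_one]; ring

end

/-- Averaging over the `d` neighbours `w u 0, …, w u (d - 1)` of `u`. -/
noncomputable def avgOp (d : ℕ) (w : ι → ℕ → ι) : Module.End ℝ (ι → ℝ) where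
  toFun f u := (∑ j ∈ range d, f (w u j)) / d
  map_add' f g := by ext u; simp [Finset.sum_add_distrib, add_div]
  map_smul' c f := by ext u; simp [← Finset.mul_sum, mul_div_assoc]

omit [Fintype ι] in
theorem avgOp_apply (d : ℕ) (w : ι → ℕ → ι) (f : ι → ℝ) (u : ι) :
    avgOp d w f u = (∑ j ∈ range d, f (w u j)) / d := rfl

/-- The vertex reached from `u` after `t` steps, when step `i` follows the edge whose number is
the `i`-th digit of `c` in base `d`. -/
def walk (d : ℕ) (w : ι → ℕ → ι) (u : ι) (c : ℕ) : ℕ → ι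
  | 0 => u
  | t + 1 => w (walk d w u c t) (c / d ^ t % d)

omit [Fintype ι] in
theorem walk_succ' (d : ℕ) (w : ι → ℕ → ι) (u : ι) (c t : ℕ) :
    walk d w u c (t + 1) = walk d w (w u (c % d)) (c / d) t := by
  induction t with
  | zero => simp [walk]
  | succ t ih => rw [walk, ih, walk, Nat.div_div_eq_div_mul, pow_succ']

theorem sum_range_mul_divMod {M : Type*} [AddCommMonoid M] {d : ℕ} (hd : 0 < d) (e : ℕ)
    (F : ℕ → ℕ → M) :
    ∑ c ∈ range (d * e), F (c % d) (c / d) = ∑ j ∈ range d, ∑ c ∈ range e, F j c := by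
  rw [← Finset.sum_product']
  refine Finset.sum_nbij' (fun c => (c % d, c / d)) (fun p => p.1 + d * p.2) ?_ ?_ ?_ ?_ ?_
  · intro c hc
    simp only [mem_product, mem_range] at hc ⊢
    exact ⟨Nat.mod_lt _ hd, Nat.div_lt_of_lt_mul hc⟩
  · intro p hp
    simp only [mem_product, mem_range] at hp ⊢
    calc p.1 + d * p.2 < d + d * p.2 := by omega
      _ = d * (p.2 + 1) := by ring
      _ ≤ d * e := Nat.mul_le_mul_left _ (by omega)
  · intro c _; exact Nat.mod_add_div c d
  · intro p hp
    simp only [mem_product, mem_range] at hp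
    ext
    · simp [Nat.add_mul_mod_self_left, Nat.mod_eq_of_lt hp.1]
    · simp [Nat.add_mul_div_left _ _ hd, Nat.div_eq_of_lt hp.1]
  · intro c _; rfl

-- A walk of `k` steps serves as one macro step. Its operator is a power, so the gap can be made as
-- small as desired at the price of a larger degree.
omit [Fintype ι] in
theorem avgOp_walk {d : ℕ} (hd : 0 < d) (w : ι → ℕ → ι) (k : ℕ) :
    avgOp (d ^ k) (fun u c => walk d w u c k) = avgOp d w ^ k := by
  have hd' : (d : ℝ) ≠ 0 := by positivity
  induction k with
  | zero => ext f u; simp [avgOp_apply, walk]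
  | succ k ih =>
    refine LinearMap.ext fun f => funext fun u => ?_
    rw [pow_succ' (avgOp d w), Module.End.mul_apply, ← ih, avgOp_apply, avgOp_apply]
    simp_rw [avgOp_apply, walk_succ']
    rw [pow_succ', sum_range_mul_divMod hd (d ^ k)
      (fun j c => f (walk d w (w u j) c k)), ← Finset.sum_div]
    push_cast
    rw [div_div, mul_comm]

open Classical in
/-- The number of walks from `u` whose first `s` vertices lie in `X`. -/
noncomputable def walkCount (d : ℕ) (w : ι → ℕ → ι) (X : Finset ι) (s : ℕ) (u : ι) : ℕ :=
  ((range (d ^ s)).filter fun c => ∀ t < s, walk d w u c t ∈ X).card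

omit [Fintype ι] in
open Classical in
theorem walkCount_succ {d : ℕ} (hd : 0 < d) (w : ι → ℕ → ι) (X : Finset ι) (s : ℕ) (u : ι) :
    walkCount d w X (s + 1) u
      = if u ∈ X then ∑ j ∈ range d, walkCount d w X s (w u j) else 0 := by
  have key : ∀ c, (∀ t < s + 1, walk d w u c t ∈ X) ↔
      u ∈ X ∧ ∀ t < s, walk d w (w u (c % d)) (c / d) t ∈ X := by
    intro c
    rw [Nat.forall_lt_succ_left]
    simp_rw [walk_succ']
    rfl
  simp only [walkCount, Finset.card_filter, key, pow_succ']
  rw [sum_range_mul_divMod hd (d ^ s)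
    (fun j c => if u ∈ X ∧ ∀ t < s, walk d w (w u j) c t ∈ X then 1 else 0)]
  split_ifs with h <;> simp [h]

-- The `s + 1` vertices are joined by `s` steps, so the last digit of the code is never used; it
-- accounts for one of the factors `d`.
omit [Fintype ι] in
theorem walkCount_eq [DecidableEq ι] {d : ℕ} (hd : 0 < d) (w : ι → ℕ → ι) (X : Finset ι)
    (s : ℕ) (u : ι) : (walkCount d w X (s + 1) u : ℝ)
      = d ^ (s + 1) * (compress X (avgOp d w) ^ s) (restr X 1) u := by
  have hd' : (d : ℝ) ≠ 0 := by positivity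
  induction s generalizing u with
  | zero =>
    rw [walkCount_succ hd]
    simp [walkCount, restr_apply]
  | succ s ih =>
    rw [walkCount_succ hd, pow_succ' (compress X (avgOp d w)), Module.End.mul_apply, compress, Module.End.mul_apply,
      Module.End.mul_apply, restr_apply]
    have hsupp : restr X ((compress X (avgOp d w) ^ s) (restr X 1))
        = (compress X (avgOp d w) ^ s) (restr X 1) := by
      cases s with
      | zero => simp [restr_idem]
      | succ s =>
        rw [pow_succ', Module.End.mul_apply, compress, Module.End.mul_apply,
          Module.End.mul_apply, restr_idem]
    rw [← compress, hsupp]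
    split_ifs with h
    · rw [avgOp_apply]
      push_cast
      simp_rw [ih]
      rw [← Finset.mul_sum]
      field_simp
      ring
    · simp

theorem sum_walkCount [DecidableEq ι] {d : ℕ} (hd : 0 < d) (w : ι → ℕ → ι) (X : Finset ι)
    (s : ℕ) : ((∑ u, walkCount d w X (s + 1) u : ℕ) : ℝ)
      = d ^ (s + 1) * (restr X 1 ⬝ᵥ (compress X (avgOp d w) ^ s) (restr X 1)) := by
  push_cast
  simp_rw [walkCount_eq hd]
  rw [← Finset.mul_sum]
  congr 1
  have hsupp : restr X ((compress X (avgOp d w) ^ s) (restr X 1))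
      = (compress X (avgOp d w) ^ s) (restr X 1) := by
    cases s with
    | zero => simp [restr_idem]
    | succ s =>
      rw [pow_succ', Module.End.mul_apply, compress, Module.End.mul_apply,
        Module.End.mul_apply, restr_idem]
  rw [← restr_symm, one_dotProduct, hsupp]

omit [Fintype ι] in
theorem walkCount_mono (d : ℕ) (w : ι → ℕ → ι) {X Y : Finset ι} (h : X ⊆ Y) (s : ℕ) (u : ι) :
    walkCount d w X s u ≤ walkCount d w Y s u := by
  refine Finset.card_le_card fun c hc => ?_
  simp only [mem_filter] at hc ⊢
  exact ⟨hc.1, fun t ht => h (hc.2 t ht)⟩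

/-- By Bernoulli's inequality, (1 - y)ˢ(1 + sy) ≤ (1 - y)ˢ(1 + y)ˢ ≤ 1. -/
theorem mul_one_sub_pow_le {y : ℝ} (h0 : 0 ≤ y) (h1 : y ≤ 1) {s : ℕ} (hs : 0 < s) :
    y * (1 - y) ^ s ≤ 1 / s := by
  have hs' : (0 : ℝ) < s := by exact_mod_cast hs
  have h2 : (1 - y) ^ s * (1 + s * y) ≤ 1 := by
    have hb : 1 + (s : ℝ) * y ≤ (1 + y) ^ s := one_add_mul_le_pow (by linarith) s
    calc (1 - y) ^ s * (1 + s * y) ≤ (1 - y) ^ s * (1 + y) ^ s :=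
          mul_le_mul_of_nonneg_left hb (pow_nonneg (by linarith) s)
      _ = (1 - y ^ 2) ^ s := by rw [← mul_pow]; ring_nf
      _ ≤ 1 := pow_le_one₀ (by nlinarith) (by nlinarith)
  rw [le_div_iff₀ hs']
  have h3 : 0 ≤ (1 - y) ^ s := pow_nonneg (by linarith) s
  nlinarith

/-- Walks inside `A` rarely stay inside a subset of `A`. -/
theorem IsMixing.card_sub_mul_walk_le [DecidableEq ι] [Nonempty ι] {d : ℕ} (hd : 0 < d)
    {w : ι → ℕ → ι} {l : ℝ} (h : IsMixing (avgOp d w) l) (hl : 0 ≤ l) {X A : Finset ι} (hX : X ⊆ A)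
    (hA : A.Nonempty) {s : ℕ} (hs : 0 < s) :
    ((A.card : ℝ) - X.card) * (∑ u, walkCount d w X (s + 1) u : ℕ)
      ≤ A.card * (1 / s + l * Fintype.card ι / A.card) * (∑ u, walkCount d w A (s + 1) u : ℕ) := by
  have hA0 : (0 : ℝ) < A.card := by exact_mod_cast hA.card_pos
  have hQ : (0 : ℝ) < Fintype.card ι := by exact_mod_cast Fintype.card_pos
  have hXA : (X.card : ℝ) ≤ A.card := by exact_mod_cast Finset.card_le_card hX
  have hs' : (0 : ℝ) < s := by exact_mod_cast hs
  set μ : ℝ := l * Fintype.card ι / A.card with hμ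
  have hμ0 : 0 ≤ μ := by positivity
  set x : ℝ := 1 - X.card / A.card with hx
  have hx0 : 0 ≤ x := by
    rw [hx, sub_nonneg]; exact (div_le_one hA0).2 hXA
  have hx1 : x ≤ 1 := by rw [hx]; linarith [show (0 : ℝ) ≤ X.card / A.card by positivity]
  have e : (A.card : ℝ) - X.card = A.card * x := by rw [hx]; field_simp
  rw [e, mul_assoc, mul_assoc]
  refine mul_le_mul_of_nonneg_left ?_ hA0.le
  have hmono : ((∑ u, walkCount d w X (s + 1) u : ℕ) : ℝ)
      ≤ (∑ u, walkCount d w A (s + 1) u : ℕ) := by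
    exact_mod_cast Finset.sum_le_sum fun u _ => walkCount_mono d w hX (s + 1) u
  have hN0 : (0 : ℝ) ≤ (∑ u, walkCount d w A (s + 1) u : ℕ) := by positivity
  -- Here `x` is the defect of `X` relative to `A`, and `μ` the loss due to the imperfect expander.
  -- For x ≤ μ, monotonicity of the counts suffices. Otherwise `walk_le` for `X` and `le_walk` for
  -- `A` bound the ratio of the counts by (1 - (x - μ))ˢ, and `mul_one_sub_pow_le` applies to x - μ.
  rcases le_total x μ with hxm | hxm
  · calc x * _ ≤ μ * (∑ u, walkCount d w A (s + 1) u : ℕ) :=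
          mul_le_mul hxm hmono (by positivity) hμ0
      _ ≤ _ := mul_le_mul_of_nonneg_right (by linarith [show 0 ≤ 1 / (s : ℝ) by positivity]) hN0
  · have hup := h.walk_le hl X s
    have hlo := h.le_walk hl A s
    have hup' : ((∑ u, walkCount d w X (s + 1) u : ℕ) : ℝ) ≤ d ^ (s + 1) *
        (((A.card : ℝ) / Fintype.card ι) ^ s * (1 - (x - μ)) ^ s * A.card) := by
      rw [sum_walkCount hd]
      refine mul_le_mul_of_nonneg_left (hup.trans ?_) (by positivity)
      rw [← mul_pow]
      refine mul_le_mul (le_of_eq ?_) hXA (by positivity) ?_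
      · congr 1
        rw [hx, hμ]; field_simp; ring
      · exact pow_nonneg (mul_nonneg (by positivity) (by linarith)) s
    have hlo' : (d : ℝ) ^ (s + 1) * (((A.card : ℝ) / Fintype.card ι) ^ s * A.card)
        ≤ (∑ u, walkCount d w A (s + 1) u : ℕ) := by
      rw [sum_walkCount hd]
      exact mul_le_mul_of_nonneg_left hlo (by positivity)
    have hB : x * (1 - (x - μ)) ^ s ≤ 1 / s + μ := by
      have h1 := mul_one_sub_pow_le (y := x - μ) (by linarith) (by linarith) hs
      have h2 : (1 - (x - μ)) ^ s ≤ 1 := pow_le_one₀ (by linarith) (by linarith)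
      nlinarith
    set D : ℝ := (d : ℝ) ^ (s + 1) * (((A.card : ℝ) / Fintype.card ι) ^ s * A.card) with hD
    have hD0 : 0 ≤ D := by positivity
    calc x * ((∑ u, walkCount d w X (s + 1) u : ℕ) : ℝ)
        ≤ x * (D * (1 - (x - μ)) ^ s) := by
          refine mul_le_mul_of_nonneg_left (hup'.trans (le_of_eq ?_)) hx0
          rw [hD]; ring
      _ = (x * (1 - (x - μ)) ^ s) * D := by ring
      _ ≤ (1 / s + μ) * D := mul_le_mul_of_nonneg_right hB hD0
      _ ≤ _ := mul_le_mul_of_nonneg_left hlo' (by positivity)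

/-- Some walk inside `A` is caught by few of the subsets `X v` of `A`, even when each of them is
weighted by its defect. -/
theorem IsMixing.exists_walk [DecidableEq ι] [Nonempty ι] {d : ℕ} (hd : 0 < d)
    {w : ι → ℕ → ι} {l : ℝ} (h : IsMixing (avgOp d w) l) (hl : 0 ≤ l) {A : Finset ι}
    (hA : A.Nonempty) {s : ℕ} (hs : 0 < s) {V : Type*} (I : Finset V) (X : V → Finset ι)
    (hX : ∀ v ∈ I, X v ⊆ A) :
    ∃ u, ∃ c < d ^ (s + 1), (∀ t < s + 1, walk d w u c t ∈ A) ∧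
      ∀ J ⊆ I, (∀ v ∈ J, ∀ t < s + 1, walk d w u c t ∈ X v) →
        ∑ v ∈ J, ((A.card : ℝ) - (X v).card)
          ≤ I.card * (A.card * (1 / s + l * Fintype.card ι / A.card)) := by
  classical
  set M : ℝ := A.card * (1 / s + l * Fintype.card ι / A.card) with hM
  -- An averaging argument over all walks inside `A`, each charged with the total defect of the sets
  -- `X v` that contain it. Exchanging the sums reduces the average to the bound for a single `v`;
  -- there is at least one walk to average over, by `le_walk`.
  by_contra hcon
  push Not at hcon
  let W : Finset ι → Finset (ι × ℕ) := fun Y => (univ ×ˢ range (d ^ (s + 1))).filter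
    fun p => ∀ t < s + 1, walk d w p.1 p.2 t ∈ Y
  have hW : ∀ Y, ((W Y).card : ℝ) = (∑ u, walkCount d w Y (s + 1) u : ℕ) := by
    intro Y
    simp only [W, walkCount, Finset.card_filter, Finset.sum_product]
    congr!
  have hbound : ∀ v ∈ I, ((A.card : ℝ) - (X v).card) * (W (X v)).card ≤ M * (W A).card := by
    intro v hv
    rw [hW, hW]
    exact h.card_sub_mul_walk_le hd hl (hX v hv) hA hs
  have hsum := Finset.sum_le_sum hbound
  rw [Finset.sum_const, nsmul_eq_mul, ← mul_assoc] at hsum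
  have hWA : (W A).Nonempty := by
    rw [← Finset.card_pos]
    have h1 := h.le_walk hl A s
    have h2 : (0 : ℝ) < (W A).card := by
      rw [hW, sum_walkCount hd]
      have hA0 : (0 : ℝ) < A.card := by exact_mod_cast hA.card_pos
      have hQ : (0 : ℝ) < Fintype.card ι := by exact_mod_cast Fintype.card_pos
      have hd' : (0 : ℝ) < d := by exact_mod_cast hd
      have : 0 < ((A.card : ℝ) / Fintype.card ι) ^ s * A.card := by positivity
      have := this.trans_le h1
      positivity
    exact_mod_cast h2
  have hswap : ∑ v ∈ I, ((A.card : ℝ) - (X v).card) * (W (X v)).card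
      = ∑ p ∈ W A, ∑ v ∈ I.filter (fun v => ∀ t < s + 1, walk d w p.1 p.2 t ∈ X v),
        ((A.card : ℝ) - (X v).card) := by
    simp_rw [Finset.sum_filter]
    rw [Finset.sum_comm]
    refine Finset.sum_congr rfl fun v hv => ?_
    rw [← Finset.sum_filter, Finset.sum_const, nsmul_eq_mul, mul_comm]
    congr 3
    ext p
    simp only [W, mem_filter, mem_product, mem_univ, true_and]
    exact ⟨fun hp => ⟨⟨hp.1, fun t ht => hX v hv (hp.2 t ht)⟩, hp.2⟩, fun hp => ⟨hp.1.1, hp.2⟩⟩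
  have hgt : ∑ p ∈ W A, (I.card : ℝ) * M < ∑ p ∈ W A,
      ∑ v ∈ I.filter (fun v => ∀ t < s + 1, walk d w p.1 p.2 t ∈ X v),
        ((A.card : ℝ) - (X v).card) := by
    refine Finset.sum_lt_sum_of_nonempty hWA fun p hp => ?_
    simp only [W, mem_filter, mem_product, mem_univ, true_and, mem_range] at hp
    obtain ⟨J, hJ, hJ', hlt⟩ := hcon p.1 p.2 hp.1 hp.2
    refine hlt.trans_le (Finset.sum_le_sum_of_subset_of_nonneg ?_ ?_)
    · intro v hv; exact mem_filter.2 ⟨hJ hv, hJ' v hv⟩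
    · intro v hv _
      rw [sub_nonneg]
      exact_mod_cast Finset.card_le_card (hX v (mem_filter.1 hv).1)
  rw [Finset.sum_const, nsmul_eq_mul, ← hswap] at hgt
  linarith

end Mixing

/-! ### The expander in coordinates -/

namespace Torus

open Finset Mixing

section

variable {m : ℕ} [NeZero m]

/-- The sixteen generators: eight copies of the identity, then the shears, the translations and
their inverses. -/
def gen : ℕ → (ZMod m × ZMod m ≃ ZMod m × ZMod m)
  | 8 => shearFst
  | 9 => shearFst.symm
  | 10 => shearSnd
  | 11 => shearSnd.symm
  | 12 => shiftFst
  | 13 => shiftFst.symm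
  | 14 => shiftSnd
  | 15 => shiftSnd.symm
  | _ => Equiv.refl _

theorem dotProduct_comp_equiv {ι : Type*} [Fintype ι] (σ : ι ≃ ι) (f g : ι → ℝ) :
    f ⬝ᵥ (fun u => g (σ u)) = (fun u => f (σ.symm u)) ⬝ᵥ g := by
  unfold dotProduct
  rw [← Equiv.sum_comp σ fun u => f (σ.symm u) * g u]
  simp

theorem two_mul_dotProduct_comp {ι : Type*} [Fintype ι] (σ : ι ≃ ι) (f : ι → ℝ) :
    2 * (f ⬝ᵥ fun u => f (σ u)) = 2 * (f ⬝ᵥ f) - energy σ f := by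
  have h : energy σ f = (∑ z, f (σ z) * f (σ z)) - 2 * (f ⬝ᵥ fun u => f (σ u)) + f ⬝ᵥ f := by
    unfold energy dotProduct
    rw [Finset.mul_sum, ← Finset.sum_sub_distrib, ← Finset.sum_add_distrib]
    exact Finset.sum_congr rfl fun z _ => by ring
  rw [Equiv.sum_comp σ fun z => f z * f z] at h
  rw [h]; unfold dotProduct; ring

theorem neg_le_dotProduct_comp {ι : Type*} [Fintype ι] (σ : ι ≃ ι) (f : ι → ℝ) :
    -(f ⬝ᵥ f) ≤ f ⬝ᵥ fun u => f (σ u) := by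
  have h : 0 ≤ ∑ z, (f (σ z) + f z) ^ 2 := Finset.sum_nonneg fun _ _ => sq_nonneg _
  have e : ∑ z, (f (σ z) + f z) ^ 2
      = (∑ z, f (σ z) * f (σ z)) + 2 * (f ⬝ᵥ fun u => f (σ u)) + f ⬝ᵥ f := by
    unfold dotProduct
    rw [Finset.mul_sum, ← Finset.sum_add_distrib, ← Finset.sum_add_distrib]
    exact Finset.sum_congr rfl fun z _ => by ring
  rw [e, Equiv.sum_comp σ fun z => f z * f z] at h
  unfold dotProduct at *
  linarith

theorem dotProduct_avgOp {ι : Type*} [Fintype ι] (d : ℕ) (w : ι → ℕ → ι) (f g : ι → ℝ) :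
    f ⬝ᵥ avgOp d w g = (∑ j ∈ range d, f ⬝ᵥ fun u => g (w u j)) / d := by
  simp only [dotProduct, avgOp_apply]
  rw [Finset.sum_comm, Finset.sum_div]
  refine Finset.sum_congr rfl fun u _ => ?_
  rw [mul_div_assoc', Finset.mul_sum]

/-- The copies of the identity are half of the generators, and this makes the operator semidefinite.
Its form is ‖f‖² minus a sixteenth of the sum of the four energies, and that sum is at least ‖f‖²/24
on mean zero functions: the gap is 1 - 1/384. -/
theorem isMixing_gen :
    IsMixing (avgOp 16 fun (u : ZMod m × ZMod m) j => gen j u) (383 / 384) where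
  symm f g := by
    rw [dotProduct_avgOp, dotProduct_comm, dotProduct_avgOp]
    have : ∀ σ : ZMod m × ZMod m ≃ ZMod m × ZMod m,
        (g ⬝ᵥ fun u => f (σ u)) = f ⬝ᵥ fun u => g (σ.symm u) := by
      intro σ; rw [dotProduct_comp_equiv, dotProduct_comm]
    simp only [this]
    simp only [Finset.sum_range_succ, Finset.sum_range_zero, gen, Equiv.symm_symm, Equiv.refl_symm]
    ring
  psd f := by
    rw [dotProduct_avgOp]
    have h := fun σ : ZMod m × ZMod m ≃ ZMod m × ZMod m => neg_le_dotProduct_comp σ f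
    refine div_nonneg ?_ (by positivity)
    simp only [Finset.sum_range_succ, Finset.sum_range_zero, gen, Equiv.refl_apply]
    linarith [h shearFst, h shearFst.symm, h shearSnd, h shearSnd.symm, h shiftFst,
      h shiftFst.symm, h shiftSnd, h shiftSnd.symm]
  one := by
    ext u; simp [avgOp_apply]
  gap f hf := by
    rw [dotProduct_avgOp]
    have h := fun σ : ZMod m × ZMod m ≃ ZMod m × ZMod m => two_mul_dotProduct_comp σ f
    have e := fun σ : ZMod m × ZMod m ≃ ZMod m × ZMod m => energy_symm σ f
    have hg := sum_sq_le_energy f hf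
    have hs : ∑ z, f z ^ 2 = f ⬝ᵥ f := Finset.sum_congr rfl fun z _ => sq (f z)
    rw [hs] at hg
    rw [div_le_iff₀ (by norm_num)]
    simp only [Finset.sum_range_succ, Finset.sum_range_zero, gen, Equiv.refl_apply]
    push_cast
    linarith [h shearFst, h shearFst.symm, h shearSnd, h shearSnd.symm, h shiftFst,
      h shiftFst.symm, h shiftSnd, h shiftSnd.symm, e shearFst, e shearSnd, e shiftFst, e shiftSnd]

/-- The number of a point of the torus. -/
def enc (z : ZMod m × ZMod m) : ℕ := z.1.val * m + z.2.val

theorem enc_div (z : ZMod m × ZMod m) : enc z / m = z.1.val := by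
  have := ZMod.val_lt z.2
  rw [enc, mul_comm, Nat.mul_add_div (NeZero.pos m), Nat.div_eq_of_lt this, add_zero]

theorem enc_mod (z : ZMod m × ZMod m) : enc z % m = z.2.val := by
  rw [enc, mul_comm, Nat.mul_add_mod, Nat.mod_eq_of_lt (ZMod.val_lt z.2)]

theorem enc_lt (z : ZMod m × ZMod m) : enc z < m * m := by
  have h1 := ZMod.val_lt z.1
  have h2 := ZMod.val_lt z.2
  calc z.1.val * m + z.2.val < z.1.val * m + m := by omega
    _ = (z.1.val + 1) * m := by ring
    _ ≤ m * m := Nat.mul_le_mul_right _ h1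

theorem enc_injective : Function.Injective (enc : ZMod m × ZMod m → ℕ) := by
  intro z w h
  have h1 := enc_div z
  have h2 := enc_mod z
  rw [h, enc_div] at h1
  rw [h, enc_mod] at h2
  exact Prod.ext (ZMod.val_injective m h1.symm) (ZMod.val_injective m h2.symm)

theorem exists_enc {u : ℕ} (hu : u < m * m) : ∃ z : ZMod m × ZMod m, enc z = u := by
  refine ⟨((u / m : ℕ), (u % m : ℕ)), ?_⟩
  have h1 : u / m < m := Nat.div_lt_of_lt_mul hu
  have h2 : u % m < m := Nat.mod_lt _ (NeZero.pos m)
  rw [enc, ZMod.val_natCast_of_lt h1, ZMod.val_natCast_of_lt h2, mul_comm, Nat.div_add_mod]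

theorem sum_enc {M : Type*} [AddCommMonoid M] (F : ℕ → M) :
    ∑ z : ZMod m × ZMod m, F (enc z) = ∑ u ∈ range (m * m), F u := by
  refine Finset.sum_bij (fun z _ => enc z) (fun z _ => mem_range.2 (enc_lt z))
    (fun z _ w _ h => enc_injective h) (fun u hu => ?_) (fun _ _ => rfl)
  obtain ⟨z, hz⟩ := exists_enc (m := m) (mem_range.1 hu)
  exact ⟨z, mem_univ _, hz⟩

end

/-- The generators in coordinates. -/
def step (m u g : ℕ) : ℕ :=
  if g = 8 then (u / m + u % m) % m * m + u % m
  else if g = 9 then (u / m + (m - u % m)) % m * m + u % m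
  else if g = 10 then u / m * m + (u % m + u / m) % m
  else if g = 11 then u / m * m + (u % m + (m - u / m)) % m
  else if g = 12 then (u / m + 1) % m * m + u % m
  else if g = 13 then (u / m + (m - 1)) % m * m + u % m
  else if g = 14 then u / m * m + (u % m + 1) % m
  else if g = 15 then u / m * m + (u % m + (m - 1)) % m
  else u

section

variable {m : ℕ} [NeZero m]

theorem val_sub_eq (x y : ZMod m) : (x - y).val = (x.val + (m - y.val)) % m := by
  have hy := (ZMod.val_lt y).le
  have : x - y = ((x.val + (m - y.val) : ℕ) : ZMod m) := by
    push_cast [Nat.cast_sub hy]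
    simp [sub_eq_add_neg]
  rw [this, ZMod.val_natCast]

theorem val_add_one_eq (x : ZMod m) : (x + 1).val = (x.val + 1) % m := by
  have : x + 1 = ((x.val + 1 : ℕ) : ZMod m) := by push_cast; simp
  rw [this, ZMod.val_natCast]

theorem val_sub_one_eq (x : ZMod m) : (x - 1).val = (x.val + (m - 1)) % m := by
  have hm : 1 ≤ m := NeZero.pos m
  have : x - 1 = ((x.val + (m - 1) : ℕ) : ZMod m) := by
    push_cast [Nat.cast_sub hm]
    simp; ring
  rw [this, ZMod.val_natCast]

theorem step_enc (z : ZMod m × ZMod m) (g : ℕ) : step m (enc z) g = enc (gen g z) := by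
  unfold step
  simp only [enc_div, enc_mod]
  split_ifs with h h h h h h h h
  · subst h; simp [gen, enc, shearFst, ZMod.val_add]
  · subst h; simp [gen, enc, shearFst, val_sub_eq]
  · subst h; simp [gen, enc, shearSnd, ZMod.val_add]
  · subst h; simp [gen, enc, shearSnd, val_sub_eq]
  · subst h; simp [gen, enc, shiftFst, val_add_one_eq]
  · subst h; simp [gen, enc, shiftFst, val_sub_one_eq]
  · subst h; simp [gen, enc, shiftSnd, val_add_one_eq]
  · subst h; simp [gen, enc, shiftSnd, val_sub_one_eq]
  · have : gen (m := m) g = Equiv.refl _ := by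
      unfold gen; split <;> first | rfl | contradiction
    rw [this, Equiv.refl_apply]

omit [NeZero m] in
theorem enc_walk {d : ℕ} {w : ZMod m × ZMod m → ℕ → ZMod m × ZMod m} {w' : ℕ → ℕ → ℕ}
    (h : ∀ z j, w' (enc z) j = enc (w z j)) (z : ZMod m × ZMod m) (c t : ℕ) :
    walk d w' (enc z) c t = enc (walk d w z c t) := by
  induction t with
  | zero => rfl
  | succ t ih => rw [walk, ih, h, walk]

end

/-- The end of the walk of `k` steps from `u` in the torus with `m * m` points. -/
def nbr (m k u c : ℕ) : ℕ := walk 16 (step m) u c k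

section

variable {m : ℕ} [NeZero m]

theorem nbr_enc (k : ℕ) (z : ZMod m × ZMod m) (c : ℕ) :
    nbr m k (enc z) c = enc (walk 16 (fun u j => gen j u) z c k) :=
  enc_walk (fun z j => step_enc z j) z c k

theorem nbr_lt (k : ℕ) {u : ℕ} (hu : u < m * m) (c : ℕ) : nbr m k u c < m * m := by
  obtain ⟨z, rfl⟩ := exists_enc hu
  rw [nbr_enc]; exact enc_lt _

theorem isMixing_nbr (k : ℕ) : IsMixing (avgOp (16 ^ k)
    fun (u : ZMod m × ZMod m) c => walk 16 (fun u j => gen j u) u c k) ((383 / 384) ^ k) := by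
  rw [avgOp_walk (by norm_num)]
  exact isMixing_gen.pow (by norm_num) k

theorem card_torus : Fintype.card (ZMod m × ZMod m) = m * m := by
  rw [Fintype.card_prod, ZMod.card]

/-- Correlations along the edges of the expander. -/
theorem nbr_bounds (k : ℕ) (x : ℕ → ℝ) :
    (∑ u ∈ range (m * m), x u) ^ 2 / (m * m : ℕ)
        ≤ (∑ u ∈ range (m * m), ∑ c ∈ range (16 ^ k), x u * x (nbr m k u c)) / (16 ^ k : ℕ) ∧
      (∑ u ∈ range (m * m), ∑ c ∈ range (16 ^ k), x u * x (nbr m k u c)) / (16 ^ k : ℕ)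
        ≤ (∑ u ∈ range (m * m), x u) ^ 2 / (m * m : ℕ)
          + (383 / 384) ^ k * ∑ u ∈ range (m * m), x u ^ 2 := by
  have h := (isMixing_nbr (m := m) k).bounds (by positivity) fun z => x (enc z)
  rw [card_torus, sum_enc x] at h
  have e1 : (fun z : ZMod m × ZMod m => x (enc z)) ⬝ᵥ (fun z => x (enc z))
      = ∑ u ∈ range (m * m), x u ^ 2 := by
    rw [← sum_enc fun u => x u ^ 2]
    exact Finset.sum_congr rfl fun z _ => (sq _).symm
  have e2 : (fun z : ZMod m × ZMod m => x (enc z)) ⬝ᵥ avgOp (16 ^ k)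
      (fun (u : ZMod m × ZMod m) c => walk 16 (fun u j => gen j u) u c k) (fun z => x (enc z))
      = (∑ u ∈ range (m * m), ∑ c ∈ range (16 ^ k), x u * x (nbr m k u c)) / (16 ^ k : ℕ) := by
    rw [← sum_enc fun u => ∑ c ∈ range (16 ^ k), x u * x (nbr m k u c), Finset.sum_div]
    refine Finset.sum_congr rfl fun z _ => ?_
    rw [avgOp_apply, mul_div_assoc', Finset.mul_sum]
    simp_rw [nbr_enc]
  rw [e1, e2] at h
  exact h

/-- Some walk inside `A` is caught by few of the subsets `X v` of `A`, even when each of them is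
weighted by its defect. -/
theorem exists_walk_nbr (k : ℕ) {A : Finset ℕ} (hAm : A ⊆ range (m * m)) (hA : A.Nonempty) {s : ℕ}
    (hs : 0 < s) (I : Finset ℕ) (X : ℕ → Finset ℕ) (hX : ∀ v ∈ I, X v ⊆ A) :
    ∃ u < m * m, ∃ c < (16 ^ k) ^ (s + 1),
      (∀ t < s + 1, walk (16 ^ k) (nbr m k) u c t ∈ A) ∧
      ∀ J ⊆ I, (∀ v ∈ J, ∀ t < s + 1, walk (16 ^ k) (nbr m k) u c t ∈ X v) →
        ∑ v ∈ J, ((A.card : ℝ) - (X v).card)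
          ≤ I.card * (A.card * (1 / s + (383 / 384) ^ k * (m * m : ℕ) / A.card)) := by
  classical
  let pull : Finset ℕ → Finset (ZMod m × ZMod m) := fun Y => univ.filter fun z => enc z ∈ Y
  have hpull : ∀ Y ⊆ A, (pull Y).card = Y.card := by
    intro Y hY
    refine Finset.card_bij (fun z _ => enc z) (fun z hz => (mem_filter.1 hz).2)
      (fun z _ w _ h => enc_injective h) (fun u hu => ?_)
    obtain ⟨z, rfl⟩ := exists_enc (m := m) (mem_range.1 (hAm (hY hu)))
    exact ⟨z, mem_filter.2 ⟨mem_univ _, hu⟩, rfl⟩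
  have hne : (pull A).Nonempty := by rw [← Finset.card_pos, hpull A subset_rfl]; exact hA.card_pos
  obtain ⟨z, c, hc, h1, h2⟩ := (isMixing_nbr (m := m) k).exists_walk (by positivity)
    (by positivity) hne hs I (fun v => pull (X v)) fun v hv z hz =>
      mem_filter.2 ⟨mem_univ _, hX v hv (mem_filter.1 hz).2⟩
  have hw : ∀ t, walk (16 ^ k) (nbr m k) (enc z) c t = enc (walk (16 ^ k)
      (fun (u : ZMod m × ZMod m) c => walk 16 (fun u j => gen j u) u c k) z c t) :=
    fun t => enc_walk (fun z j => nbr_enc k z j) z c t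
  refine ⟨enc z, enc_lt z, c, hc, fun t ht => ?_, fun J hJ hJX => ?_⟩
  · rw [hw]; exact (mem_filter.1 (h1 t ht)).2
  · have := h2 J hJ fun v hv t ht => mem_filter.2 ⟨mem_univ _, by rw [← hw]; exact hJX v hv t ht⟩
    rw [hpull A subset_rfl, card_torus] at this
    refine le_trans (le_of_eq ?_) this
    exact Finset.sum_congr rfl fun v hv => by rw [hpull _ (hX v (hJ hv))]

end

/-- Bernoulli's inequality gives (383/384)^384 ≤ 1/2, and 5376 = 384 · 14, so the power is at most
2^(-14a), while 2^11 a³ ≤ 2^(11a) · 2^(3a). Logarithmically many steps would do, but linearly many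
are affordable. -/
theorem gap_pow_le {a : ℕ} :
    (383 / 384 : ℝ) ^ (5376 * a) * (2 ^ 11 * (a : ℝ) ^ 3) ≤ 1 := by
  rcases Nat.eq_zero_or_pos a with rfl | ha
  · norm_num
  have h1 : (383 / 384 : ℝ) ^ 384 ≤ 1 / 2 := by
    have := one_add_mul_le_pow (show (-2 : ℝ) ≤ 1 / 383 by norm_num) 384
    have h2 : (2 : ℝ) ≤ (384 / 383) ^ 384 := by
      refine le_trans (by norm_num) (this.trans (le_of_eq ?_)); norm_num
    have h3 : (383 / 384 : ℝ) ^ 384 * (384 / 383) ^ 384 = 1 := by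
      rw [← mul_pow]; norm_num
    have h4 : (0 : ℝ) < (383 / 384 : ℝ) ^ 384 := by positivity
    generalize (383 / 384 : ℝ) ^ 384 = p at *
    generalize (384 / 383 : ℝ) ^ 384 = q at *
    nlinarith
  have h2 : (383 / 384 : ℝ) ^ (5376 * a) ≤ (1 / 2) ^ (14 * a) := by
    rw [show 5376 * a = 384 * (14 * a) by ring, pow_mul]
    exact pow_le_pow_left₀ (by positivity) h1 _
  have h3 : (a : ℝ) ≤ 2 ^ a := by exact_mod_cast Nat.lt_two_pow_self.le
  have h4 : (2 : ℝ) ^ 11 * (a : ℝ) ^ 3 ≤ 2 ^ (14 * a) := by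
    calc (2 : ℝ) ^ 11 * (a : ℝ) ^ 3 ≤ 2 ^ (11 * a) * (2 ^ a) ^ 3 := by
          gcongr
          · norm_num
          · omega
      _ = 2 ^ (14 * a) := by rw [← pow_mul, ← pow_add]; congr 1; ring
  calc _ ≤ (1 / 2 : ℝ) ^ (14 * a) * 2 ^ (14 * a) := mul_le_mul h2 h4 (by positivity) (by positivity)
    _ = 1 := by rw [← mul_pow]; norm_num

end Torus

/-! ### Missing edges, and sets with few of them -/

namespace ApproxClique

open Finset Mixing Torus

/-- `H` is the indicator of the non-edges of a graph on `0, …, n - 1`. -/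
structure IsNonEdge (n : ℕ) (H : ℕ → ℕ → ℕ) : Prop where
  symm : ∀ u v, H u v = H v u
  le_one : ∀ u v, H u v ≤ 1
  diag : ∀ u, H u u = 0
  supp : ∀ u v, n ≤ u → H u v = 0

/-- The number of non-neighbours of `v` in `S`. -/
def miss (n : ℕ) (H : ℕ → ℕ → ℕ) (S : ℕ → ℕ) (v : ℕ) : ℕ := ∑ w ∈ range n, H v w * S w

/-- The number of common non-neighbours. -/
def codeg (n : ℕ) (H : ℕ → ℕ → ℕ) (u w : ℕ) : ℕ := ∑ v ∈ range n, H u v * H w v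

/-- The squared distance of two sets, measured by the numbers of non-neighbours. -/
noncomputable def dist2 (n : ℕ) (H : ℕ → ℕ → ℕ) (S R : ℕ → ℕ) : ℝ :=
  ∑ v ∈ range n, ((miss n H S v : ℝ) - miss n H R v) ^ 2

/-- The positive terms of the estimate of `dist2` along the edges `u — W u c` of an expander. -/
def corrPos (n d : ℕ) (W : ℕ → ℕ → ℕ) (H : ℕ → ℕ → ℕ) (S R : ℕ → ℕ) : ℕ :=
  ∑ u ∈ range n, ∑ c ∈ range d,
    codeg n H u (W u c) * (S u * S (W u c) + R u * R (W u c))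

/-- The negative terms of the estimate of `dist2` along the edges `u — W u c` of an expander. -/
def corrNeg (n d : ℕ) (W : ℕ → ℕ → ℕ) (H : ℕ → ℕ → ℕ) (S R : ℕ → ℕ) : ℕ :=
  ∑ u ∈ range n, ∑ c ∈ range d,
    codeg n H u (W u c) * (S u * R (W u c) + R u * S (W u c))

theorem dist2_nonneg (n : ℕ) (H : ℕ → ℕ → ℕ) (S R : ℕ → ℕ) : 0 ≤ dist2 n H S R :=
  Finset.sum_nonneg fun _ _ => sq_nonneg _

/-- For each `v`, `nbr_bounds` is applied to the function u ↦ (S u - R u) H u v, whose sum is the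
difference of the numbers of non-neighbours. Summation over `v` turns the products of entries of `H`
into codegrees. The error arises from the `n` functions, each of squared norm at most `n`; the
points of the torus beyond `n` contribute nothing. -/
theorem corr_bounds {n m k : ℕ} [NeZero m] (hnm : n ≤ m * m) {H : ℕ → ℕ → ℕ}
    (hH : IsNonEdge n H) {S R : ℕ → ℕ} (hS : ∀ u, S u ≤ 1) (hR : ∀ u, R u ≤ 1) :
    dist2 n H S R * (16 ^ k : ℕ) ≤ (m * m : ℕ) * ((corrPos n (16 ^ k) (nbr m k) H S R : ℝ)
        - corrNeg n (16 ^ k) (nbr m k) H S R) ∧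
      (m * m : ℕ) * ((corrPos n (16 ^ k) (nbr m k) H S R : ℝ)
        - corrNeg n (16 ^ k) (nbr m k) H S R)
        ≤ (dist2 n H S R + (383 / 384) ^ k * (m * m : ℕ) * (n : ℝ) ^ 2) * (16 ^ k : ℕ) := by
  have hQ : (0 : ℝ) < (m * m : ℕ) := by
    have : 0 < m := NeZero.pos m
    positivity
  have hd : (0 : ℝ) < (16 ^ k : ℕ) := by positivity
  let x : ℕ → ℕ → ℝ := fun v u => ((S u : ℝ) - R u) * H u v
  have hx0 : ∀ v u, n ≤ u → x v u = 0 := fun v u hu => by simp [x, hH.supp u v hu]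
  have hsub : range n ⊆ range (m * m) := Finset.range_subset_range.2 hnm
  have hext : ∀ F : ℕ → ℝ, (∀ u, n ≤ u → F u = 0) →
      ∑ u ∈ range (m * m), F u = ∑ u ∈ range n, F u := by
    intro F hF
    symm
    exact Finset.sum_subset hsub fun u _ hu => hF u (not_lt.1 fun h => hu (mem_range.2 h))
  have hsum : ∀ v, ∑ u ∈ range (m * m), x v u = (miss n H S v : ℝ) - miss n H R v := by
    intro v
    rw [hext _ (hx0 v)]
    simp only [miss, x]
    push_cast
    rw [← Finset.sum_sub_distrib]
    refine Finset.sum_congr rfl fun u _ => ?_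
    rw [hH.symm v u]; ring
  have hsq : ∀ v, ∑ u ∈ range (m * m), x v u ^ 2 ≤ n := by
    intro v
    rw [hext _ fun u hu => by simp [hx0 v u hu]]
    calc ∑ u ∈ range n, x v u ^ 2 ≤ ∑ u ∈ range n, (1 : ℝ) := by
          refine Finset.sum_le_sum fun u _ => ?_
          have h1 : (S u : ℝ) ≤ 1 := by exact_mod_cast hS u
          have h2 : (R u : ℝ) ≤ 1 := by exact_mod_cast hR u
          have h3 : (H u v : ℝ) ≤ 1 := by exact_mod_cast hH.le_one u v
          have h4 : (0 : ℝ) ≤ S u := by positivity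
          have h5 : (0 : ℝ) ≤ R u := by positivity
          have h6 : (0 : ℝ) ≤ H u v := by positivity
          simp only [x, mul_pow]
          have a1 : ((S u : ℝ) - R u) ^ 2 ≤ 1 := by nlinarith
          have a2 : (H u v : ℝ) ^ 2 ≤ 1 := by nlinarith
          exact mul_le_one₀ a1 (by positivity) a2
      _ = n := by simp
  have hcorr : ∑ v ∈ range n, ∑ u ∈ range (m * m), ∑ c ∈ range (16 ^ k), x v u * x v (nbr m k u c)
      = (corrPos n (16 ^ k) (nbr m k) H S R : ℝ) - corrNeg n (16 ^ k) (nbr m k) H S R := by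
    simp_rw [fun v => hext (fun u => ∑ c ∈ range (16 ^ k), x v u * x v (nbr m k u c))
      fun u hu => by simp [hx0 v u hu]]
    rw [Finset.sum_comm]
    simp only [corrPos, corrNeg]
    push_cast
    rw [← Finset.sum_sub_distrib]
    refine Finset.sum_congr rfl fun u _ => ?_
    rw [← Finset.sum_sub_distrib, Finset.sum_comm]
    refine Finset.sum_congr rfl fun c _ => ?_
    simp only [codeg, x]
    push_cast
    rw [Finset.sum_mul, Finset.sum_mul, ← Finset.sum_sub_distrib]
    refine Finset.sum_congr rfl fun v _ => ?_
    ring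
  rw [← hcorr]
  have hb := fun v => nbr_bounds (m := m) k (x v)
  have e : (m * m : ℕ) * (∑ v ∈ range n, ∑ u ∈ range (m * m), ∑ c ∈ range (16 ^ k),
        x v u * x v (nbr m k u c))
      = (∑ v ∈ range n, (m * m : ℕ) * ((∑ u ∈ range (m * m), ∑ c ∈ range (16 ^ k),
        x v u * x v (nbr m k u c)) / (16 ^ k : ℕ))) * (16 ^ k : ℕ) := by
    rw [Finset.mul_sum, Finset.sum_mul]
    refine Finset.sum_congr rfl fun v _ => ?_
    field_simp
  rw [e]
  constructor
  · refine mul_le_mul_of_nonneg_right (Finset.sum_le_sum fun v _ => ?_) hd.le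
    have := (hb v).1
    rw [hsum, div_le_iff₀ hQ] at this
    linarith
  · refine mul_le_mul_of_nonneg_right ?_ hd.le
    have : ∀ v ∈ range n, (m * m : ℕ) * ((∑ u ∈ range (m * m), ∑ c ∈ range (16 ^ k),
        x v u * x v (nbr m k u c)) / (16 ^ k : ℕ))
        ≤ ((miss n H S v : ℝ) - miss n H R v) ^ 2 + (383 / 384) ^ k * (m * m : ℕ) * n := by
      intro v _
      have h1 := (hb v).2
      rw [hsum] at h1
      have h2 := mul_le_mul_of_nonneg_left (hsq v) (show (0 : ℝ) ≤ (383 / 384) ^ k by positivity)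
      calc _ ≤ (m * m : ℕ) * (((miss n H S v : ℝ) - miss n H R v) ^ 2 / (m * m : ℕ)
            + (383 / 384) ^ k * n) := mul_le_mul_of_nonneg_left (by linarith) hQ.le
        _ = _ := by field_simp
    refine (Finset.sum_le_sum this).trans (le_of_eq ?_)
    rw [Finset.sum_add_distrib, Finset.sum_const, card_range, nsmul_eq_mul, dist2]
    ring

/-! ### Sampling and a packing bound. -/

/-- The variance of the mean of `t` independent uniform samples. -/
theorem sum_sample_sq {n t : ℕ} (hn : 0 < n) (ht : 0 < t) (y : Fin n → ℝ) :
    ∑ a : Fin t → Fin n, ((∑ j, y (a j)) / t - (∑ i, y i) / n) ^ 2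
      ≤ (n : ℝ) ^ t * ((∑ i, y i ^ 2) / n / t) := by
  have hn' : (0 : ℝ) < n := by exact_mod_cast hn
  have ht' : (0 : ℝ) < t := by exact_mod_cast ht
  set μ : ℝ := (∑ i, y i) / n with hμ
  set z : Fin n → ℝ := fun i => y i - μ with hz
  have hz0 : ∑ i, z i = 0 := by
    simp only [hz, Finset.sum_sub_distrib, Finset.sum_const, card_univ, Fintype.card_fin,
      nsmul_eq_mul, hμ]
    field_simp; ring
  have hzsq : ∑ i, z i ^ 2 ≤ ∑ i, y i ^ 2 := by
    have : ∑ i, z i ^ 2 = ∑ i, y i ^ 2 - n * μ ^ 2 := by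
      have e : ∀ i, z i ^ 2 = y i ^ 2 - 2 * μ * y i + μ ^ 2 := fun i => by simp only [hz]; ring
      simp_rw [e, Finset.sum_add_distrib, Finset.sum_sub_distrib, ← Finset.mul_sum,
        Finset.sum_const, card_univ, Fintype.card_fin, nsmul_eq_mul]
      have : ∑ i, y i = n * μ := by rw [hμ]; field_simp
      rw [this]; ring
    rw [this]
    have : 0 ≤ (n : ℝ) * μ ^ 2 := by positivity
    linarith
  have hterm : ∀ a : Fin t → Fin n,
      ((∑ j, y (a j)) / t - μ) ^ 2 = (∑ i, ∑ j, z (a i) * z (a j)) / t ^ 2 := by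
    intro a
    rw [← Finset.sum_mul_sum]
    have : ∑ j, z (a j) = ∑ j, y (a j) - t * μ := by simp [hz, Finset.sum_sub_distrib]
    rw [this]; field_simp
  -- Independence: the mixed terms vanish because `z` has mean zero.
  have hpair : ∀ i j : Fin t, ∑ a : Fin t → Fin n, z (a i) * z (a j)
      = if i = j then (n : ℝ) ^ (t - 1) * ∑ i, z i ^ 2 else 0 := by
    intro i j
    have hprod : ∀ g : Fin t → Fin n → ℝ, ∑ a : Fin t → Fin n, ∏ l, g l (a l)
        = ∏ l, ∑ b, g l b := by
      intro g
      rw [Finset.prod_univ_sum, Fintype.piFinset_univ]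
    split_ifs with hij
    · subst hij
      have := hprod fun l b => if l = i then z b ^ 2 else 1
      have e1 : ∀ a : Fin t → Fin n, (∏ l, if l = i then z (a l) ^ 2 else 1) = z (a i) * z (a i) := by
        intro a; rw [Finset.prod_ite_eq' univ i fun l => z (a l) ^ 2]; simp [sq]
      simp_rw [e1] at this
      rw [this, ← Finset.mul_prod_erase univ _ (mem_univ i)]
      rw [Finset.prod_congr rfl (g := fun _ => (n : ℝ)) fun l hl => by
        simp [(Finset.mem_erase.1 hl).1]]
      rw [Finset.prod_const, Finset.card_erase_of_mem (mem_univ i), card_univ, Fintype.card_fin]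
      simp [mul_comm]
    · have := hprod fun l b => if l = i ∨ l = j then z b else 1
      have e1 : ∀ a : Fin t → Fin n, (∏ l, if l = i ∨ l = j then z (a l) else 1)
          = z (a i) * z (a j) := by
        intro a
        rw [Finset.prod_ite, Finset.prod_const_one, mul_one]
        have : univ.filter (fun l : Fin t => l = i ∨ l = j) = {i, j} := by ext l; simp
        rw [this, Finset.prod_pair hij]
      simp_rw [e1] at this
      rw [this]
      exact Finset.prod_eq_zero (mem_univ i) (by simpa using hz0)
  calc ∑ a : Fin t → Fin n, ((∑ j, y (a j)) / t - μ) ^ 2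
      = (∑ i : Fin t, ∑ j : Fin t, ∑ a : Fin t → Fin n, z (a i) * z (a j)) / t ^ 2 := by
        simp_rw [hterm]
        rw [← Finset.sum_div, Finset.sum_comm]
        congr 1
        exact Finset.sum_congr rfl fun i _ => Finset.sum_comm
    _ = t * ((n : ℝ) ^ (t - 1) * ∑ i, z i ^ 2) / t ^ 2 := by
        simp_rw [hpair]
        simp
    _ ≤ t * ((n : ℝ) ^ (t - 1) * ∑ i, y i ^ 2) / t ^ 2 := by gcongr
    _ = _ := by
        obtain ⟨s, rfl⟩ : ∃ s, t = s + 1 := ⟨t - 1, by omega⟩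
        rw [Nat.add_sub_cancel, pow_succ (n : ℝ)]
        field_simp

/-- A family of sets that are pairwise far apart with respect to `dist2` is small. -/
theorem packing {n r t : ℕ} (hn : 0 < n) (ht : 0 < t) {H : ℕ → ℕ → ℕ} (hH : ∀ u v, H u v ≤ 1)
    {R : ℕ → ℕ → ℕ} (hR : ∀ i u, R i u ≤ 1) {θ : ℝ} (hθ : 8 * (n : ℝ) ^ 3 / t ≤ θ)
    (hsep : ∀ i < r, ∀ j < i, θ < dist2 n H (R i) (R j)) : r ≤ 2 * 2 ^ t := by
  classical
  have hn' : (0 : ℝ) < n := by exact_mod_cast hn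
  have ht' : (0 : ℝ) < t := by exact_mod_cast ht
  -- One sample `a` serves all `v` at once, and the estimate depends on `R i` only through its `t`
  -- values on the sample.
  let est : ℕ → (Fin t → Fin n) → ℕ → ℝ := fun i a v =>
    (∑ j, (n : ℝ) * (H v (a j) * R i (a j))) / t
  let err : ℕ → (Fin t → Fin n) → ℝ := fun i a =>
    ∑ v ∈ range n, (est i a v - miss n H (R i) v) ^ 2
  have herr : ∀ i, ∑ a, err i a ≤ (n : ℝ) ^ t * ((n : ℝ) ^ 3 / t) := by
    intro i
    rw [Finset.sum_comm]
    have : ∀ v ∈ range n, ∑ a, (est i a v - miss n H (R i) v) ^ 2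
        ≤ (n : ℝ) ^ t * ((n : ℝ) ^ 2 / t) := by
      intro v _
      have h := sum_sample_sq hn ht fun b : Fin n => (n : ℝ) * (H v b * R i b)
      have e : (∑ b : Fin n, (n : ℝ) * (H v b * R i b)) / n = miss n H (R i) v := by
        rw [← Finset.mul_sum, mul_div_cancel_left₀ _ hn'.ne', miss]
        push_cast
        rw [Finset.sum_range]
      rw [e] at h
      refine h.trans ?_
      have hle : ∑ b : Fin n, ((n : ℝ) * (H v b * R i b)) ^ 2 ≤ n * (n : ℝ) ^ 2 := by
        calc _ ≤ ∑ b : Fin n, (n : ℝ) ^ 2 := by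
              refine Finset.sum_le_sum fun b _ => ?_
              have h1 : (H v b : ℝ) ≤ 1 := by exact_mod_cast hH v b
              have h2 : (R i b : ℝ) ≤ 1 := by exact_mod_cast hR i b
              have h3 : (H v b : ℝ) * R i b ≤ 1 := mul_le_one₀ h1 (by positivity) h2
              exact pow_le_pow_left₀ (by positivity) (by nlinarith) 2
          _ = _ := by simp
      gcongr
      rw [div_le_iff₀ hn']; linarith
    refine (Finset.sum_le_sum this).trans (le_of_eq ?_)
    rw [Finset.sum_const, card_range, nsmul_eq_mul]; ring
  let good : ℕ → Finset (Fin t → Fin n) := fun i =>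
    univ.filter fun a => err i a ≤ 2 * ((n : ℝ) ^ 3 / t)
  have hcard : (univ : Finset (Fin t → Fin n)).card = n ^ t := by simp
  -- Markov's inequality: at least half of all samples have at most twice the bound on the mean
  -- error.
  have hgood : ∀ i, (n : ℝ) ^ t ≤ 2 * (good i).card := by
    intro i
    have h1 : ((univ.filter fun a => ¬ err i a ≤ 2 * ((n : ℝ) ^ 3 / t)).card : ℝ)
        * (2 * ((n : ℝ) ^ 3 / t)) ≤ (n : ℝ) ^ t * ((n : ℝ) ^ 3 / t) := by
      refine le_trans ?_ (herr i)
      refine le_trans ?_ (Finset.sum_le_sum_of_subset_of_nonneg (Finset.filter_subset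
        (fun a => ¬ err i a ≤ 2 * ((n : ℝ) ^ 3 / t)) univ)
        fun a _ _ => Finset.sum_nonneg fun _ _ => sq_nonneg _)
      rw [← nsmul_eq_mul]
      exact Finset.card_nsmul_le_sum _ _ _ fun a ha => (not_le.1 (mem_filter.1 ha).2).le
    have h2 := Finset.card_filter_add_card_filter_not (s := (univ : Finset (Fin t → Fin n)))
      (fun a => err i a ≤ 2 * ((n : ℝ) ^ 3 / t))
    rw [hcard] at h2
    have h3 : ((good i).card : ℝ) + (univ.filter fun a => ¬ err i a ≤ 2 * ((n : ℝ) ^ 3 / t)).card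
        = (n : ℝ) ^ t := by rw [← Nat.cast_add, h2, Nat.cast_pow]
    have h4 : (0 : ℝ) < (n : ℝ) ^ 3 / t := by positivity
    have h5 : 2 * ((univ.filter fun a => ¬ err i a ≤ 2 * ((n : ℝ) ^ 3 / t)).card : ℝ)
        ≤ (n : ℝ) ^ t := by
      refine le_of_mul_le_mul_right ?_ h4
      linarith
    linarith
  -- By double counting, a single sample is good for at least half of the family.
  obtain ⟨a, ha⟩ : ∃ a, (r : ℝ) ≤ 2 * ((range r).filter fun i => a ∈ good i).card := by
    by_contra hcon
    push Not at hcon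
    have h1 : ∑ a : Fin t → Fin n, (2 * (((range r).filter fun i => a ∈ good i).card : ℝ))
        < ∑ a : Fin t → Fin n, (r : ℝ) := by
      refine Finset.sum_lt_sum_of_nonempty ⟨fun _ => ⟨0, hn⟩, mem_univ _⟩ fun a _ => hcon a
    rw [Finset.sum_const, hcard, nsmul_eq_mul, ← Finset.mul_sum] at h1
    have h2 : ∑ a : Fin t → Fin n, (((range r).filter fun i => a ∈ good i).card : ℝ)
        = ∑ i ∈ range r, ((good i).card : ℝ) := by
      have := Finset.sum_card_bipartiteAbove_eq_sum_card_bipartiteBelow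
        (s := (univ : Finset (Fin t → Fin n))) (t := range r) fun a i => a ∈ good i
      have e : ∀ i, (univ.filter fun a => a ∈ good i) = good i := fun i => by simp
      simp only [Finset.bipartiteAbove, Finset.bipartiteBelow, e] at this
      exact_mod_cast this
    rw [h2] at h1
    have h3 := Finset.sum_le_sum fun i (_ : i ∈ range r) => hgood i
    rw [Finset.sum_const, card_range, nsmul_eq_mul, ← Finset.mul_sum] at h3
    push_cast at h1
    linarith
  have hinj : ((range r).filter fun i => a ∈ good i).card
      ≤ (univ : Finset (Fin t → Fin 2)).card := by
    refine Finset.card_le_card_of_injOn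
      (fun i j => ⟨R i (a j), Nat.lt_succ_of_le (hR i (a j))⟩) (fun _ _ => mem_univ _) ?_
    have main : ∀ i j, i ∈ (range r).filter (fun i => a ∈ good i) →
        j ∈ (range r).filter (fun i => a ∈ good i) → j < i →
        (∀ l, R i (a l) = R j (a l)) → False := by
      intro i j hi hj hlt heq
      have hgi := (mem_filter.1 (mem_filter.1 hi).2).2
      have hgj := (mem_filter.1 (mem_filter.1 hj).2).2
      have hs := hsep i (mem_range.1 (mem_filter.1 hi).1) j hlt
      have hest : ∀ v, est i a v = est j a v := fun v => by simp only [est, heq]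
      -- Two sets that agree on the sample share their estimate; as both errors are at most 2n³/t,
      -- their distance would be at most 8n³/t, against the separation.
      have : dist2 n H (R i) (R j) ≤ 2 * err i a + 2 * err j a := by
        simp only [dist2, err, Finset.mul_sum]
        rw [← Finset.sum_add_distrib]
        refine Finset.sum_le_sum fun v _ => ?_
        rw [hest]
        nlinarith [sq_nonneg ((est j a v - miss n H (R i) v) + (est j a v - miss n H (R j) v))]
      have e8 : 8 * (n : ℝ) ^ 3 / t = 8 * ((n : ℝ) ^ 3 / t) := by ring
      linarith
    intro i hi j hj heq
    have heq' : ∀ l, R i (a l) = R j (a l) := fun l => by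
      have := congrFun heq l
      simpa using this
    rcases lt_trichotomy i j with h | h | h
    · exact (main j i hj hi h fun l => (heq' l).symm).elim
    · exact h
    · exact (main i j hi hj h heq').elim
  have : (univ : Finset (Fin t → Fin 2)).card = 2 ^ t := by simp
  rw [this] at hinj
  have h2 : (r : ℝ) ≤ 2 * (2 ^ t : ℕ) := ha.trans (by gcongr)
  exact_mod_cast h2

/-! ### Greedy selection by rounded values. -/

/-- Greedy selection of at most `K` elements of `S`, in `n` passes of increasing levels. -/
def select (n K : ℕ) (S f : ℕ → ℕ) : ℕ → Finset ℕ
  | 0 => ∅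
  | i + 1 =>
    if S (i % n) ≠ 0 ∧ i % n ∉ select n K S f i ∧ (select n K S f i).card < K
        ∧ f (i % n) < (i / n + 1) * K then
      insert (i % n) (select n K S f i)
    else select n K S f i

theorem select_subset {n : ℕ} (hn : 0 < n) (K : ℕ) (S f : ℕ → ℕ) (i : ℕ) :
    ∀ v ∈ select n K S f i, v < n ∧ S v ≠ 0 := by
  induction i with
  | zero => simp [select]
  | succ i ih =>
    rw [select]
    split_ifs with h
    · intro v hv
      rcases Finset.mem_insert.1 hv with rfl | hv
      · exact ⟨Nat.mod_lt _ hn, h.1⟩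
      · exact ih v hv
    · exact ih

theorem select_card_le (n K : ℕ) (S f : ℕ → ℕ) (i : ℕ) : (select n K S f i).card ≤ K := by
  induction i with
  | zero => simp [select]
  | succ i ih =>
    rw [select]
    split_ifs with h
    · rw [Finset.card_insert_of_notMem h.2.1]; exact h.2.2.1
    · exact ih

/-- As long as there is room, an element of `S` is passed over only because its value reaches the
threshold of the current pass. -/
theorem select_late {n : ℕ} (K : ℕ) (S f : ℕ → ℕ) (i : ℕ)
    (hc : (select n K S f i).card < K) {u : ℕ} (hS : S u ≠ 0)
    (hu : u ∉ select n K S f i) : ∀ j < i, j % n = u → (j / n + 1) * K ≤ f u := by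
  induction i with
  | zero => simp
  | succ i ih =>
    rw [select] at hc hu
    split_ifs at hc hu with h
    · intro j hj hju
      have hc' : (select n K S f i).card < K :=
        (Finset.card_le_card (Finset.subset_insert _ _)).trans_lt hc
      have hne : u ≠ i % n := fun e => hu (e ▸ Finset.mem_insert_self _ _)
      have hu' : u ∉ select n K S f i := fun e => hu (Finset.mem_insert_of_mem e)
      rcases Nat.lt_succ_iff_lt_or_eq.1 hj with hj | rfl
      · exact ih hc' hu' j hj hju
      · exact (hne hju.symm).elim
    · intro j hj hju
      rcases Nat.lt_succ_iff_lt_or_eq.1 hj with hj | rfl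
      · exact ih hc hu j hj hju
      · subst hju
        by_contra hlt
        exact h ⟨hS, hu, hc, not_le.1 hlt⟩

/-- When `v` enters during a pass, any `u` still missing was visited and refused in the preceding
pass, so the rounded value of `u` is no smaller than that of `v`. -/
theorem select_level {n : ℕ} (hn : 0 < n) {K : ℕ} (hK : 0 < K) (S f : ℕ → ℕ) (i : ℕ) :
    ∀ v ∈ select n K S f i, ∀ u < n, S u ≠ 0 → u ∉ select n K S f i → f v / K ≤ f u / K := by
  induction i with
  | zero => simp [select]
  | succ i ih =>
    have hlate := select_late (n := n) K S f i
    rw [select]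
    split_ifs with h
    · intro v hv u hun hSu hu
      have hu' : u ∉ select n K S f i := fun e => hu (Finset.mem_insert_of_mem e)
      rcases Finset.mem_insert.1 hv with rfl | hv
      · have h1 : f (i % n) / K ≤ i / n :=
          Nat.le_of_lt_succ ((Nat.div_lt_iff_lt_mul hK).2 h.2.2.2)
        refine h1.trans ?_
        rcases Nat.eq_zero_or_pos (i / n) with h0 | h0
        · rw [h0]; exact Nat.zero_le _
        · obtain ⟨l, hl⟩ : ∃ l, i / n = l + 1 := ⟨i / n - 1, by omega⟩
          have hlt : n * l + u < i := by
            have := Nat.div_mul_le_self i n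
            rw [hl, add_mul, one_mul, mul_comm] at this
            omega
          have h2 := hlate h.2.2.1 hSu hu' (n * l + u) hlt
            (by rw [Nat.mul_add_mod, Nat.mod_eq_of_lt hun])
          rw [Nat.mul_add_div hn, Nat.div_eq_of_lt hun, add_zero] at h2
          rw [hl]
          exact (Nat.le_div_iff_mul_le hK).2 h2
      · exact ih v hv u hun hSu hu'
    · exact ih

/-- An exchange argument: the elements chosen outside `A` are as many as those of `A` left out, and
none exceeds any of the latter by more than `K`, the width of a level. Rounding thus loses at most
`K * K` in all. -/
theorem select_spec {n : ℕ} (hn : 0 < n) {K : ℕ} {S f : ℕ → ℕ} {L : ℕ}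
    (hL : ∀ v < n, f v < L * K) {A : Finset ℕ} (hA : ∀ v ∈ A, v < n ∧ S v ≠ 0)
    (hAK : A.card = K) :
    (select n K S f (L * n)).card = K ∧
      ∑ v ∈ select n K S f (L * n), f v ≤ ∑ v ∈ A, f v + K * K := by
  rcases Nat.eq_zero_or_pos K with rfl | hK
  · have := select_card_le n 0 S f (L * n)
    have h0 : select n 0 S f (L * n) = ∅ := Finset.card_eq_zero.1 (by omega)
    simp [h0]
  set O := select n K S f (L * n) with hO
  have hcard : O.card = K := by
    by_contra hne
    have hlt : O.card < K := lt_of_le_of_ne (select_card_le n K S f _) hne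
    obtain ⟨u, huA, huO⟩ : ∃ u ∈ A, u ∉ O := by
      by_contra hcon
      push Not at hcon
      have := Finset.card_le_card (show A ⊆ O from hcon)
      omega
    obtain ⟨hun, hSu⟩ := hA u huA
    have hL0 : 0 < L := by
      rcases Nat.eq_zero_or_pos L with h | h
      · have := hL u hun; simp [h] at this
      · exact h
    obtain ⟨l, rfl⟩ : ∃ l, L = l + 1 := ⟨L - 1, by omega⟩
    have h1 := select_late (n := n) K S f _ hlt hSu huO (n * l + u)
      (by rw [add_mul, one_mul, mul_comm]; omega) (by rw [Nat.mul_add_mod, Nat.mod_eq_of_lt hun])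
    rw [Nat.mul_add_div hn, Nat.div_eq_of_lt hun, add_zero] at h1
    have := hL u hun
    omega
  refine ⟨hcard, ?_⟩
  have hcc : (O \ A).card = (A \ O).card := Finset.card_sdiff_comm (by rw [hcard, hAK])
  have hpt : ∀ v ∈ O \ A, ∀ u ∈ A \ O, f v ≤ f u + K := by
    intro v hv u hu
    rw [Finset.mem_sdiff] at hv hu
    have h1 := select_level hn hK S f (L * n) v hv.1 u (hA u hu.1).1 (hA u hu.1).2 hu.2
    have h2 := Nat.div_add_mod (f v) K
    have h3 := Nat.mod_lt (f v) hK
    have h4 := Nat.mul_div_le (f u) K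
    have h5 := Nat.mul_le_mul_left K h1
    omega
  have hsd : ∑ v ∈ O \ A, f v ≤ ∑ u ∈ A \ O, f u + (A \ O).card * K := by
    rcases Nat.eq_zero_or_pos (A \ O).card with h0 | h0
    · have : O \ A = ∅ := Finset.card_eq_zero.1 (by omega)
      simp [this]
    · refine Nat.le_of_mul_le_mul_left ?_ h0
      calc (A \ O).card * ∑ v ∈ O \ A, f v = ∑ v ∈ O \ A, ∑ u ∈ A \ O, f v := by
            rw [Finset.mul_sum]; exact Finset.sum_congr rfl fun v _ => by simp
        _ ≤ ∑ v ∈ O \ A, ∑ u ∈ A \ O, (f u + K) :=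
            Finset.sum_le_sum fun v hv => Finset.sum_le_sum fun u hu => hpt v hv u hu
        _ = _ := by
            rw [Finset.sum_const, hcc, Finset.sum_add_distrib, Finset.sum_const, smul_eq_mul,
              smul_eq_mul]
  have h1 := Finset.sum_inter_add_sum_sdiff O A f
  have h2 := Finset.sum_inter_add_sum_sdiff A O f
  rw [Finset.inter_comm] at h2
  have h3 : (A \ O).card * K ≤ K * K :=
    Nat.mul_le_mul_right _ (hAK ▸ Finset.card_le_card Finset.sdiff_subset)
  omega

/-! ### Replacing a set by a nearby representative. -/

theorem sum_miss_sub_sq_le {n : ℕ} {H : ℕ → ℕ → ℕ} {S R : ℕ → ℕ} {D : Finset ℕ}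
    (hD : D ⊆ range n) :
    (∑ v ∈ D, ((miss n H S v : ℝ) - miss n H R v)) ^ 2 ≤ D.card * dist2 n H S R := by
  refine sq_sum_le_card_mul_sum_sq.trans ?_
  gcongr
  exact Finset.sum_le_sum_of_subset_of_nonneg hD fun _ _ _ => sq_nonneg _

/-- By Cauchy–Schwarz the squared sum is at most `K * dist2`, and 256 = 16². This fixes how close a
representative has to be: total counts over `K` vertices change by at most K²/(16E). -/
theorem abs_sum_miss_sub_le {n : ℕ} {H : ℕ → ℕ → ℕ} {S R : ℕ → ℕ} {D : Finset ℕ}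
    (hD : D ⊆ range n) {K E : ℕ} (hE : 0 < E) (hK : D.card = K)
    (hd : 256 * (E : ℝ) ^ 2 * dist2 n H S R ≤ (K : ℝ) ^ 3) :
    16 * E * |∑ v ∈ D, ((miss n H S v : ℝ) - miss n H R v)| ≤ (K : ℝ) ^ 2 := by
  have hE' : (0 : ℝ) < E := by exact_mod_cast hE
  have h := sum_miss_sub_sq_le (H := H) (S := S) (R := R) hD
  rw [hK] at h
  refine le_of_sq_le_sq ?_ (by positivity)
  rw [mul_pow, sq_abs]
  have hK0 : (0 : ℝ) ≤ K := by positivity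
  calc (16 * (E : ℝ)) ^ 2 * (∑ v ∈ D, ((miss n H S v : ℝ) - miss n H R v)) ^ 2
      ≤ (16 * (E : ℝ)) ^ 2 * (K * dist2 n H S R) := by gcongr
    _ = K * (256 * (E : ℝ) ^ 2 * dist2 n H S R) := by ring
    _ ≤ K * (K : ℝ) ^ 3 := by gcongr
    _ = ((K : ℝ) ^ 2) ^ 2 := by ring

/-- A set that looks dense from a nearby set is dense. -/
theorem dense_of_close {n : ℕ} {H : ℕ → ℕ → ℕ} (hH : IsNonEdge n H) {S R : ℕ → ℕ} {D : Finset ℕ}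
    (hD : ∀ v ∈ D, v < n ∧ S v ≠ 0) {K E : ℕ} (hE : 0 < E) (hK : D.card = K)
    (hd : 256 * (E : ℝ) ^ 2 * dist2 n H S R ≤ (K : ℝ) ^ 3)
    (htot : 4 * E * ∑ v ∈ D, miss n H R v ≤ K * K) :
    E * ∑ u ∈ D, ∑ v ∈ D, H u v ≤ K * (K - 1) := by
  have hDn : D ⊆ range n := fun v hv => mem_range.2 (hD v hv).1
  -- For K ≤ 1 the right-hand side is 0, but then `D` has no pair of distinct elements.
  rcases Nat.lt_or_ge K 2 with hK2 | hK2
  · have : ∑ u ∈ D, ∑ v ∈ D, H u v = 0 := by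
      refine Finset.sum_eq_zero fun u hu => Finset.sum_eq_zero fun v hv => ?_
      have : u = v := Finset.card_le_one.1 (by omega) u hu v hv
      rw [this, hH.diag]
    simp [this]
  have h1 : ∑ u ∈ D, ∑ v ∈ D, H u v ≤ ∑ u ∈ D, miss n H S u := by
    refine Finset.sum_le_sum fun u _ => ?_
    calc ∑ v ∈ D, H u v ≤ ∑ v ∈ D, H u v * S v := Finset.sum_le_sum fun v hv =>
          Nat.le_mul_of_pos_right _ (Nat.pos_of_ne_zero (hD v hv).2)
      _ ≤ miss n H S u := Finset.sum_le_sum_of_subset hDn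
  have h2 := abs_sum_miss_sub_le hDn hE hK hd
  rw [Finset.sum_sub_distrib] at h2
  have hE' : (0 : ℝ) < E := by exact_mod_cast hE
  have h3 := le_abs_self (∑ v ∈ D, (miss n H S v : ℝ) - ∑ v ∈ D, (miss n H R v : ℝ))
  have h4 : 4 * (E : ℝ) * ∑ v ∈ D, (miss n H R v : ℝ) ≤ K * K := by exact_mod_cast htot
  have h5 : ((∑ u ∈ D, ∑ v ∈ D, H u v : ℕ) : ℝ) ≤ ∑ v ∈ D, (miss n H S v : ℝ) := by
    exact_mod_cast h1
  -- The left-hand side is at most (1/4 + 1/16)K², which is below K²/2 ≤ K(K - 1) since K ≥ 2.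
  have h6 : (E : ℝ) * (∑ u ∈ D, ∑ v ∈ D, H u v : ℕ) ≤ K * ((K : ℝ) - 1) := by
    have hK2' : (2 : ℝ) ≤ K := by exact_mod_cast hK2
    have a1 := mul_le_mul_of_nonneg_left h5 hE'.le
    have a2 := mul_le_mul_of_nonneg_left h3 hE'.le
    nlinarith
  have h7 : (K : ℝ) * ((K : ℝ) - 1) = ((K * (K - 1) : ℕ) : ℝ) := by
    push_cast [Nat.cast_sub (show 1 ≤ K by omega)]; ring
  rw [h7] at h6
  exact_mod_cast h6

/-- The greedy selection succeeds when it is guided by a set close to a good one. -/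
theorem select_succeeds {n : ℕ} (hn : 0 < n) {H : ℕ → ℕ → ℕ} (hH : IsNonEdge n H) {S R : ℕ → ℕ}
    (hR : ∀ u, R u ≤ 1) {K E a : ℕ} (hE : 0 < E) (ha : n * E < a * K) {A : Finset ℕ}
    (hA : ∀ v ∈ A, v < n ∧ S v ≠ 0) (hAK : A.card = K)
    (hd : 256 * (E : ℝ) ^ 2 * dist2 n H S R ≤ (K : ℝ) ^ 3)
    (hq : 16 * (E : ℝ) * ∑ v ∈ A, (miss n H S v : ℝ) ≤ (K : ℝ) ^ 2) :
    (select n K S (fun v => 8 * E * miss n H R v) (8 * a * n)).card = K ∧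
      4 * E * ∑ v ∈ select n K S (fun v => 8 * E * miss n H R v) (8 * a * n), miss n H R v
        ≤ K * K := by
  have hAn : A ⊆ range n := fun v hv => mem_range.2 (hA v hv).1
  -- Hence `8 * a` levels of width `K` cover all values.
  have hlev : ∀ v < n, 8 * E * miss n H R v < 8 * a * K := by
    intro v _
    have : miss n H R v ≤ n := by
      calc miss n H R v ≤ ∑ w ∈ range n, 1 := Finset.sum_le_sum fun w _ =>
            (Nat.mul_le_mul (hH.le_one v w) (hR w))
        _ = n := by simp
    calc 8 * E * miss n H R v ≤ 8 * E * n := Nat.mul_le_mul_left _ this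
      _ = 8 * (n * E) := by ring
      _ < 8 * (a * K) := by omega
      _ = 8 * a * K := by ring
  obtain ⟨h1, h2⟩ := select_spec hn hlev hA hAK
  refine ⟨h1, ?_⟩
  rw [← Finset.mul_sum, ← Finset.mul_sum] at h2
  have h3 := abs_sum_miss_sub_le hAn hE hAK hd
  rw [Finset.sum_sub_distrib] at h3
  have h4 := neg_abs_le (∑ v ∈ A, (miss n H S v : ℝ) - ∑ v ∈ A, (miss n H R v : ℝ))
  have hE' : (0 : ℝ) < E := by exact_mod_cast hE
  -- The count for `S` and the passage from `S` to `R` each contribute at most K²/(16E). The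
  -- rounding in the selection will add one more `K * K`.
  have h5 : 8 * (E : ℝ) * ∑ v ∈ A, (miss n H R v : ℝ) ≤ (K : ℝ) * K := by
    have a1 := mul_le_mul_of_nonneg_left h4 hE'.le
    nlinarith
  have h6 : 8 * E * ∑ v ∈ A, miss n H R v ≤ K * K := by exact_mod_cast h5
  nlinarith

/-- The common neighbourhood of the first `s + 1` vertices of a walk. -/
def common (H : ℕ → ℕ → ℕ) (x : ℕ → ℕ) (s v : ℕ) : ℕ := ∏ t ∈ range s, (1 - H (x t) v)

/-- Let X v consist of the w in `A` with H w v = 0. A vertex v belongs to the common neighbourhood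
of a walk in `A` exactly if the walk stays in X v, and the defect of X v is the number of
non-neighbours of v in `A`. So `exists_walk_nbr` bounds the number of non-edges between `A` and the
common neighbourhood, which is then counted from the side of `A`. -/
theorem exists_good_walk {n m k : ℕ} [NeZero m] (hnm : n ≤ m * m) {H : ℕ → ℕ → ℕ}
    (hH : IsNonEdge n H) {A : Finset ℕ} (hAn : A ⊆ range n) (hA : A.Nonempty)
    (hcl : ∀ u ∈ A, ∀ v ∈ A, H u v = 0) {s : ℕ} (hs : 0 < s) :
    ∃ u < m * m, ∃ c < (16 ^ k) ^ (s + 1),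
      (∀ v ∈ A, common H (walk (16 ^ k) (nbr m k) u c) (s + 1) v ≠ 0) ∧
      ∑ v ∈ A, (miss n H (fun v => if v < n then
          common H (walk (16 ^ k) (nbr m k) u c) (s + 1) v else 0) v : ℝ)
        ≤ n * (A.card * (1 / s + (383 / 384) ^ k * (m * m : ℕ) / A.card)) := by
  classical
  obtain ⟨u, hu, c, hc, h1, h2⟩ := exists_walk_nbr (m := m) k
    (hAn.trans (Finset.range_subset_range.2 hnm)) hA hs (range n)
    (fun v => A.filter fun w => H w v = 0) fun v _ => Finset.filter_subset _ _
  set x := walk (16 ^ k) (nbr m k) u c with hx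
  have hle : ∀ v, common H x (s + 1) v ≤ 1 := fun v =>
    Finset.prod_le_one' fun t _ => Nat.sub_le _ _
  have hne : ∀ v, common H x (s + 1) v ≠ 0 ↔ ∀ t < s + 1, H (x t) v = 0 := by
    intro v
    rw [common, Finset.prod_ne_zero_iff]
    refine ⟨fun h t ht => ?_, fun h t ht => ?_⟩
    · have := h t (mem_range.2 ht); omega
    · have := h t (mem_range.1 ht); omega
  refine ⟨u, hu, c, hc, fun v hv => (hne v).2 fun t ht => hcl _ (h1 t ht) v hv, ?_⟩
  have h3 := h2 ((range n).filter fun v => common H x (s + 1) v ≠ 0) (Finset.filter_subset _ _)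
    fun v hv t ht => mem_filter.2 ⟨h1 t ht, (hne v).1 (mem_filter.1 hv).2 t ht⟩
  rw [card_range] at h3
  refine le_trans (le_of_eq ?_) h3
  have hdef : ∀ v, (A.card : ℝ) - (A.filter fun w => H w v = 0).card
      = ∑ w ∈ A, (H w v : ℝ) := by
    intro v
    have e1 := Finset.card_filter_add_card_filter_not (s := A) fun w => H w v = 0
    have e2 : ∑ w ∈ A, H w v = (A.filter fun w => ¬ H w v = 0).card := by
      rw [Finset.card_filter]
      refine Finset.sum_congr rfl fun w _ => ?_
      have := hH.le_one w v
      split_ifs <;> omega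
    have e3 : (A.card : ℝ) = (A.filter fun w => H w v = 0).card + ∑ w ∈ A, (H w v : ℝ) := by
      rw [← e1]; push_cast [← e2]; ring
    linarith
  simp_rw [hdef]
  rw [Finset.sum_filter]
  have hsplit : ∀ v, (if common H x (s + 1) v ≠ 0 then ∑ w ∈ A, (H w v : ℝ) else 0)
      = ∑ w ∈ A, (H w v : ℝ) * common H x (s + 1) v := by
    intro v
    have := hle v
    split_ifs with h
    · simp [show common H x (s + 1) v = 1 by omega]
    · simp [not_not.1 h]
  simp_rw [hsplit]
  rw [Finset.sum_comm]
  refine Finset.sum_congr rfl fun w _ => ?_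
  simp only [miss]
  push_cast
  refine Finset.sum_congr rfl fun v hv => ?_
  rw [if_pos (mem_range.1 hv)]

end ApproxClique

/-! ### A program logic for the random access machine -/

namespace RAM

/-- The banks that the program writes to. -/
def Prog.writes : Prog → List ℕ
  | .skip => []
  | .set a _ _ => [a]
  | .read a _ => [a]
  | .seq p q => p.writes ++ q.writes
  | .ite _ p q => p.writes ++ q.writes
  | .loop _ p => p.writes

/-- The number of nodes of an expression. -/
def Expr.nodes : Expr → ℕ
  | .lit _ => 1
  | .get _ e => e.nodes + 1
  | .bin _ e₁ e₂ => e₁.nodes + e₂.nodes + 1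

/-- An exponent `k` such that the value of the expression is at most `2 ^ (k * l)`, when all cells
hold values up to `2 ^ (20 * l)`. -/
def Expr.expo : Expr → ℕ
  -- The crude bound c ≤ 2^c suffices for literals. The largest one in use is 5376, whence the limit
  -- 6000 on exponents below.
  | .lit c => c
  | .get _ _ => 20
  | .bin .add e₁ e₂ => max e₁.expo e₂.expo + 1
  | .bin .sub e₁ _ => e₁.expo
  | .bin .mul e₁ e₂ => e₁.expo + e₂.expo
  | .bin .div e₁ _ => e₁.expo

/-- The expression does not use bank `0`, and all its subexpressions have exponents up to `6000`. -/
def Expr.ok : Expr → Bool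
  | .lit c => decide (c ≤ 6000)
  -- Bank 0 holds the numerators and denominators, which obey no bound in terms of `l`.
  | .get a e => decide (a ≠ 0) && e.ok
  | .bin op e₁ e₂ => decide ((Expr.bin op e₁ e₂).expo ≤ 6000) && e₁.ok && e₂.ok

/-- All banks but the first hold values up to `2 ^ (20 * l)`. -/
def Bdd (l : ℕ) (m : Mem) : Prop := ∀ a, a ≠ 0 → ∀ i, m a i ≤ 2 ^ (20 * l)

/-- An upper bound for the time to evaluate a node of an expression. -/
def tick (l : ℕ) : ℕ := 2 * (6000 * l + 2)

theorem Bdd.write {l : ℕ} {m : Mem} (h : Bdd l m) {v : ℕ} (hv : v ≤ 2 ^ (20 * l)) (a i : ℕ) :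
    Bdd l (m.write a i v) := by
  intro b hb j
  unfold Mem.write
  split_ifs
  · exact hv
  · exact h b hb j

theorem Expr.val_le {l : ℕ} (hl : 0 < l) {m : Mem} (h : Bdd l m) (e : Expr) (he : e.ok = true) :
    e.val m ≤ 2 ^ (e.expo * l) := by
  induction e with
  | lit c =>
    exact Nat.lt_two_pow_self.le.trans (Nat.pow_le_pow_right (by norm_num) (Nat.le_mul_of_pos_right _ hl))
  | get a e _ =>
    simp only [Expr.ok, Bool.and_eq_true, decide_eq_true_eq] at he
    exact h a he.1 _
  | bin op e₁ e₂ h₁ h₂ =>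
    simp only [Expr.ok, Bool.and_eq_true, decide_eq_true_eq] at he
    have h₁ := h₁ he.1.2
    have h₂ := h₂ he.2
    cases op with
    | add =>
      simp only [Expr.val, Op.apply, Expr.expo]
      have a₁ : 2 ^ (e₁.expo * l) ≤ 2 ^ (max e₁.expo e₂.expo * l) :=
        Nat.pow_le_pow_right (by norm_num) (Nat.mul_le_mul_right _ (le_max_left _ _))
      have a₂ : 2 ^ (e₂.expo * l) ≤ 2 ^ (max e₁.expo e₂.expo * l) :=
        Nat.pow_le_pow_right (by norm_num) (Nat.mul_le_mul_right _ (le_max_right _ _))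
      have a₃ : 2 ^ (max e₁.expo e₂.expo * l + 1) ≤ 2 ^ ((max e₁.expo e₂.expo + 1) * l) :=
        Nat.pow_le_pow_right (by norm_num) (by rw [add_mul, one_mul]; omega)
      rw [pow_succ] at a₃
      omega
    | sub => exact (Nat.sub_le _ _).trans h₁
    | mul =>
      simp only [Expr.val, Op.apply, Expr.expo, add_mul, pow_add]
      exact Nat.mul_le_mul h₁ h₂
    | div => exact (Nat.div_le_self _ _).trans h₁

theorem Expr.expo_le {e : Expr} (he : e.ok = true) : e.expo ≤ 6000 := by
  cases e with
  | lit c => simpa [Expr.ok, Expr.expo] using he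
  | get a e => simp [Expr.expo]
  | bin op e₁ e₂ =>
    simp only [Expr.ok, Bool.and_eq_true, decide_eq_true_eq] at he
    exact he.1.1

theorem Expr.two_mul_len_le {l : ℕ} (hl : 0 < l) {m : Mem} (h : Bdd l m) {e : Expr}
    (he : e.ok = true) : 2 * len (e.val m) ≤ tick l := by
  have h1 := e.val_le hl h he
  have h2 : e.val m < 2 ^ (e.expo * l + 1) := by rw [pow_succ]; have := Nat.two_pow_pos (e.expo * l); omega
  have h3 := Nat.size_le.2 h2
  have h4 : e.expo * l ≤ 6000 * l := Nat.mul_le_mul_right _ (Expr.expo_le he)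
  unfold len tick
  omega

theorem Expr.cost_le {l : ℕ} (hl : 0 < l) {m : Mem} (h : Bdd l m) (e : Expr) (he : e.ok = true) :
    e.cost m ≤ e.nodes * tick l := by
  induction e with
  | lit c =>
    have := Expr.two_mul_len_le hl h he
    simp only [Expr.cost, Expr.nodes, Expr.val] at *
    omega
  | get a e ih =>
    have h1 := Expr.two_mul_len_le hl h he
    simp only [Expr.ok, Bool.and_eq_true, decide_eq_true_eq] at he
    have h2 := Expr.two_mul_len_le hl h he.2
    have h3 := ih he.2
    simp only [Expr.cost, Expr.nodes, Expr.val, add_mul, one_mul] at *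
    omega
  | bin op e₁ e₂ h₁ h₂ =>
    simp only [Expr.ok, Bool.and_eq_true, decide_eq_true_eq] at he
    have a₁ := Expr.two_mul_len_le hl h he.1.2
    have a₂ := Expr.two_mul_len_le hl h he.2
    have b₁ := h₁ he.1.2
    have b₂ := h₂ he.2
    simp only [Expr.cost, Expr.nodes, add_mul, one_mul] at *
    omega

/-- From the memory `m`, the program `p` halts after some number `t` of ticks with a memory `m'`
such that `Q t m'`; it reads no bits, and keeps all values bounded. -/
def Runs (l : ℕ) (ω : ℕ → Bool) (p : Prog) (m : Mem) (Q : ℕ → Mem → Prop) : Prop :=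
  Bdd l m → ∀ pos, ∃ t T m', Exec ω p ⟨m, pos⟩ T ⟨m', pos⟩ ∧ T ≤ t * tick l ∧ Bdd l m' ∧
    (∀ a, a ∉ p.writes → m' a = m a) ∧ Q t m'

variable {l : ℕ} {ω : ℕ → Bool}

theorem Runs.mono {p : Prog} {m : Mem} {Q Q' : ℕ → Mem → Prop} (h : Runs l ω p m Q)
    (hQ : ∀ t m', Bdd l m' → (∀ a, a ∉ p.writes → m' a = m a) → Q t m' → Q' t m') :
    Runs l ω p m Q' := by
  intro hm pos
  obtain ⟨t, T, m', h1, h2, h3, h4, h5⟩ := h hm pos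
  exact ⟨t, T, m', h1, h2, h3, h4, hQ t m' h3 h4 h5⟩

theorem Runs.skip {m : Mem} {Q : ℕ → Mem → Prop} (h : Q 1 m) : Runs l ω .skip m Q := by
  intro hm pos
  refine ⟨1, 1, m, .skip _, ?_, hm, fun _ _ => rfl, h⟩
  unfold tick; omega

theorem Runs.set (hl : 0 < l) {a : ℕ} {i e : Expr} {m : Mem} {Q : ℕ → Mem → Prop}
    (hi : i.ok = true) (he : e.ok = true) (hv : Bdd l m → e.val m ≤ 2 ^ (20 * l))
    (h : Q (i.nodes + e.nodes + 1) (m.write a (i.val m) (e.val m))) :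
    Runs l ω (.set a i e) m Q := by
  intro hm pos
  refine ⟨_, _, _, .set a i e _, ?_, hm.write (hv hm) _ _, ?_, h⟩
  · have := i.cost_le hl hm hi
    have := e.cost_le hl hm he
    have := Expr.two_mul_len_le hl hm hi
    have := Expr.two_mul_len_le hl hm he
    simp only [add_mul, one_mul]
    omega
  · intro b hb
    simp only [Prog.writes, List.mem_singleton] at hb
    funext j
    simp [Mem.write, hb]

theorem Runs.seq {p q : Prog} {m : Mem} {Q : ℕ → Mem → Prop}
    (h : Runs l ω p m fun t m' => Runs l ω q m' fun t' m'' => Q (t + t') m'') :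
    Runs l ω (.seq p q) m Q := by
  intro hm pos
  obtain ⟨t, T, m', h1, h2, h3, h4, h5⟩ := h hm pos
  obtain ⟨t', T', m'', g1, g2, g3, g4, g5⟩ := h5 h3 pos
  refine ⟨t + t', T + T', m'', .seq h1 g1, by rw [add_mul]; omega, g3, ?_, g5⟩
  intro a ha
  simp only [Prog.writes, List.mem_append, not_or] at ha
  rw [g4 a ha.2, h4 a ha.1]

theorem Runs.ite (hl : 0 < l) {e : Expr} {p q : Prog} {m : Mem} {Q : ℕ → Mem → Prop}
    (he : e.ok = true)
    (hp : e.val m ≠ 0 → Runs l ω p m fun t m' => Q (e.nodes + 1 + t) m')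
    (hq : e.val m = 0 → Runs l ω q m fun t m' => Q (e.nodes + 1 + t) m') :
    Runs l ω (.ite e p q) m Q := by
  intro hm pos
  have c1 := e.cost_le hl hm he
  have c2 := Expr.two_mul_len_le hl hm he
  by_cases h : e.val m = 0
  · obtain ⟨t, T, m', h1, h2, h3, h4, h5⟩ := hq h hm pos
    refine ⟨_, _, m', .ite_false p h h1, ?_, h3, ?_, h5⟩
    · simp only [add_mul, one_mul]; omega
    · intro a ha
      simp only [Prog.writes, List.mem_append, not_or] at ha
      exact h4 a ha.2
  · obtain ⟨t, T, m', h1, h2, h3, h4, h5⟩ := hp h hm pos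
    refine ⟨_, _, m', .ite_true q h h1, ?_, h3, ?_, h5⟩
    · simp only [add_mul, one_mul]; omega
    · intro a ha
      simp only [Prog.writes, List.mem_append, not_or] at ha
      exact h4 a ha.1

/-- The scalar variable kept in cell `0` of a bank. -/
abbrev Expr.var (a : ℕ) : Expr := .get a (.lit 0)

instance : Add Expr := ⟨.bin .add⟩
instance : Sub Expr := ⟨.bin .sub⟩
instance : Mul Expr := ⟨.bin .mul⟩
instance : Div Expr := ⟨.bin .div⟩
instance (n : ℕ) : OfNat Expr n := ⟨.lit n⟩

@[simp] theorem Expr.val_lit (m : Mem) (c : ℕ) : (Expr.lit c).val m = c := rfl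
@[simp] theorem Expr.val_ofNat (m : Mem) (n : ℕ) : (ofNat(n) : Expr).val m = OfNat.ofNat n := rfl
@[simp] theorem Expr.val_get (m : Mem) (a : ℕ) (e : Expr) : (get a e).val m = m a (e.val m) := rfl
@[simp] theorem Expr.val_add (m : Mem) (e f : Expr) : (e + f).val m = e.val m + f.val m := rfl
@[simp] theorem Expr.val_sub (m : Mem) (e f : Expr) : (e - f).val m = e.val m - f.val m := rfl
@[simp] theorem Expr.val_mul (m : Mem) (e f : Expr) : (e * f).val m = e.val m * f.val m := rfl
@[simp] theorem Expr.val_div (m : Mem) (e f : Expr) : (e / f).val m = e.val m / f.val m := rfl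
theorem Expr.val_var (m : Mem) (a : ℕ) : (Expr.var a).val m = m a 0 := rfl

@[simp] theorem Expr.nodes_lit (c : ℕ) : (lit c).nodes = 1 := rfl
@[simp] theorem Expr.nodes_ofNat (n : ℕ) : (ofNat(n) : Expr).nodes = 1 := rfl
@[simp] theorem Expr.nodes_get (a : ℕ) (e : Expr) : (get a e).nodes = e.nodes + 1 := rfl
@[simp] theorem Expr.nodes_add (e f : Expr) : (e + f).nodes = e.nodes + f.nodes + 1 := rfl
@[simp] theorem Expr.nodes_sub (e f : Expr) : (e - f).nodes = e.nodes + f.nodes + 1 := rfl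
@[simp] theorem Expr.nodes_mul (e f : Expr) : (e * f).nodes = e.nodes + f.nodes + 1 := rfl
@[simp] theorem Expr.nodes_div (e f : Expr) : (e / f).nodes = e.nodes + f.nodes + 1 := rfl

theorem Mem.write_same (m : Mem) (a i v : ℕ) : m.write a i v a i = v := by simp [Mem.write]

theorem Mem.write_idx (m : Mem) (a i v j : ℕ) :
    m.write a i v a j = if j = i then v else m a j := by simp [Mem.write]

theorem Mem.write_of_ne (m : Mem) {a b : ℕ} (h : b ≠ a) (i v : ℕ) : m.write a i v b = m b := by
  funext j; simp [Mem.write, h]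

/-- Counting loop: for `i = 0, …, e - 1` do `p`. -/
def Prog.count (i : ℕ) (e : Expr) (p : Prog) : Prog :=
  .seq (.set i 0 0) (.loop (e - .var i) (.seq p (.set i 0 (.var i + 1))))

/-- Amortised analysis: one round may exceed `T` by the growth of the potential `Φ`. In the search
this pays for the rare rounds that take quadratic time. The bound `e` is evaluated anew in each
round, so its value must not depend on what the body writes. -/
theorem Runs.count_potential (hl : 0 < l) {i : ℕ} {e : Expr} {p : Prog} {m : Mem}
    {Q : ℕ → Mem → Prop} (N : ℕ) (I : ℕ → Mem → Prop) (Φ : Mem → ℕ) (T : ℕ)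
    (hi : i ≠ 0) (hip : i ∉ p.writes) (he : (e - .var i).ok = true)
    (hval : ∀ m', (∀ a, a ≠ i → a ∉ p.writes → m' a = m a) → e.val m' = N)
    (hN : N ≤ 2 ^ (20 * l)) (h0 : I 0 (m.write i 0 0))
    (hstep : ∀ j < N, ∀ m', Bdd l m' → (∀ a, a ≠ i → a ∉ p.writes → m' a = m a) → m' i 0 = j →
      I j m' → Runs l ω p m' fun t m'' =>
        t + Φ m' ≤ T + Φ (m''.write i 0 (j + 1)) ∧ I (j + 1) (m''.write i 0 (j + 1)))
    (hQ : ∀ t m', Bdd l m' → (∀ a, a ≠ i → a ∉ p.writes → m' a = m a) → m' i 0 = N → I N m' →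
      t + Φ (m.write i 0 0) ≤ N * (T + (e.nodes + 10)) + (e.nodes + 10) + Φ m' → Q t m') :
    Runs l ω (.count i e p) m Q := by
  have hok : (Expr.var i + 1).ok = true := by
    show (Expr.bin .add (.get i (.lit 0)) (.lit 1)).ok = true
    simp [Expr.ok, Expr.expo, hi]
  have hloop : ∀ k j, j + k = N → ∀ m', Bdd l m' → (∀ a, a ≠ i → a ∉ p.writes → m' a = m a) →
      m' i 0 = j → I j m' → Runs l ω (.loop (e - .var i) (.seq p (.set i 0 (.var i + 1)))) m'
        fun t m'' => (∀ a, a ≠ i → a ∉ p.writes → m'' a = m a) ∧ m'' i 0 = N ∧ I N m'' ∧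
          t + Φ m' ≤ k * (T + (e.nodes + 10)) + (e.nodes + 5) + Φ m'' := by
    intro k
    induction k with
    | zero =>
      intro j hj m' _ hfr hij hI hm pos
      have hz : (e - Expr.var i).val m' = 0 := by
        rw [Expr.val_sub, hval m' hfr, Expr.val_var, hij]; omega
      have c1 := (e - Expr.var i).cost_le hl hm he
      have c2 := Expr.two_mul_len_le hl hm he
      have hnodes : (e - Expr.var i).nodes = e.nodes + 3 := rfl
      obtain rfl : j = N := by omega
      refine ⟨e.nodes + 4, _, m', .loop_done _ hz, ?_, hm, fun _ _ => rfl, hfr, hij, hI, by omega⟩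
      rw [hnodes] at c1
      simp only [add_mul] at *
      omega
    | succ k ih =>
      intro j hj m' hB hfr hij hI hm pos
      have hz : (e - Expr.var i).val m' ≠ 0 := by
        rw [Expr.val_sub, hval m' hfr, Expr.val_var, hij]; omega
      have c1 := (e - Expr.var i).cost_le hl hm he
      have c2 := Expr.two_mul_len_le hl hm he
      have hnodes : (e - Expr.var i).nodes = e.nodes + 3 := rfl
      obtain ⟨t, T', m'', h1, h2, h3, h4, h5, h6⟩ :=
        hstep j (by omega) m' hB hfr hij hI hm pos
      have hij'' : m'' i 0 = j := by rw [h4 i hip, hij]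
      have hset : Runs l ω (.set i 0 (.var i + 1)) m'' fun t m₁ =>
          t = 6 ∧ m₁ = m''.write i 0 (j + 1) := by
        refine Runs.set hl rfl hok (fun _ => ?_) ⟨rfl, ?_⟩
        · show m'' i 0 + 1 ≤ _
          omega
        · show m''.write i 0 (m'' i 0 + 1) = _
          rw [hij'']
      obtain ⟨_, T₁, m₁, g1, g2, g3, g4, rfl, rfl⟩ := hset h3 pos
      have hfr1 : ∀ a, a ≠ i → a ∉ p.writes → m''.write i 0 (j + 1) a = m a := by
        intro a ha ha'
        rw [Mem.write_of_ne _ ha, h4 a ha', hfr a ha ha']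
      obtain ⟨t₂, T₂, m₂, k1, k2, k3, k4, k5, k6, k7, k8⟩ := ih (j + 1) (by omega) _ g3 hfr1
        (Mem.write_same _ _ _ _) h6 g3 pos
      refine ⟨e.nodes + 4 + (t + 6) + t₂, _, m₂, .loop_step hz (.seq h1 g1) k1, ?_, k3, ?_, k5, k6,
        k7, ?_⟩
      · rw [hnodes] at c1
        simp only [add_mul] at *
        omega
      · intro a ha
        simp only [Prog.writes, List.mem_append, List.mem_singleton, not_or] at ha
        rw [k5 a ha.2 ha.1, hfr a ha.2 ha.1]
      · rw [add_mul, one_mul]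
        omega
  refine Runs.seq (Runs.set hl rfl rfl (fun _ => Nat.zero_le _) ?_)
  have h00 : m.write i (Expr.val m 0) (Expr.val m 0) = m.write i 0 0 := rfl
  rw [h00]
  have hfr : ∀ a, a ≠ i → a ∉ p.writes → m.write i 0 0 a = m a :=
    fun a ha _ => Mem.write_of_ne _ ha _ _
  intro hB
  refine (hloop N 0 (by omega) _ hB hfr (Mem.write_same _ _ _ _) h0).mono ?_ hB
  intro t m' hB' _ ⟨k1, k2, k3, k4⟩
  refine hQ _ m' hB' k1 k2 k3 ?_
  have : (0 : Expr).nodes = 1 := rfl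
  rw [this]
  omega

theorem Runs.count (hl : 0 < l) {i : ℕ} {e : Expr} {p : Prog} {m : Mem}
    {Q : ℕ → Mem → Prop} (N : ℕ) (I : ℕ → Mem → Prop) (T : ℕ)
    (hi : i ≠ 0) (hip : i ∉ p.writes) (he : (e - .var i).ok = true)
    (hval : ∀ m', (∀ a, a ≠ i → a ∉ p.writes → m' a = m a) → e.val m' = N)
    (hN : N ≤ 2 ^ (20 * l)) (h0 : I 0 (m.write i 0 0))
    (hstep : ∀ j < N, ∀ m', Bdd l m' → (∀ a, a ≠ i → a ∉ p.writes → m' a = m a) → m' i 0 = j →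
      I j m' → Runs l ω p m' fun t m'' => t ≤ T ∧ I (j + 1) (m''.write i 0 (j + 1)))
    (hQ : ∀ t m', Bdd l m' → (∀ a, a ≠ i → a ∉ p.writes → m' a = m a) → m' i 0 = N → I N m' →
      t ≤ N * (T + (e.nodes + 10)) + (e.nodes + 10) → Q t m') :
    Runs l ω (.count i e p) m Q :=
  Runs.count_potential hl N I (fun _ => 0) T hi hip he hval hN h0 hstep hQ

/-- Summation loop: variable `b` becomes the sum of the values of `f` for `i = 0, …, e - 1`. -/
def Prog.sum (b i : ℕ) (e f : Expr) : Prog :=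
  .seq (.set b 0 0) (.count i e (.set b 0 (.var b + f)))

theorem Runs.sum (hl : 0 < l) {b i : ℕ} {e f : Expr} {m : Mem} {Q : ℕ → Mem → Prop} (N : ℕ)
    (F : ℕ → ℕ) (hi : i ≠ 0) (hib : i ≠ b) (he : (e - .var i).ok = true)
    (hf : (.var b + f : Expr).ok = true)
    (hval : ∀ m', (∀ a, a ≠ i → a ≠ b → m' a = m a) → e.val m' = N)
    (hN : N ≤ 2 ^ (20 * l))
    (hF : ∀ j < N, ∀ m', (∀ a, a ≠ i → a ≠ b → m' a = m a) → m' i 0 = j → f.val m' = F j)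
    (hS : ∑ j ∈ Finset.range N, F j ≤ 2 ^ (20 * l))
    (hQ : ∀ t m', (∀ a, a ≠ i → a ≠ b → m' a = m a) → (∀ j, j ≠ 0 → m' b j = m b j) →
      m' b 0 = ∑ j ∈ Finset.range N, F j →
      t ≤ N * (f.nodes + e.nodes + 20) + (e.nodes + 20) → Q t m') :
    Runs l ω (.sum b i e f) m Q := by
  refine Runs.seq (Runs.set hl rfl rfl (fun _ => Nat.zero_le _) ?_)
  have h00 : m.write b (Expr.val m 0) (Expr.val m 0) = m.write b 0 0 := rfl
  rw [h00]
  have fr : ∀ m' : Mem, (∀ a, a ≠ i → a ∉ (Prog.set b 0 (.var b + f)).writes →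
      m' a = m.write b 0 0 a) → ∀ a, a ≠ i → a ≠ b → m' a = m a := by
    intro m' h a ha hb
    rw [h a ha (by simpa [Prog.writes] using hb), Mem.write_of_ne _ hb]
  refine Runs.count hl N (fun j m' => m' b 0 = ∑ j ∈ Finset.range j, F j ∧
    ∀ j, j ≠ 0 → m' b j = m b j) (f.nodes + 10) hi
    (by simpa [Prog.writes] using hib) he (fun m' h => hval m' (fr m' h)) hN ?_ ?_ ?_
  · rw [Mem.write_of_ne _ hib.symm]
    refine ⟨by rw [Mem.write_same]; rfl, fun j hj => ?_⟩
    rw [Mem.write_idx, if_neg hj]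
  · intro j hj m' _ hfr hij hI
    have hv : (Expr.var b + f).val m' = ∑ j ∈ Finset.range (j + 1), F j := by
      rw [Expr.val_add, Expr.val_var, hI.1, hF j hj m' (fr m' hfr) hij, Finset.sum_range_succ]
    refine Runs.set hl rfl hf (fun _ => ?_) ⟨?_, ?_⟩
    · rw [hv]
      exact (Finset.sum_le_sum_of_subset (Finset.range_subset_range.2 hj)).trans hS
    · have h1 : (0 : Expr).nodes = 1 := rfl
      have h2 : (Expr.var b + f).nodes = 2 + f.nodes + 1 := rfl
      rw [h1, h2]; omega
    · have h0 : (0 : Expr).val m' = 0 := rfl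
      rw [Mem.write_of_ne _ hib.symm, hv, h0]
      refine ⟨Mem.write_same _ _ _ _, fun j hj => ?_⟩
      rw [Mem.write_idx, if_neg hj, hI.2 j hj]
  · intro t m' _ hfr _ hI ht
    refine hQ _ m' (fr m' hfr) hI.2 hI.1 ?_
    have h1 : (0 : Expr).nodes = 1 := rfl
    rw [h1]
    have : N * (f.nodes + 10 + (e.nodes + 10)) = N * (f.nodes + e.nodes + 20) := by ring
    omega

end RAM

/-! ### Tables -/

namespace RAM

variable {l : ℕ} {ω : ℕ → Bool}

/-- Table loop: for `i = 0, …, e - 1`, run `p` and store its result `t` in cell `b + i` of bank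
`A`. -/
def Prog.table (A i t : ℕ) (b e : Expr) (p : Prog) : Prog :=
  .count i e (.seq p (.set A (b + .var i) (.var t)))

/-- In `hstep` the cells not yet reached still have their old contents, so that a table can be
updated in place from its own entries. -/
theorem Runs.table (hl : 0 < l) {A i t : ℕ} {b e : Expr} {p : Prog} {m : Mem}
    {Q : ℕ → Mem → Prop} (N B : ℕ) (F : ℕ → ℕ) (T : ℕ) (hi : i ≠ 0) (ht : t ≠ 0)
    (hiA : i ≠ A) (hip : i ∉ p.writes) (hAp : A ∉ p.writes)
    (he : (e - .var i).ok = true) (hb : (b + .var i).ok = true)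
    (hval : ∀ m', (∀ a, a ≠ i → a ≠ A → a ∉ p.writes → m' a = m a) →
      e.val m' = N ∧ b.val m' = B)
    (hN : N ≤ 2 ^ (20 * l))
    (hstep : ∀ j < N, ∀ m', Bdd l m' → (∀ a, a ≠ i → a ≠ A → a ∉ p.writes → m' a = m a) →
      (∀ x, x < B ∨ B + j ≤ x → m' A x = m A x) → m' i 0 = j →
      Runs l ω p m' fun τ m'' => τ ≤ T ∧ m'' t 0 = F j)
    (hQ : ∀ τ m', Bdd l m' → (∀ a, a ≠ i → a ≠ A → a ∉ p.writes → m' a = m a) →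
      (∀ x, m' A x = if B ≤ x ∧ x < B + N then F (x - B) else m A x) →
      τ ≤ N * (T + b.nodes + e.nodes + 20) + (e.nodes + 10) → Q τ m') :
    Runs l ω (.table A i t b e p) m Q := by
  have htok : (Expr.var t).ok = true := by simp [Expr.ok, ht]
  have fr : ∀ m' : Mem, (∀ a, a ≠ i → a ∉ (Prog.seq p (.set A (b + .var i) (.var t))).writes →
      m' a = m a) → ∀ a, a ≠ i → a ≠ A → a ∉ p.writes → m' a = m a := by
    intro m' h a h1 h2 h3
    exact h a h1 (by simp [Prog.writes, h2, h3])
  refine Runs.count hl N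
    (fun j m' => ∀ x, m' A x = if B ≤ x ∧ x < B + j then F (x - B) else m A x)
    (T + b.nodes + 6) hi (by simp [Prog.writes, hip, hiA]) he (fun m' h => (hval m' (fr m' h)).1) hN
    ?_ ?_ ?_
  · intro x
    rw [Mem.write_of_ne _ hiA.symm, if_neg (by omega)]
  · intro j hj m' hB hfr hij hI
    refine Runs.seq ((hstep j hj m' hB (fr m' hfr) (fun x hx => ?_) hij).mono ?_)
    · rw [hI, if_neg (by omega)]
    · rintro τ m₁ hB₁ hfr₁ ⟨h1, h2⟩
      refine Runs.set hl hb htok (fun h => ?_) ⟨?_, ?_⟩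
      · exact h t ht 0
      · have h3 : (b + Expr.var i).nodes = b.nodes + 2 + 1 := rfl
        have h4 : (Expr.var t).nodes = 2 := rfl
        rw [h3, h4]; omega
      · intro x
        have hfr₂ : ∀ a, a ≠ i → a ≠ A → a ∉ p.writes → m₁ a = m a := by
          intro a h3 h4 h5
          rw [hfr₁ a h5, fr m' hfr a h3 h4 h5]
        have hv : (b + Expr.var i).val m₁ = B + j := by
          rw [Expr.val_add, (hval m₁ hfr₂).2, Expr.val_var, hfr₁ i hip, hij]
        rw [Mem.write_of_ne _ hiA.symm, Mem.write_idx, hv, Expr.val_var, h2, hfr₁ A hAp, hI]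
        by_cases hx : x = B + j
        · rw [if_pos hx, if_pos (by omega), hx, Nat.add_sub_cancel_left]
        · rw [if_neg hx]
          congr 1
          exact propext ⟨fun h => by omega, fun h => by omega⟩
  · intro τ m' hB hfr _ hI hτ
    refine hQ τ m' hB (fr m' hfr) hI ?_
    have : T + b.nodes + 6 + (e.nodes + 10) ≤ T + b.nodes + e.nodes + 20 := by omega
    have := Nat.mul_le_mul_left N this
    omega

end RAM

namespace ApproxClique

open RAM Finset Mixing Torus

/-! ### The environment of the search

Bank `4` holds `n`, bank `5` the size `K` of the clique, bank `6` the precision `E`, bank `7` the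
ratio `a`, bank `8` the length `k` of a macro step of a walk, bank `9` the degree `16 ^ k`, bank
`10` the number of codes of walks, bank `11` the side `m` of the torus, bank `12` its size, and bank
`13` the number `s` of vertices of a walk.  Banks `14`, `15`, `16` hold tables of non-edges,
macro steps, and codegrees. -/

structure Scalars (n K E a k s m : ℕ) (μ : Mem) : Prop where
  val_n : μ 4 0 = n
  val_K : μ 5 0 = K
  val_E : μ 6 0 = E
  val_a : μ 7 0 = a
  val_k : μ 8 0 = k
  val_d : μ 9 0 = 16 ^ k
  val_D : μ 10 0 = (16 ^ k) ^ s
  val_m : μ 11 0 = m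
  val_Q : μ 12 0 = m * m
  val_s : μ 13 0 = s

structure Tables (n k m : ℕ) (H : ℕ → ℕ → ℕ) (μ : Mem) : Prop where
  val_H : ∀ u v, v < n → μ 14 (u * n + v) = H u v
  val_W : ∀ u < m * m, ∀ c < 16 ^ k, μ 15 (u * 16 ^ k + c) = nbr m k u c
  val_C : ∀ u < n, ∀ c < 16 ^ k, μ 16 (u * 16 ^ k + c) = codeg n H u (nbr m k u c)

theorem Scalars.congr {n K E a k s m : ℕ} {μ ν : Mem} (h : Scalars n K E a k s m μ)
    (hν : ∀ b, 4 ≤ b → b ≤ 13 → ν b = μ b) : Scalars n K E a k s m ν := by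
  obtain ⟨h1, h2, h3, h4, h5, h6, h7, h8, h9, h10⟩ := h
  constructor <;> rw [hν _ (by norm_num) (by norm_num)] <;> assumption

theorem Tables.congr {n k m : ℕ} {H : ℕ → ℕ → ℕ} {μ ν : Mem} (h : Tables n k m H μ)
    (hν : ∀ b, 14 ≤ b → b ≤ 16 → ν b = μ b) : Tables n k m H ν := by
  obtain ⟨h1, h2, h3⟩ := h
  constructor <;> rw [hν _ (by norm_num) (by norm_num)] <;> assumption

/-- All parameters are at most `2 ^ l`. -/
structure Sizes (l n K E a k s m : ℕ) : Prop where
  pos : 0 < l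
  le_n : n ≤ 2 ^ l
  le_K : K ≤ 2 ^ l
  le_E : E ≤ 2 ^ l
  le_a : a ≤ 2 ^ l
  le_k : k ≤ 2 ^ l
  le_s : s ≤ 2 ^ l
  le_d : 16 ^ k ≤ 2 ^ l
  le_D : (16 ^ k) ^ s ≤ 2 ^ l
  le_m : m ≤ 2 ^ l

/-! ### The inner loops of the search -/

/-- The vertices adjacent to all vertices of the walk from `i / d ^ s` with the code
`i % d ^ s`. -/
def cand (n k m s : ℕ) (H : ℕ → ℕ → ℕ) (i v : ℕ) : ℕ :=
  if v < n then common H (walk (16 ^ k) (nbr m k) (i / (16 ^ k) ^ s) (i % (16 ^ k) ^ s)) s v else 0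

/-- The sets `S`, `R` are close according to the estimate of their distance. -/
def Close (n K E k m : ℕ) (H : ℕ → ℕ → ℕ) (S R : ℕ → ℕ) : Prop :=
  512 * E * E * (m * m) * (corrPos n (16 ^ k) (nbr m k) H S R - corrNeg n (16 ^ k) (nbr m k) H S R)
    ≤ 16 ^ k * K * K * K

open Expr Prog in
/-- Bank `23` becomes the set of common neighbours of the walk with number `var 40`. -/
def walkProg : Prog :=
  .seq (.set 50 0 (var 40 / var 10)) <|
  .seq (.set 51 0 (var 40 - var 40 / var 10 * var 10)) <|
  .seq (.table 23 42 52 0 (var 4) (.set 52 0 1)) <|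
  .count 41 (var 13) <|
    .seq (.table 23 42 52 0 (var 4) (.set 52 0 (get 23 (var 42) *
      (1 - get 14 (var 50 * var 4 + var 42))))) <|
    .seq (.set 50 0 (get 15 (var 50 * var 9 + (var 51 - var 51 / var 9 * var 9))))
      (.set 51 0 (var 51 / var 9))

theorem le_pow_of_le {l x i : ℕ} (h : x ≤ (2 ^ l) ^ i) (hi : i ≤ 20) : x ≤ 2 ^ (20 * l) := by
  rw [mul_comm, pow_mul]
  exact h.trans (Nat.pow_le_pow_right (Nat.two_pow_pos l) hi)

theorem sub_div_mul (x y : ℕ) : x - x / y * y = x % y := by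
  have := Nat.div_add_mod' x y
  omega

theorem walk_nbr_lt {m k : ℕ} [NeZero m] {u : ℕ} (hu : u < m * m) (c t : ℕ) :
    walk (16 ^ k) (nbr m k) u c t < m * m := by
  induction t with
  | zero => exact hu
  | succ t ih => exact nbr_lt k ih _

/-- After j rounds, variable 50 holds vertex j of the walk, variable 51 the unused digits of its
code, and bank 23 the common neighbourhood of the first j vertices. Only the first `n` cells of bank
23 are written, so the others have to vanish beforehand. -/
theorem walkProg_runs {l : ℕ} {ω : ℕ → Bool} {n K E a k s m : ℕ} [NeZero m]
    {H : ℕ → ℕ → ℕ} {μ : Mem} (hs : Sizes l n K E a k s m) (h1 : Scalars n K E a k s m μ) (h2 : Tables n k m H μ)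
    {i : ℕ} (hi : i < m * m * (16 ^ k) ^ s) (h40 : μ 40 0 = i) (h23 : ∀ v, n ≤ v → μ 23 v = 0) :
    Runs l ω walkProg μ fun t μ' => t ≤ (s + 2) * (n * 100 + 100) ∧
      ∀ v, μ' 23 v = cand n k m s H i v := by
  have hl := hs.pos
  have hD : 0 < (16 ^ k) ^ s := by positivity
  have hu : i / (16 ^ k) ^ s < m * m := (Nat.div_lt_iff_lt_mul hD).2 hi
  have hi' : i ≤ 2 ^ (20 * l) := by
    refine le_pow_of_le (i := 3) (hi.le.trans ?_) (by norm_num)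
    rw [pow_succ, pow_two]
    exact Nat.mul_le_mul (Nat.mul_le_mul hs.le_m hs.le_m) hs.le_D
  have hn : n ≤ 2 ^ (20 * l) := le_pow_of_le (i := 1) (by simpa using hs.le_n) (by norm_num)
  set x := walk (16 ^ k) (nbr m k) (i / (16 ^ k) ^ s) (i % (16 ^ k) ^ s) with hx
  unfold walkProg
  have e50 : (Expr.var 40 / Expr.var 10).val μ = i / (16 ^ k) ^ s := by
    simp only [Expr.val_div, Expr.val_var, h40, h1.val_D]
  refine Runs.seq (Runs.set hl rfl rfl (fun _ => ?_) ?_)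
  · rw [e50]; exact (Nat.div_le_self _ _).trans hi'
  rw [e50]
  change Runs l ω _ (μ.write 50 0 _) _
  set μ₁ := μ.write 50 0 (i / (16 ^ k) ^ s) with hμ₁
  have e51 : (Expr.var 40 - Expr.var 40 / Expr.var 10 * Expr.var 10).val μ₁
      = i % (16 ^ k) ^ s := by
    have a1 : μ₁ 40 = μ 40 := Mem.write_of_ne _ (by norm_num) _ _
    have a2 : μ₁ 10 = μ 10 := Mem.write_of_ne _ (by norm_num) _ _
    simp only [Expr.val_sub, Expr.val_mul, Expr.val_div, Expr.val_var, a1, a2, h40, h1.val_D,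
      sub_div_mul]
  refine Runs.seq (Runs.set hl rfl rfl (fun _ => ?_) ?_)
  · rw [e51]; exact (Nat.mod_le _ _).trans hi'
  rw [e51]
  change Runs l ω _ (μ₁.write 51 0 _) _
  set μ₂ := μ₁.write 51 0 (i % (16 ^ k) ^ s) with hμ₂
  have b50 : μ₂ 50 0 = i / (16 ^ k) ^ s := by
    rw [hμ₂, Mem.write_of_ne _ (by norm_num), hμ₁, Mem.write_same]
  have b51 : μ₂ 51 0 = i % (16 ^ k) ^ s := by rw [hμ₂, Mem.write_same]
  have bfr : ∀ b, b ≠ 50 → b ≠ 51 → μ₂ b = μ b := fun b g1 g2 => by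
    rw [hμ₂, Mem.write_of_ne _ g2, hμ₁, Mem.write_of_ne _ g1]
  refine Runs.seq (Runs.table hl n 0 (fun _ => 1) 10 (by norm_num) (by norm_num) (by norm_num)
    (by decide) (by decide) rfl rfl (fun m' h => ⟨?_, rfl⟩) hn ?_ ?_)
  · rw [Expr.val_var, h 4 (by norm_num) (by norm_num) (by decide), bfr 4 (by norm_num)
      (by norm_num), h1.val_n]
  · intro j _ m' _ _ _ _
    exact Runs.set hl rfl rfl (fun _ => Nat.one_le_two_pow) ⟨by decide, Mem.write_same _ _ _ _⟩
  intro t₃ μ₃ hB₃ hfr₃ hμ₃ ht₃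
  have cfr : ∀ b, b ≠ 50 → b ≠ 51 → b ≠ 42 → b ≠ 23 → b ≠ 52 → μ₃ b = μ b := fun b g1 g2 g3 g4 g5 => by
    rw [hfr₃ b g3 g4 (by simpa [Prog.writes] using g5), bfr b g1 g2]
  refine Runs.count hl s (fun j μ' => μ' 50 0 = x j ∧ μ' 51 0 = i % (16 ^ k) ^ s / (16 ^ k) ^ j ∧
    ∀ v, μ' 23 v = if v < n then common H x j v else 0) (n * 100 + 80) (by norm_num) (by decide)
    rfl (fun m' h => ?_) (le_pow_of_le (i := 1) (by simpa using hs.le_s) (by norm_num)) ?_ ?_ ?_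
  · rw [Expr.val_var, h 13 (by norm_num) (by decide), cfr 13 (by norm_num) (by norm_num)
      (by norm_num) (by norm_num) (by norm_num), h1.val_s]
  · refine ⟨?_, ?_, fun v => ?_⟩
    · rw [Mem.write_of_ne _ (by norm_num), hfr₃ 50 (by norm_num) (by norm_num) (by decide), b50]
      rfl
    · rw [Mem.write_of_ne _ (by norm_num), hfr₃ 51 (by norm_num) (by norm_num) (by decide), b51]
      simp
    · rw [Mem.write_of_ne _ (by norm_num), hμ₃]
      by_cases hv : v < n
      · simp [hv, common]
      · rw [if_neg (by omega), if_neg hv, bfr 23 (by norm_num) (by norm_num), h23 v (by omega)]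
  · rintro j hj μ₄ hB₄ hfr₄ _ ⟨g1, g2, g3⟩
    have dfr : ∀ b, 4 ≤ b → b ≤ 16 → μ₄ b = μ b := fun b q1 q2 => by
      rw [hfr₄ b (by omega) (by simp [Prog.writes, Prog.table, Prog.count]; omega),
        cfr b (by omega) (by omega) (by omega) (by omega) (by omega)]
    have k1 : Scalars n K E a k s m μ₄ := h1.congr fun b q1 q2 => dfr b q1 (by omega)
    have k2 : Tables n k m H μ₄ := h2.congr fun b q1 q2 => dfr b (by omega) q2
    refine Runs.seq (Runs.table hl n 0 (fun v => common H x (j + 1) v) 40 (by norm_num)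
      (by norm_num) (by norm_num) (by decide) (by decide) rfl rfl (fun m' h => ⟨?_, rfl⟩) hn ?_ ?_)
    · rw [Expr.val_var, h 4 (by norm_num) (by norm_num) (by decide), k1.val_n]
    · intro v hv m' _ hfr h23 h42
      have e : (Expr.get 23 (.var 42) * (1 - Expr.get 14 (.var 50 * .var 4 + .var 42))).val m'
          = common H x (j + 1) v := by
        simp only [Expr.val_sub, Expr.val_mul, Expr.val_get, Expr.val_add, Expr.val_lit,
          Expr.val_ofNat, h42]
        rw [h23 v (by omega), g3, if_pos hv, hfr 50 (by norm_num) (by norm_num) (by decide), g1,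
          hfr 4 (by norm_num) (by norm_num) (by decide), k1.val_n,
          hfr 14 (by norm_num) (by norm_num) (by decide), k2.val_H _ _ hv, common, common,
          prod_range_succ]
      refine Runs.set hl rfl rfl (fun _ => ?_) ⟨by decide, ?_⟩
      · rw [e]
        exact (Finset.prod_le_one' fun t _ => Nat.sub_le _ _).trans Nat.one_le_two_pow
      · rw [e]; exact Mem.write_same _ _ _ _
    · intro t₅ μ₅ hB₅ hfr₅ hμ₅ ht₅
      have l50 : μ₅ 50 0 = x j := by rw [hfr₅ 50 (by norm_num) (by norm_num) (by decide), g1]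
      have l51 : μ₅ 51 0 = i % (16 ^ k) ^ s / (16 ^ k) ^ j := by
        rw [hfr₅ 51 (by norm_num) (by norm_num) (by decide), g2]
      have l9 : μ₅ 9 0 = 16 ^ k := by
        rw [hfr₅ 9 (by norm_num) (by norm_num) (by decide), k1.val_d]
      have e : (Expr.get 15 (.var 50 * .var 9 + (.var 51 - .var 51 / .var 9 * .var 9))).val μ₅
          = x (j + 1) := by
        simp only [Expr.val_sub, Expr.val_mul, Expr.val_get, Expr.val_add, Expr.val_lit,
          Expr.val_div, l50, l51, l9, sub_div_mul]
        rw [hfr₅ 15 (by norm_num) (by norm_num) (by decide),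
          k2.val_W _ (walk_nbr_lt hu _ _) _ (Nat.mod_lt _ (by positivity))]
        rfl
      refine Runs.seq (Runs.set hl rfl rfl (fun _ => ?_) ?_)
      · rw [e]
        refine le_pow_of_le (i := 2) ((walk_nbr_lt hu _ _).le.trans ?_) (by norm_num)
        rw [pow_two]
        exact Nat.mul_le_mul hs.le_m hs.le_m
      rw [e]
      have e' : (Expr.var 51 / Expr.var 9).val (μ₅.write 50 ((0 : Expr).val μ₅) (x (j + 1)))
          = i % (16 ^ k) ^ s / (16 ^ k) ^ (j + 1) := by
        simp only [Expr.val_div, Expr.val_var]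
        rw [Mem.write_of_ne _ (by norm_num), Mem.write_of_ne _ (by norm_num), l51, l9,
          Nat.div_div_eq_div_mul, pow_succ]
      refine Runs.set hl rfl rfl (fun _ => ?_) ⟨?_, ?_, ?_, ?_⟩
      · rw [e']
        exact (Nat.div_le_self _ _).trans ((Nat.mod_le _ _).trans hi')
      · simp only [Expr.nodes_get, Expr.nodes_add, Expr.nodes_sub, Expr.nodes_mul, Expr.nodes_div,
          Expr.nodes_lit, Expr.nodes_ofNat] at ht₅ ⊢
        omega
      · rw [Mem.write_of_ne _ (by norm_num), Mem.write_of_ne _ (by norm_num)]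
        exact Mem.write_same _ _ _ _
      · rw [e', Mem.write_of_ne _ (by norm_num)]
        exact Mem.write_same _ _ _ _
      · intro v
        rw [Mem.write_of_ne _ (by norm_num), Mem.write_of_ne _ (by norm_num),
          Mem.write_of_ne _ (by norm_num), hμ₅, g3]
        by_cases hv : v < n
        · rw [if_pos (by omega), if_pos hv, Nat.sub_zero]
        · rw [if_neg (by omega), if_neg hv, if_neg hv]
  · rintro t₆ μ₆ _ _ _ ⟨_, _, g3⟩ ht₆
    refine ⟨?_, fun v => g3 v⟩
    simp only [Expr.nodes_get, Expr.nodes_sub, Expr.nodes_mul, Expr.nodes_div,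
      Expr.nodes_lit, Expr.nodes_ofNat] at ht₃ ht₆ ⊢
    have e1 : s * (n * 100 + 80 + (1 + 1 + 10)) ≤ s * (n * 100 + 100) :=
      Nat.mul_le_mul_left _ (by omega)
    have e2 : (s + 2) * (n * 100 + 100) = s * (n * 100 + 100) + (n * 200 + 200) := by ring
    omega

end ApproxClique

/-! ### Looking for a close representative. -/

namespace ApproxClique

open RAM Finset Mixing Torus

/-- The representatives `R j` with `j < r`, and the numbers of their non-neighbours. -/
structure Reps (n m : ℕ) (H : ℕ → ℕ → ℕ) (R : ℕ → ℕ → ℕ) (r : ℕ) (μ : Mem) : Prop where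
  val_r : μ 30 0 = r
  val_R : ∀ j < r, ∀ v < m * m, μ 31 (j * (m * m) + v) = R j v
  val_q : ∀ j < r, ∀ v < n, μ 32 (j * n + v) = miss n H (R j) v

theorem Reps.congr {n m : ℕ} {H : ℕ → ℕ → ℕ} {R : ℕ → ℕ → ℕ} {r : ℕ} {μ ν : Mem}
    (h : Reps n m H R r μ) (hν : ∀ b, 30 ≤ b → b ≤ 32 → ν b = μ b) : Reps n m H R r ν := by
  obtain ⟨h1, h2, h3⟩ := h
  constructor <;> rw [hν _ (by norm_num) (by norm_num)] <;> assumption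

theorem codeg_le {n : ℕ} {H : ℕ → ℕ → ℕ} (hH : IsNonEdge n H) (u w : ℕ) : codeg n H u w ≤ n :=
  calc codeg n H u w ≤ ∑ _v ∈ range n, 1 :=
        Finset.sum_le_sum fun v _ => Nat.mul_le_mul (hH.le_one u v) (hH.le_one w v)
    _ = n := by simp

theorem miss_le {n : ℕ} {H : ℕ → ℕ → ℕ} (hH : IsNonEdge n H) {S : ℕ → ℕ} (hS : ∀ v, S v ≤ 1)
    (v : ℕ) : miss n H S v ≤ n :=
  calc miss n H S v ≤ ∑ _v ∈ range n, 1 :=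
        Finset.sum_le_sum fun w _ => Nat.mul_le_mul (hH.le_one v w) (hS w)
    _ = n := by simp

theorem corrPos_le {n d : ℕ} {W H : ℕ → ℕ → ℕ} (hH : IsNonEdge n H) {S R : ℕ → ℕ}
    (hS : ∀ v, S v ≤ 1) (hR : ∀ v, R v ≤ 1) : corrPos n d W H S R ≤ n * (d * (n * 2)) :=
  calc corrPos n d W H S R ≤ ∑ _u ∈ range n, ∑ _c ∈ range d, n * 2 :=
        Finset.sum_le_sum fun u _ => Finset.sum_le_sum fun c _ => Nat.mul_le_mul (codeg_le hH _ _)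
          (Nat.add_le_add (Nat.mul_le_mul (hS _) (hS _)) (Nat.mul_le_mul (hR _) (hR _)))
    _ = n * (d * (n * 2)) := by simp

theorem corrNeg_le {n d : ℕ} {W H : ℕ → ℕ → ℕ} (hH : IsNonEdge n H) {S R : ℕ → ℕ}
    (hS : ∀ v, S v ≤ 1) (hR : ∀ v, R v ≤ 1) : corrNeg n d W H S R ≤ n * (d * (n * 2)) :=
  calc corrNeg n d W H S R ≤ ∑ _u ∈ range n, ∑ _c ∈ range d, n * 2 :=
        Finset.sum_le_sum fun u _ => Finset.sum_le_sum fun c _ => Nat.mul_le_mul (codeg_le hH _ _)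
          (Nat.add_le_add (Nat.mul_le_mul (hS _) (hR _)) (Nat.mul_le_mul (hR _) (hS _)))
    _ = n * (d * (n * 2)) := by simp

theorem sum_range_mul_divMod' {d : ℕ} (hd : 0 < d) (n : ℕ) (F : ℕ → ℕ → ℕ) :
    ∑ i ∈ range (n * d), F (i / d) (i % d) = ∑ u ∈ range n, ∑ c ∈ range d, F u c := by
  rw [mul_comm, sum_range_mul_divMod hd n (fun c u => F u c), Finset.sum_comm]

/-- The terms of the sum `corrPos`. -/
def posTerm (n k m : ℕ) (H : ℕ → ℕ → ℕ) (S R : ℕ → ℕ) (u c : ℕ) : ℕ :=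
  codeg n H u (nbr m k u c) * (S u * S (nbr m k u c) + R u * R (nbr m k u c))

/-- The terms of the sum `corrNeg`. -/
def negTerm (n k m : ℕ) (H : ℕ → ℕ → ℕ) (S R : ℕ → ℕ) (u c : ℕ) : ℕ :=
  codeg n H u (nbr m k u c) * (S u * R (nbr m k u c) + R u * S (nbr m k u c))

theorem corrPos_eq (n k m : ℕ) (H : ℕ → ℕ → ℕ) (S R : ℕ → ℕ) :
    corrPos n (16 ^ k) (nbr m k) H S R =
      ∑ i ∈ range (n * 16 ^ k), posTerm n k m H S R (i / 16 ^ k) (i % 16 ^ k) :=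
  (sum_range_mul_divMod' (by positivity) n (posTerm n k m H S R)).symm

theorem corrNeg_eq (n k m : ℕ) (H : ℕ → ℕ → ℕ) (S R : ℕ → ℕ) :
    corrNeg n (16 ^ k) (nbr m k) H S R =
      ∑ i ∈ range (n * 16 ^ k), negTerm n k m H S R (i / 16 ^ k) (i % 16 ^ k) :=
  (sum_range_mul_divMod' (by positivity) n (negTerm n k m H S R)).symm

open Expr in
/-- The terms of the sum `corrPos`, in the order of the loop variable `var 42`, for the
representative `var 41`. -/
def posExpr : Expr :=
  get 16 (var 42) * (get 23 (var 42 / var 9) * get 23 (get 15 (var 42)) +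
    get 31 (var 41 * var 12 + var 42 / var 9) * get 31 (var 41 * var 12 + get 15 (var 42)))

open Expr in
/-- The terms of the sum `corrNeg`. -/
def negExpr : Expr :=
  get 16 (var 42) * (get 23 (var 42 / var 9) * get 31 (var 41 * var 12 + get 15 (var 42)) +
    get 31 (var 41 * var 12 + var 42 / var 9) * get 23 (get 15 (var 42)))

open Expr Prog in
/-- Variable `53` becomes the index of a representative that is close to the set in bank `23`, or
the number of representatives if there is none. -/
def findProg : Prog :=
  .seq (.set 53 0 (var 30)) <|
  .count 41 (var 30) <|
    .seq (.sum 54 42 (var 4 * var 9) posExpr) <|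
    .seq (.sum 55 42 (var 4 * var 9) negExpr) <|
    .ite (var 9 * var 5 * var 5 * var 5 + 1 - 512 * var 6 * var 6 * var 12 * (var 54 - var 55))
      (.set 53 0 (var 41)) .skip

section Pieces

variable {l : ℕ} {ω : ℕ → Bool} {n K E a k s m : ℕ} [NeZero m] {H : ℕ → ℕ → ℕ} {μ : Mem}

theorem posExpr_val (h1 : Scalars n K E a k s m μ) (h2 : Tables n k m H μ) (hnm : n ≤ m * m)
    {R : ℕ → ℕ → ℕ} {r : ℕ} (h3 : Reps n m H R r μ) {S : ℕ → ℕ} (hS : ∀ v, μ 23 v = S v) {j : ℕ}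
    (hj : j < r) (h41 : μ 41 0 = j) {i : ℕ} (hi : i < n * 16 ^ k) (h42 : μ 42 0 = i) :
    posExpr.val μ = posTerm n k m H S (R j) (i / 16 ^ k) (i % 16 ^ k) ∧
      negExpr.val μ = negTerm n k m H S (R j) (i / 16 ^ k) (i % 16 ^ k) := by
  have hd : 0 < 16 ^ k := by positivity
  have hu : i / 16 ^ k < n := (Nat.div_lt_iff_lt_mul hd).2 hi
  have hc := Nat.mod_lt i hd
  have hi' : i = i / 16 ^ k * 16 ^ k + i % 16 ^ k := (Nat.div_add_mod' i _).symm
  have hC : μ 16 i = codeg n H (i / 16 ^ k) (nbr m k (i / 16 ^ k) (i % 16 ^ k)) := by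
    rw [← h2.val_C _ hu _ hc, ← hi']
  have hW : μ 15 i = nbr m k (i / 16 ^ k) (i % 16 ^ k) := by
    rw [← h2.val_W _ (by omega) _ hc, ← hi']
  have hw : nbr m k (i / 16 ^ k) (i % 16 ^ k) < m * m := nbr_lt k (by omega) _
  simp only [posExpr, negExpr, posTerm, negTerm, Expr.val_add, Expr.val_mul, Expr.val_div, Expr.val_get,
    Expr.val_lit, h41, h42, h1.val_d, h1.val_Q, hC, hW, hS, h3.val_R j hj _ hw,
    h3.val_R j hj _ (hu.trans_le hnm), and_self]

/-- A comparison costs only order `n * 16 ^ k`, since the tabulated codegrees along the edges of the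
expander suffice. All representatives are tried, and the last close one is kept. -/
theorem findProg_runs (hs : Sizes l n K E a k s m) (h1 : Scalars n K E a k s m μ)
    (h2 : Tables n k m H μ) (hnm : n ≤ m * m) (hH : IsNonEdge n H) {R : ℕ → ℕ → ℕ} {r : ℕ}
    (hR : ∀ j v, R j v ≤ 1) (hr : r ≤ 2 ^ l)
    (h3 : Reps n m H R r μ) {S : ℕ → ℕ} (hS : ∀ v, μ 23 v = S v) (hS1 : ∀ v, S v ≤ 1) :
    Runs l ω findProg μ fun t μ' => t ≤ (r + 1) * (n * 16 ^ k * 200 + 400) ∧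
      ∃ i, μ' 53 0 = i ∧ (i = r ∧ (∀ j < r, ¬ Close n K E k m H S (R j)) ∨
        i < r ∧ Close n K E k m H S (R i)) := by
  have hl := hs.pos
  have hL : 2 ≤ 2 ^ l := by simpa using Nat.pow_le_pow_right (n := 2) (by norm_num) hl
  have hr' : r ≤ 2 ^ (20 * l) := le_pow_of_le (i := 1) (by simpa using hr) (by norm_num)
  have hnd : n * 16 ^ k ≤ 2 ^ (20 * l) := by
    refine le_pow_of_le (i := 2) ?_ (by norm_num)
    rw [pow_two]; exact Nat.mul_le_mul hs.le_n hs.le_d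
  have hcor : n * (16 ^ k * (n * 2)) ≤ 2 ^ (20 * l) := by
    refine le_pow_of_le (i := 4) ?_ (by norm_num)
    calc n * (16 ^ k * (n * 2)) ≤ 2 ^ l * (2 ^ l * (2 ^ l * 2 ^ l)) :=
          Nat.mul_le_mul hs.le_n (Nat.mul_le_mul hs.le_d (Nat.mul_le_mul hs.le_n hL))
      _ = (2 ^ l) ^ 4 := by ring
  unfold findProg
  refine Runs.seq (Runs.set hl rfl rfl (fun hB => hB _ (by norm_num) _) ?_)
  rw [Expr.val_var, h3.val_r]
  change Runs l ω _ (μ.write 53 0 r) _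
  have hfr₁ : ∀ b, b ≠ 53 → μ.write 53 0 r b = μ b := fun b hb => Mem.write_of_ne _ hb _ _
  have hμ₁ : μ.write 53 0 r 53 0 = r := Mem.write_same _ _ _ _
  generalize μ.write 53 0 r = μ₁ at hfr₁ hμ₁
  refine Runs.count hl r (fun j μ' => ∃ i, μ' 53 0 = i ∧
      (i = r ∧ (∀ j' < j, ¬ Close n K E k m H S (R j')) ∨ i < r ∧ Close n K E k m H S (R i)))
    (n * 16 ^ k * 160 + 200) (by norm_num) (by decide) rfl (fun m' h => ?_) hr' ?_ ?_ ?_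
  · rw [Expr.val_var, h 30 (by norm_num) (by decide), hfr₁ 30 (by norm_num), h3.val_r]
  · refine ⟨r, ?_, .inl ⟨rfl, by simp⟩⟩
    rw [Mem.write_of_ne _ (by norm_num), hμ₁]
  · rintro j hj μ₂ hB₂ hfr₂ h41 ⟨i, hi, hI⟩
    have fr₂ : ∀ b, b < 41 → μ₂ b = μ b := fun b hb => by
      rw [hfr₂ b (by omega) (by simp [Prog.writes, Prog.sum, Prog.count]; omega),
        hfr₁ b (by omega)]
    have key : ∀ μ' : Mem, (∀ b, b < 41 → μ' b = μ b) → Scalars n K E a k s m μ' ∧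
        Tables n k m H μ' ∧ Reps n m H R r μ' ∧ ∀ v, μ' 23 v = S v := fun μ' h =>
      ⟨h1.congr fun b _ _ => h b (by omega), h2.congr fun b _ _ => h b (by omega),
        h3.congr fun b _ _ => h b (by omega), fun v => by rw [h 23 (by norm_num), hS]⟩
    refine Runs.seq (Runs.sum hl (n * 16 ^ k) (fun i => posTerm n k m H S (R j) (i / 16 ^ k) (i % 16 ^ k))
      (by norm_num) (by norm_num)
      rfl rfl (fun m' h => ?_) hnd ?_ ?_ ?_)
    · have h' := (key m' fun b hb => by rw [h b (by omega) (by omega), fr₂ b hb]).1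
      rw [Expr.val_mul, Expr.val_var, Expr.val_var, h'.val_n, h'.val_d]
    · intro i hi m' h h42
      obtain ⟨k1, k2, k3, k4⟩ := key m' fun b hb => by rw [h b (by omega) (by omega), fr₂ b hb]
      exact (posExpr_val k1 k2 hnm k3 k4 hj
        (by rw [h 41 (by norm_num) (by norm_num), h41]) hi h42).1
    · rw [← corrPos_eq]
      exact (corrPos_le hH hS1 (hR j)).trans hcor
    intro t₃ μ₃ hfr₃ _ h54 ht₃
    rw [← corrPos_eq] at h54
    refine Runs.seq (Runs.sum hl (n * 16 ^ k) (fun i => negTerm n k m H S (R j) (i / 16 ^ k) (i % 16 ^ k))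
      (by norm_num) (by norm_num)
      rfl rfl (fun m' h => ?_) hnd ?_ ?_ ?_)
    · have h' := (key m' fun b hb => by
        rw [h b (by omega) (by omega), hfr₃ b (by omega) (by omega), fr₂ b hb]).1
      rw [Expr.val_mul, Expr.val_var, Expr.val_var, h'.val_n, h'.val_d]
    · intro i hi m' h h42
      obtain ⟨k1, k2, k3, k4⟩ := key m' fun b hb => by
        rw [h b (by omega) (by omega), hfr₃ b (by omega) (by omega), fr₂ b hb]
      exact (posExpr_val k1 k2 hnm k3 k4 hj
        (by rw [h 41 (by norm_num) (by norm_num), hfr₃ 41 (by norm_num) (by norm_num), h41])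
        hi h42).2
    · rw [← corrNeg_eq]
      exact (corrNeg_le hH hS1 (hR j)).trans hcor
    intro t₄ μ₄ hfr₄ _ h55 ht₄
    rw [← corrNeg_eq] at h55
    have fr₄ : ∀ b, b < 41 → μ₄ b = μ b := fun b hb => by
      rw [hfr₄ b (by omega) (by omega), hfr₃ b (by omega) (by omega), fr₂ b hb]
    obtain ⟨k1, -, -, -⟩ := key μ₄ fr₄
    have h54' : μ₄ 54 0 = corrPos n (16 ^ k) (nbr m k) H S (R j) := by
      rw [hfr₄ 54 (by norm_num) (by norm_num), h54]
    have h55' : μ₄ 55 0 = corrNeg n (16 ^ k) (nbr m k) H S (R j) := h55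
    have h53' : μ₄ 53 0 = i := by
      rw [hfr₄ 53 (by norm_num) (by norm_num), hfr₃ 53 (by norm_num) (by norm_num), hi]
    have h41' : μ₄ 41 0 = j := by
      rw [hfr₄ 41 (by norm_num) (by norm_num), hfr₃ 41 (by norm_num) (by norm_num), h41]
    -- With truncated subtraction, x + 1 - y ≠ 0 expresses y ≤ x.
    have hcond : (Expr.var 9 * Expr.var 5 * Expr.var 5 * Expr.var 5 + 1 -
        512 * Expr.var 6 * Expr.var 6 * Expr.var 12 * (Expr.var 54 - Expr.var 55)).val μ₄ ≠ 0 ↔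
        Close n K E k m H S (R j) := by
      simp only [Expr.val_sub, Expr.val_mul, Expr.val_get, Expr.val_add, Expr.val_lit,
        Expr.val_ofNat, k1.val_d, k1.val_K, k1.val_E, k1.val_Q, h54', h55', Close]
      omega
    have time : t₃ + (t₄ + (46 + 8)) ≤ n * 16 ^ k * 160 + 200 := by
      simp only [posExpr, negExpr, Expr.nodes_get, Expr.nodes_add, Expr.nodes_mul, Expr.nodes_div,
        Expr.nodes_lit] at ht₃ ht₄
      omega
    refine Runs.ite hl rfl (fun hc => ?_) (fun hc => ?_)
    · refine Runs.set hl rfl rfl (fun hB => hB _ (by norm_num) _) ⟨le_trans ?_ time, j, ?_, ?_⟩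
      · simp
      · rw [Mem.write_of_ne _ (by norm_num), Expr.val_var, h41']
        exact Mem.write_same _ _ _ _
      · exact .inr ⟨hj, hcond.1 hc⟩
    · refine Runs.skip ⟨le_trans ?_ time, i, ?_, ?_⟩
      · simp
      · rw [Mem.write_of_ne _ (by norm_num), h53']
      · rcases hI with ⟨hi, hI⟩ | hI
        · refine .inl ⟨hi, fun j' hj' => ?_⟩
          rcases Nat.lt_succ_iff_lt_or_eq.1 hj' with h | rfl
          · exact hI j' h
          · exact fun h => hcond.2 h hc
        · exact .inr hI
  · rintro t μ₂ _ _ _ hI ht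
    refine ⟨?_, hI⟩
    simp only [Expr.nodes_get, Expr.nodes_lit, Expr.nodes_ofNat] at ht ⊢
    have e1 : r * (n * 16 ^ k * 160 + 200 + (1 + 1 + 10)) ≤ r * (n * 16 ^ k * 200 + 400) :=
      Nat.mul_le_mul_left _ (by omega)
    rw [add_mul, one_mul]
    omega

end Pieces

end ApproxClique

/-! ### Adding representatives, and the greedy choice. -/

namespace ApproxClique

open RAM Finset Mixing Torus

open Expr Prog in
/-- If `var 53` is no index of a representative, the set in bank `23` becomes a representative. -/
def appendProg : Prog :=
  .ite (var 53 + 1 - var 30)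
    (.seq (.table 31 42 52 (var 30 * var 12) (var 12) (.set 52 0 (get 23 (var 42)))) <|
     .seq (.table 32 42 52 (var 30 * var 4) (var 4)
       (.sum 52 43 (var 4) (get 14 (var 42 * var 4 + var 43) * get 23 (var 43)))) <|
     .set 30 0 (var 30 + 1))
    .skip

open Expr Prog in
/-- Bank `3` becomes a set of at most `K` elements of the set in bank `23`, chosen by the numbers of
non-neighbours in the representative `var 53`. -/
def greedyProg : Prog :=
  .seq (.table 3 42 52 0 (var 4) (.set 52 0 0)) <|
  .seq (.set 56 0 0) <|
  .seq (.set 57 0 0) <|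
  .count 41 (8 * var 7 * var 4) <|
    .seq (.set 58 0 (var 41 - var 41 / var 4 * var 4)) <|
    .ite (get 23 (var 58) * (1 - get 3 (var 58)) * (var 5 - var 56) *
        ((var 41 / var 4 + 1) * var 5 - 8 * var 6 * get 32 (var 53 * var 4 + var 58)))
      (.seq (.set 3 (var 58) 1) <|
       .seq (.set 56 0 (var 56 + 1)) <|
       .set 57 0 (var 57 + get 32 (var 53 * var 4 + var 58)))
      .skip

section Pieces

variable {l : ℕ} {ω : ℕ → Bool} {n K E a k s m : ℕ} {H : ℕ → ℕ → ℕ} {μ : Mem}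

/-- Quadratic time is spent only if no representative is close. The new one receives the index `r`,
which is what variable 53 already holds in that case. -/
theorem appendProg_runs (hs : Sizes l n K E a k s m) (h1 : Scalars n K E a k s m μ)
    (h2 : Tables n k m H μ) (hH : IsNonEdge n H) {R : ℕ → ℕ → ℕ} {r : ℕ}
    (hr : r + 1 ≤ 2 ^ l) (h3 : Reps n m H R r μ) {S : ℕ → ℕ} (hS : ∀ v, μ 23 v = S v)
    (hS1 : ∀ v, S v ≤ 1) {i : ℕ} (hi : i ≤ r) (h53 : μ 53 0 = i) :
    Runs l ω appendProg μ fun t μ' =>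
      (i < r ∧ t ≤ 20 ∧ Reps n m H R r μ') ∨
      (i = r ∧ t ≤ (m * m * 100 + n * (n * 100 + 100)) + 200 ∧
        Reps n m H (Function.update R r S) (r + 1) μ') := by
  have hl := hs.pos
  have hn : n ≤ 2 ^ (20 * l) := le_pow_of_le (i := 1) (by simpa using hs.le_n) (by norm_num)
  have hQ : m * m ≤ 2 ^ (20 * l) := by
    refine le_pow_of_le (i := 2) ?_ (by norm_num)
    rw [pow_two]; exact Nat.mul_le_mul hs.le_m hs.le_m
  have hc : (Expr.var 53 + 1 - Expr.var 30).val μ = i + 1 - r := by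
    simp only [Expr.val_sub, Expr.val_get, Expr.val_add, Expr.val_lit, Expr.val_ofNat, h53,
      h3.val_r]
  refine Runs.ite hl rfl (fun h => ?_) (fun h => ?_)
  · obtain rfl : i = r := by omega
    refine Runs.seq (Runs.table hl (m * m) (i * (m * m)) S 10 (by norm_num) (by norm_num)
      (by norm_num) (by decide) (by decide) rfl rfl (fun m' h => ?_) hQ ?_ ?_)
    · rw [Expr.val_var, Expr.val_mul, Expr.val_var, Expr.val_var,
        h 12 (by norm_num) (by norm_num) (by decide),
        h 30 (by norm_num) (by norm_num) (by decide), h1.val_Q, h3.val_r]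
      exact ⟨rfl, rfl⟩
    · intro j hj m' _ hfr _ h42
      refine Runs.set hl rfl rfl (fun hB => hB _ (by norm_num) _) ⟨by decide, ?_⟩
      rw [Expr.val_get, Expr.val_var, h42, hfr 23 (by norm_num) (by norm_num) (by decide), hS]
      exact Mem.write_same _ _ _ _
    intro t₁ μ₁ _ hfr₁ hμ₁ ht₁
    have fr₁ : ∀ b, b < 42 → b ≠ 31 → μ₁ b = μ b := fun b hb hb' =>
      hfr₁ b (by omega) hb' (by simp [Prog.writes]; omega)
    refine Runs.seq (Runs.table hl n (i * n) (miss n H S) (n * 40 + 40) (by norm_num) (by norm_num)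
      (by norm_num) (by decide) (by decide) rfl rfl (fun m' h => ?_) hn ?_ ?_)
    · rw [Expr.val_var, Expr.val_mul, Expr.val_var, Expr.val_var,
        h 4 (by norm_num) (by norm_num) (by decide),
        h 30 (by norm_num) (by norm_num) (by decide), fr₁ 4 (by norm_num) (by norm_num),
        fr₁ 30 (by norm_num) (by norm_num), h1.val_n, h3.val_r]
      exact ⟨rfl, rfl⟩
    · intro j hj m' _ hfr _ h42
      have fr : ∀ b, b < 32 → b ≠ 31 → m' b = μ b := fun b hb hb' => by
        rw [hfr b (by omega) (by omega) (by simp [Prog.writes, Prog.sum, Prog.count]; omega),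
          fr₁ b (by omega) hb']
      refine Runs.sum hl n (fun w => H j w * S w) (by norm_num) (by norm_num) rfl rfl
        (fun m'' h => ?_) hn ?_ ((miss_le hH hS1 j).trans hn) ?_
      · rw [Expr.val_var, h 4 (by norm_num) (by norm_num), fr 4 (by norm_num) (by norm_num),
          h1.val_n]
      · intro w hw m'' h h43
        simp only [Expr.val_get, Expr.val_add, Expr.val_mul, Expr.val_lit, h43]
        rw [h 42 (by norm_num) (by norm_num), h42, h 4 (by norm_num) (by norm_num),
          fr 4 (by norm_num) (by norm_num), h1.val_n, h 14 (by norm_num) (by norm_num),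
          fr 14 (by norm_num) (by norm_num), h2.val_H _ _ hw, h 23 (by norm_num) (by norm_num),
          fr 23 (by norm_num) (by norm_num), hS]
      · intro t m'' _ _ h52 ht
        refine ⟨?_, h52⟩
        simp only [Expr.nodes_get, Expr.nodes_add, Expr.nodes_mul, Expr.nodes_lit] at ht
        omega
    intro t₂ μ₂ _ hfr₂ hμ₂ ht₂
    have fr₂ : ∀ b, b < 42 → b ≠ 31 → b ≠ 32 → μ₂ b = μ b := fun b hb hb' hb'' => by
      rw [hfr₂ b (by omega) hb'' (by simp [Prog.writes, Prog.sum, Prog.count]; omega),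
        fr₁ b hb hb']
    have e : (Expr.var 30 + 1).val μ₂ = i + 1 := by
      rw [Expr.val_add, Expr.val_var, fr₂ 30 (by norm_num) (by norm_num) (by norm_num), h3.val_r]
      rfl
    refine Runs.set hl rfl rfl (fun _ => ?_) (.inr ⟨rfl, ?_, ?_, ?_, ?_⟩)
    · rw [e]
      exact le_pow_of_le (i := 1) (by simpa using hr) (by norm_num)
    · simp only [Expr.nodes_get, Expr.nodes_add, Expr.nodes_sub, Expr.nodes_mul,
        Expr.nodes_lit, Expr.nodes_ofNat] at ht₁ ht₂ ⊢
      have e1 : n * (n * 40 + 40 + (1 + 1 + (1 + 1) + 1) + (1 + 1) + 20) ≤ n * (n * 100 + 100) :=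
        Nat.mul_le_mul_left _ (by omega)
      omega
    · rw [e]; exact Mem.write_same _ _ _ _
    · intro j hj v hv
      rw [Mem.write_of_ne _ (by norm_num), hfr₂ 31 (by norm_num) (by norm_num) (by decide), hμ₁]
      rcases Nat.lt_succ_iff_lt_or_eq.1 hj with hj | rfl
      · have : (j + 1) * (m * m) ≤ i * (m * m) := Nat.mul_le_mul_right _ hj
        rw [add_mul] at this
        rw [if_neg (by omega), Function.update_of_ne hj.ne, h3.val_R j hj v hv]
      · rw [if_pos (by omega), Function.update_self, Nat.add_sub_cancel_left]
    · intro j hj v hv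
      rw [Mem.write_of_ne _ (by norm_num), hμ₂]
      rcases Nat.lt_succ_iff_lt_or_eq.1 hj with hj | rfl
      · have : (j + 1) * n ≤ i * n := Nat.mul_le_mul_right _ hj
        rw [add_mul] at this
        rw [if_neg (by omega), Function.update_of_ne hj.ne, fr₁ 32 (by norm_num) (by norm_num),
          h3.val_q j hj v hv]
      · rw [if_pos (by omega), Function.update_self, Nat.add_sub_cancel_left]
  · exact Runs.skip (.inl ⟨by omega, by decide, h3⟩)

theorem greedyProg_runs (hs : Sizes l n K E a k s m) (h1 : Scalars n K E a k s m μ)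
    (hn0 : 0 < n) (hH : IsNonEdge n H) {R : ℕ → ℕ → ℕ} (hR : ∀ j v, R j v ≤ 1) {r : ℕ}
    (h3 : Reps n m H R r μ) {S : ℕ → ℕ} (hS : ∀ v, μ 23 v = S v)
    {i : ℕ} (hi : i < r) (h53 : μ 53 0 = i) :
    Runs l ω greedyProg μ fun t μ' => t ≤ (8 * a + 1) * (n * 200) + 100 ∧
      (∀ v < n, μ' 3 v = if v ∈ select n K S (fun v => 8 * E * miss n H (R i) v) (8 * a * n)
        then 1 else 0) ∧
      μ' 56 0 = (select n K S (fun v => 8 * E * miss n H (R i) v) (8 * a * n)).card ∧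
      μ' 57 0 = ∑ v ∈ select n K S (fun v => 8 * E * miss n H (R i) v) (8 * a * n),
        miss n H (R i) v := by
  have hl := hs.pos
  set sel := select n K S (fun v => 8 * E * miss n H (R i) v) with hsel
  have hn : n ≤ 2 ^ (20 * l) := le_pow_of_le (i := 1) (by simpa using hs.le_n) (by norm_num)
  have hK : K ≤ 2 ^ (20 * l) := le_pow_of_le (i := 1) (by simpa using hs.le_K) (by norm_num)
  have hL : 2 ≤ 2 ^ l := by simpa using Nat.pow_le_pow_right (n := 2) (by norm_num) hl
  have han : 8 * a * n ≤ 2 ^ (20 * l) := by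
    refine le_pow_of_le (i := 5) ?_ (by norm_num)
    calc 8 * a * n = 2 * 2 * 2 * a * n := by ring
      _ ≤ 2 ^ l * 2 ^ l * 2 ^ l * 2 ^ l * 2 ^ l := by
        have := hs.le_a; have := hs.le_n
        gcongr
      _ = (2 ^ l) ^ 5 := by ring
  have htot : ∀ j, ∑ v ∈ sel j, miss n H (R i) v ≤ 2 ^ (20 * l) := by
    intro j
    refine le_pow_of_le (i := 2) ?_ (by norm_num)
    calc ∑ v ∈ sel j, miss n H (R i) v ≤ (sel j).card • n :=
          Finset.sum_le_card_nsmul _ _ _ fun v _ => miss_le hH (hR i) v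
      _ = (sel j).card * n := by simp
      _ ≤ 2 ^ l * 2 ^ l := Nat.mul_le_mul ((select_card_le _ _ _ _ _).trans hs.le_K) hs.le_n
      _ = (2 ^ l) ^ 2 := by ring
  unfold greedyProg
  refine Runs.seq (Runs.table hl n 0 (fun _ => 0) 10 (by norm_num) (by norm_num)
      (by norm_num) (by decide) (by decide) rfl rfl (fun m' h => ⟨?_, rfl⟩) hn ?_ ?_)
  · rw [Expr.val_var, h 4 (by norm_num) (by norm_num) (by decide), h1.val_n]
  · intro j _ m' _ _ _ _
    exact Runs.set hl rfl rfl (fun _ => Nat.zero_le _) ⟨by decide, Mem.write_same _ _ _ _⟩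
  intro t₁ μ₁ _ hfr₁ hμ₁ ht₁
  refine Runs.seq (Runs.set hl rfl rfl (fun _ => Nat.zero_le _) ?_)
  change Runs l ω _ (μ₁.write 56 0 0) _
  refine Runs.seq (Runs.set hl rfl rfl (fun _ => Nat.zero_le _) ?_)
  change Runs l ω _ ((μ₁.write 56 0 0).write 57 0 0) _
  set μ₂ := (μ₁.write 56 0 0).write 57 0 0 with hμ₂
  have fr₂ : ∀ b, b ≠ 42 → b ≠ 3 → b ≠ 52 → b ≠ 56 → b ≠ 57 → μ₂ b = μ b :=
    fun b q1 q2 q3 q4 q5 => by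
      rw [hμ₂, Mem.write_of_ne _ q5, Mem.write_of_ne _ q4, hfr₁ b q1 q2
        (by simpa [Prog.writes] using q3)]
  have key : ∀ μ' : Mem, (∀ b, 3 < b → b < 41 → μ' b = μ₂ b) → Scalars n K E a k s m μ' ∧
      Reps n m H R r μ' ∧ ∀ v, μ' 23 v = S v := fun μ' h =>
    ⟨h1.congr fun b q1 q2 => by
        rw [h b (by omega) (by omega), fr₂ b] <;> omega,
      h3.congr fun b _ _ => by rw [h b (by omega) (by omega), fr₂ b] <;> omega,
      fun v => by rw [h 23 (by norm_num) (by norm_num), fr₂ 23, hS] <;> norm_num⟩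
  refine Runs.count hl (8 * a * n) (fun j μ' => (∀ v < n, μ' 3 v = if v ∈ sel j then 1 else 0) ∧
    μ' 56 0 = (sel j).card ∧ μ' 57 0 = ∑ v ∈ sel j, miss n H (R i) v) 150 (by norm_num)
    (by decide) rfl (fun m' h => ?_) han ?_ ?_ ?_
  · have h' := (key m' fun b q1 q2 => h b (by omega) (by simp [Prog.writes]; omega)).1
    simp only [Expr.val_mul, Expr.val_ofNat, Expr.val_get, Expr.val_lit, h'.val_a, h'.val_n]
  · have h0 : sel 0 = ∅ := rfl
    refine ⟨fun v hv => ?_, ?_, ?_⟩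
    · rw [Mem.write_of_ne _ (by norm_num), hμ₂, Mem.write_of_ne _ (by norm_num),
        Mem.write_of_ne _ (by norm_num), hμ₁, if_pos (by omega)]
      simp [h0]
    · rw [Mem.write_of_ne _ (by norm_num), hμ₂, Mem.write_of_ne _ (by norm_num), Mem.write_same]
      simp [h0]
    · rw [Mem.write_of_ne _ (by norm_num), hμ₂, Mem.write_same]
      simp [h0]
  · rintro j hj μ₃ hB₃ hfr₃ h41 ⟨g1, g2, g3⟩
    obtain ⟨k1, k3, k4⟩ := key μ₃ fun b q1 q2 => hfr₃ b (by omega) (by simp [Prog.writes]; omega)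
    have e : (Expr.var 41 - Expr.var 41 / Expr.var 4 * Expr.var 4).val μ₃ = j % n := by
      simp only [Expr.val_sub, Expr.val_mul, Expr.val_div, Expr.val_get, Expr.val_lit, h41,
        k1.val_n, sub_div_mul]
    have hv : j % n < n := Nat.mod_lt _ hn0
    refine Runs.seq (Runs.set hl rfl rfl (fun _ => ?_) ?_)
    · rw [e]; omega
    rw [e]
    change Runs l ω _ (μ₃.write 58 0 (j % n)) _
    set v := j % n with hvdef
    set μ₄ := μ₃.write 58 0 v with hμ₄
    have fr₄ : ∀ b, b ≠ 58 → μ₄ b = μ₃ b := fun b hb => Mem.write_of_ne _ hb _ _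
    have h58 : μ₄ 58 0 = v := Mem.write_same _ _ _ _
    have h53' : μ₄ 53 0 = i := by
      rw [fr₄ 53 (by norm_num), hfr₃ 53 (by norm_num) (by decide), fr₂ 53, h53] <;> norm_num
    have hq : (Expr.get 32 (.var 53 * .var 4 + .var 58)).val μ₄ = miss n H (R i) v := by
      simp only [Expr.val_add, Expr.val_mul, Expr.val_get, Expr.val_lit, h53', h58]
      rw [fr₄ 4 (by norm_num), k1.val_n, fr₄ 32 (by norm_num), k3.val_q i hi v hv]
    -- Each factor of the product tests one of the four conditions in `select`.
    have hcond : (Expr.get 23 (.var 58) * (1 - .get 3 (.var 58)) * (.var 5 - .var 56) *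
        ((.var 41 / .var 4 + 1) * .var 5 - 8 * .var 6 *
          .get 32 (.var 53 * .var 4 + .var 58))).val μ₄ ≠ 0 ↔
        (S v ≠ 0 ∧ v ∉ sel j ∧ (sel j).card < K ∧ 8 * E * miss n H (R i) v < (j / n + 1) * K) := by
      rw [Expr.val_mul, Expr.val_mul, Expr.val_mul, Expr.val_sub _ _ (_ * _), Expr.val_mul _ _ (Expr.get 32 _), hq]
      simp only [Expr.val_add, Expr.val_mul, Expr.val_get, Expr.val_lit, Expr.val_sub,
        Expr.val_ofNat, Expr.val_div, h58]
      rw [fr₄ 23 (by norm_num), fr₄ 3 (by norm_num), fr₄ 5 (by norm_num), fr₄ 56 (by norm_num),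
        fr₄ 41 (by norm_num), fr₄ 4 (by norm_num), fr₄ 6 (by norm_num), k1.val_n, k1.val_K,
        k1.val_E, h41, k4, g1 v hv, g2]
      simp only [ne_eq, mul_eq_zero, not_or, and_assoc]
      refine and_congr Iff.rfl (and_congr ?_ (and_congr ?_ ?_))
      · split_ifs with h <;> simp [h]
      · omega
      · omega
    refine Runs.ite hl rfl (fun hc => ?_) (fun hc => ?_)
    · have hc' := hcond.1 hc
      have hstep : sel (j + 1) = insert v (sel j) := by
        rw [hsel, select, if_pos]; exact hc'
      refine Runs.seq (Runs.set hl rfl rfl (fun _ => Nat.one_le_two_pow) ?_)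
      have e3 : (Expr.var 58).val μ₄ = v := h58
      rw [e3]
      change Runs l ω _ (μ₄.write 3 v 1) _
      have e56 : (Expr.var 56 + 1).val (μ₄.write 3 v 1) = (sel j).card + 1 := by
        rw [Expr.val_add, Expr.val_var, Mem.write_of_ne _ (by norm_num), fr₄ 56 (by norm_num), g2]
        rfl
      refine Runs.seq (Runs.set hl rfl rfl (fun _ => ?_) ?_)
      · rw [e56]; omega
      rw [e56]
      change Runs l ω _ ((μ₄.write 3 v 1).write 56 0 _) _
      set μ₅ := (μ₄.write 3 v 1).write 56 0 ((sel j).card + 1) with hμ₅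
      have fr₅ : ∀ b, b ≠ 3 → b ≠ 56 → μ₅ b = μ₄ b := fun b q1 q2 => by
        rw [hμ₅, Mem.write_of_ne _ q2, Mem.write_of_ne _ q1]
      have e57 : (Expr.var 57 + Expr.get 32 (.var 53 * .var 4 + .var 58)).val μ₅
          = ∑ v ∈ sel (j + 1), miss n H (R i) v := by
        have : (Expr.get 32 (.var 53 * .var 4 + .var 58)).val μ₅ =
            (Expr.get 32 (.var 53 * .var 4 + .var 58)).val μ₄ := by
          simp only [Expr.val_add, Expr.val_mul, Expr.val_get, Expr.val_lit]
          rw [fr₅ 53, fr₅ 4, fr₅ 58, fr₅ 32] <;> norm_num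
        rw [Expr.val_add, this, hq, Expr.val_var, fr₅ 57 (by norm_num) (by norm_num),
          fr₄ 57 (by norm_num), g3, hstep, Finset.sum_insert hc'.2.1, add_comm]
      refine Runs.set hl rfl rfl (fun _ => ?_) ⟨by simp, fun w hw => ?_, ?_, ?_⟩
      · rw [e57]; exact htot _
      · rw [Mem.write_of_ne _ (by norm_num), Mem.write_of_ne _ (by norm_num), hμ₅,
          Mem.write_of_ne _ (by norm_num), Mem.write_idx, hstep, fr₄ 3 (by norm_num), g1 w hw]
        by_cases h : w = v
        · simp [h]
        · simp [h]
      · rw [Mem.write_of_ne _ (by norm_num), Mem.write_of_ne _ (by norm_num), hμ₅, Mem.write_same,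
          hstep, Finset.card_insert_of_notMem hc'.2.1]
      · rw [Mem.write_of_ne _ (by norm_num), e57]
        exact Mem.write_same _ _ _ _
    · have hstep : sel (j + 1) = sel j := by
        rw [hsel, select, if_neg]
        exact fun h => hcond.2 h hc
      refine Runs.skip ⟨by simp, ?_⟩
      rw [hstep, Mem.write_of_ne _ (by norm_num), Mem.write_of_ne _ (by norm_num),
        Mem.write_of_ne _ (by norm_num), fr₄ 3 (by norm_num), fr₄ 56 (by norm_num),
        fr₄ 57 (by norm_num)]
      exact ⟨g1, g2, g3⟩
  · rintro t₃ μ₃ _ _ _ hI ht₃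
    refine ⟨?_, hI⟩
    simp only [Expr.nodes_get, Expr.nodes_mul, Expr.nodes_lit, Expr.nodes_ofNat] at ht₁ ht₃ ⊢
    have e1 : (8 * a + 1) * (n * 200) = 8 * a * n * 200 + n * 200 := by ring
    have e2 : 1 ≤ n := hn0
    omega

end Pieces

end ApproxClique

/-! ### The search through all walks. -/

namespace ApproxClique

open RAM Finset Mixing Torus

open Expr Prog in
/-- One step of the search, for the walk with number `var 40`. -/
def stepProg : Prog :=
  .ite (var 2) .skip <|
    .seq walkProg <|
    .seq findProg <|
    .seq appendProg <|
    .seq greedyProg <|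
    .ite ((1 - (var 5 - var 56)) * (var 5 * var 5 + 1 - 4 * var 6 * var 57)) (.set 2 0 1) .skip

open Expr Prog in
/-- The search through all walks. -/
def searchProg : Prog := .count 40 (var 12 * var 10) stepProg

/-- The greedy choice finds a set of the right size with few non-neighbours. -/
def Succeeds (n K E a : ℕ) (H : ℕ → ℕ → ℕ) (S R : ℕ → ℕ) : Prop :=
  (select n K S (fun v => 8 * E * miss n H R v) (8 * a * n)).card = K ∧
    4 * E * ∑ v ∈ select n K S (fun v => 8 * E * miss n H R v) (8 * a * n), miss n H R v ≤ K * K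

/-- `R` can serve as a representative of `S`. -/
def Represents (n K E k m : ℕ) (H : ℕ → ℕ → ℕ) (S R : ℕ → ℕ) : Prop :=
  (∀ v, R v ≤ 1) ∧ (R = S ∨ Close n K E k m H S R)

/-- The search failed for the walk with number `i`. -/
def FailsAt (n K E a k s m : ℕ) (H : ℕ → ℕ → ℕ) (i : ℕ) : Prop :=
  ∃ R, Represents n K E k m H (cand n k m s H i) R ∧ ¬ Succeeds n K E a H (cand n k m s H i) R

/-- Bank `3` holds the result of a successful search. -/
def Found (n K E a k s m : ℕ) (H : ℕ → ℕ → ℕ) (μ : Mem) : Prop :=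
  ∃ i R, Represents n K E k m H (cand n k m s H i) R ∧ Succeeds n K E a H (cand n k m s H i) R ∧
    ∀ v < n, μ 3 v = if v ∈ select n K (cand n k m s H i) (fun v => 8 * E * miss n H R v)
      (8 * a * n) then 1 else 0

/-- The invariant of the search. -/
def SearchInv (n K E a k s m : ℕ) (H : ℕ → ℕ → ℕ) (i : ℕ) (μ : Mem) : Prop :=
  (∀ v, n ≤ v → μ 23 v = 0) ∧
  (∃ R r, Reps n m H R r μ ∧ (∀ j v, R j v ≤ 1) ∧
    ∀ i < r, ∀ j < i, ¬ Close n K E k m H (R i) (R j)) ∧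
  (μ 2 0 = 0 ∧ (∀ j < i, FailsAt n K E a k s m H j) ∨ μ 2 0 = 1 ∧ Found n K E a k s m H μ)

theorem cand_le_one (n k m s : ℕ) (H : ℕ → ℕ → ℕ) (i v : ℕ) : cand n k m s H i v ≤ 1 := by
  unfold cand
  split_ifs
  · exact Finset.prod_le_one' fun t _ => Nat.sub_le _ _
  · exact Nat.zero_le _

section Pieces

variable {l : ℕ} {ω : ℕ → Bool} {n K E a k s m : ℕ} [NeZero m] {H : ℕ → ℕ → ℕ} {μ : Mem}

/-- The potential is the number of representatives, variable 30, times the cost of creating one.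
Which representative a candidate meets depends on the history of the search; the invariant records
only that some admissible one was used. -/
theorem stepProg_runs (hs : Sizes l n K E a k s m) (h1 : Scalars n K E a k s m μ)
    (h2 : Tables n k m H μ) (hn0 : 0 < n) (hnm : n ≤ m * m) (hH : IsNonEdge n H) {M : ℕ}
    (hM : M + 1 ≤ 2 ^ l)
    (hpack : ∀ (R : ℕ → ℕ → ℕ) r, (∀ j v, R j v ≤ 1) →
      (∀ i < r, ∀ j < i, ¬ Close n K E k m H (R i) (R j)) → r ≤ M)
    {i : ℕ} (hi : i < m * m * (16 ^ k) ^ s) (h40 : μ 40 0 = i)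
    (hI : SearchInv n K E a k s m H i μ) :
    Runs l ω stepProg μ fun t μ' =>
      t + (m * m * 100 + n * (n * 100 + 100) + 200) * μ 30 0 ≤
        ((s + 2) * (n * 100 + 100) + (M + 1) * (n * 16 ^ k * 200 + 400) + (8 * a + 1) * (n * 200)
          + 300) + (m * m * 100 + n * (n * 100 + 100) + 200) * μ' 30 0 ∧
      SearchInv n K E a k s m H (i + 1) μ' := by
  have hl := hs.pos
  obtain ⟨h23, ⟨R, r, h3, hR, hsep⟩, hout⟩ := hI
  have hrM := hpack R r hR hsep
  refine Runs.ite hl rfl (fun hc => ?_) (fun hc => ?_)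
  · rw [Expr.val_var] at hc
    refine Runs.skip ⟨?_, h23, ⟨R, r, h3, hR, hsep⟩, .inr ?_⟩
    · have : (Expr.var 2).nodes = 2 := rfl
      rw [this]; omega
    · rcases hout with h | h
      · exact absurd h.1 hc
      · exact h
  rw [Expr.val_var] at hc
  have hfail : ∀ j < i, FailsAt n K E a k s m H j := by
    rcases hout with h | h
    · exact h.2
    · omega
  set S := cand n k m s H i with hSdef
  have hS1 : ∀ v, S v ≤ 1 := cand_le_one n k m s H i
  refine Runs.seq ((walkProg_runs hs h1 h2 hi h40 h23).mono ?_)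
  rintro t₁ μ₁ - fr₁ ⟨ht₁, hS⟩
  have fr₁' : ∀ b, b < 23 ∨ 24 ≤ b ∧ b < 40 → μ₁ b = μ b := fun b hb => fr₁ b (by
    simp [walkProg, Prog.writes, Prog.table, Prog.count]; omega)
  have a1 : Scalars n K E a k s m μ₁ := h1.congr fun b _ _ => fr₁' b (by omega)
  have a2 : Tables n k m H μ₁ := h2.congr fun b _ _ => fr₁' b (by omega)
  have a3 : Reps n m H R r μ₁ := h3.congr fun b _ _ => fr₁' b (by omega)
  refine Runs.seq ((findProg_runs hs a1 a2 hnm hH hR (by omega) a3 hS hS1).mono ?_)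
  rintro t₂ μ₂ - fr₂ ⟨ht₂, i₀, h53, hi₀⟩
  have fr₂' : ∀ b, b < 40 → μ₂ b = μ₁ b := fun b hb => fr₂ b (by
    simp [findProg, Prog.writes, Prog.sum, Prog.count]; omega)
  have b1 : Scalars n K E a k s m μ₂ := a1.congr fun b _ _ => fr₂' b (by omega)
  have b2 : Tables n k m H μ₂ := a2.congr fun b _ _ => fr₂' b (by omega)
  have b3 : Reps n m H R r μ₂ := a3.congr fun b _ _ => fr₂' b (by omega)
  have bS : ∀ v, μ₂ 23 v = S v := fun v => by rw [fr₂' 23 (by norm_num), hS]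
  have hi₀r : i₀ ≤ r := by rcases hi₀ with h | h <;> omega
  refine Runs.seq ((appendProg_runs hs b1 b2 hH (by omega) b3 bS hS1 hi₀r h53).mono ?_)
  rintro t₃ μ₃ - fr₃ h₃
  have fr₃' : ∀ b, b < 30 → μ₃ b = μ₂ b := fun b hb => fr₃ b (by
    simp [appendProg, Prog.writes, Prog.table, Prog.sum, Prog.count]; omega)
  have c1 : Scalars n K E a k s m μ₃ := b1.congr fun b _ _ => fr₃' b (by omega)
  have cS : ∀ v, μ₃ 23 v = S v := fun v => by rw [fr₃' 23 (by norm_num), bS]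
  have c53 : μ₃ 53 0 = i₀ := by rw [fr₃ 53 (by decide), h53]
  obtain ⟨R', r', c3, hR', hsep', hi₀r', hrep, ht₃⟩ : ∃ R' r', Reps n m H R' r' μ₃ ∧
      (∀ j v, R' j v ≤ 1) ∧ (∀ i < r', ∀ j < i, ¬ Close n K E k m H (R' i) (R' j)) ∧ i₀ < r' ∧
      Represents n K E k m H S (R' i₀) ∧
      t₃ + (m * m * 100 + n * (n * 100 + 100) + 200) * r ≤
        20 + (m * m * 100 + n * (n * 100 + 100) + 200) * r' := by
    rcases h₃ with ⟨g1, g2, g3⟩ | ⟨rfl, g2, g3⟩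
    · refine ⟨R, r, g3, hR, hsep, g1, ⟨hR i₀, .inr ?_⟩, by omega⟩
      rcases hi₀ with h | h
      · omega
      · exact h.2
    · have hnc : ∀ j < i₀, ¬ Close n K E k m H S (R j) := by
        rcases hi₀ with h | h
        · exact h.2
        · omega
      refine ⟨_, _, g3, ?_, ?_, Nat.lt_succ_self _, ⟨?_, .inl ?_⟩, ?_⟩
      · intro j v
        rcases eq_or_ne j i₀ with rfl | h
        · rw [Function.update_self]; exact hS1 v
        · rw [Function.update_of_ne h]; exact hR j v
      · intro j hj j' hj'
        rw [Function.update_of_ne (show j' ≠ i₀ by omega)]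
        rcases eq_or_ne j i₀ with rfl | h
        · rw [Function.update_self]; exact hnc j' hj'
        · rw [Function.update_of_ne h]; exact hsep j (by omega) j' hj'
      · rw [Function.update_self]; exact hS1
      · rw [Function.update_self]
      · have := Nat.mul_add_one (m * m * 100 + n * (n * 100 + 100) + 200) i₀
        omega
  refine Runs.seq ((greedyProg_runs hs c1 hn0 hH hR' c3 cS hi₀r' c53).mono ?_)
  rintro t₄ μ₄ - fr₄ ⟨ht₄, hout₄, h56, h57⟩
  have fr₄' : ∀ b, b < 40 → b ≠ 3 → μ₄ b = μ₃ b := fun b hb hb' => fr₄ b (by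
    simp [greedyProg, Prog.writes, Prog.table, Prog.count]; omega)
  have d1 : Scalars n K E a k s m μ₄ := c1.congr fun b _ _ => fr₄' b (by omega) (by omega)
  have d3 : Reps n m H R' r' μ₄ := c3.congr fun b _ _ => fr₄' b (by omega) (by omega)
  have d2 : μ₄ 2 0 = 0 := by
    rw [fr₄' 2 (by norm_num) (by norm_num), fr₃' 2 (by norm_num), fr₂' 2 (by norm_num),
      fr₁' 2 (by norm_num), hc]
  have d23 : ∀ v, n ≤ v → μ₄ 23 v = 0 := fun v hv => by
    rw [fr₄' 23 (by norm_num) (by norm_num), cS, hSdef, cand, if_neg (by omega)]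
  have hcond : ((1 - (.var 5 - .var 56)) * (.var 5 * .var 5 + 1 - 4 * .var 6 * .var 57) :
      Expr).val μ₄ ≠ 0 ↔ Succeeds n K E a H S (R' i₀) := by
    simp only [Expr.val_add, Expr.val_mul, Expr.val_get, Expr.val_lit, Expr.val_sub,
      Expr.val_ofNat, d1.val_K, d1.val_E, h56, h57, Succeeds]
    have := select_card_le n K S (fun v => 8 * E * miss n H (R' i₀) v) (8 * a * n)
    rw [mul_ne_zero_iff]
    refine and_congr ?_ ?_
    · omega
    · omega
  have time : t₁ + (t₂ + (t₃ + (t₄ + 100))) + (m * m * 100 + n * (n * 100 + 100) + 200) * r ≤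
      ((s + 2) * (n * 100 + 100) + (M + 1) * (n * 16 ^ k * 200 + 400) + (8 * a + 1) * (n * 200)
          + 220) + (m * m * 100 + n * (n * 100 + 100) + 200) * r' := by
    have : (r + 1) * (n * 16 ^ k * 200 + 400) ≤ (M + 1) * (n * 16 ^ k * 200 + 400) :=
      Nat.mul_le_mul_right _ (by omega)
    omega
  rw [h3.val_r]
  refine Runs.ite hl rfl (fun h => ?_) (fun h => ?_)
  · refine Runs.set hl rfl rfl (fun _ => Nat.one_le_two_pow) ⟨?_, fun v hv => ?_,
      ⟨R', r', d3.congr fun b _ _ => Mem.write_of_ne _ (by omega) _ _, hR', hsep'⟩, .inr ⟨?_, ?_⟩⟩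
    · rw [Mem.write_of_ne _ (by norm_num), d3.val_r]
      simp only [Expr.nodes_get, Expr.nodes_add, Expr.nodes_sub, Expr.nodes_mul, Expr.nodes_lit,
        Expr.nodes_ofNat]
      omega
    · rw [Mem.write_of_ne _ (by norm_num), d23 v hv]
    · exact Mem.write_same _ _ _ _
    · refine ⟨i, R' i₀, hrep, hcond.1 h, fun v hv => ?_⟩
      rw [Mem.write_of_ne _ (by norm_num), hout₄ v hv]
  · refine Runs.skip ⟨?_, d23, ⟨R', r', d3, hR', hsep'⟩, .inl ⟨d2, fun j hj => ?_⟩⟩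
    · rw [d3.val_r]
      simp only [Expr.nodes_get, Expr.nodes_add, Expr.nodes_sub, Expr.nodes_mul, Expr.nodes_lit,
        Expr.nodes_ofNat]
      omega
    · rcases Nat.lt_succ_iff_lt_or_eq.1 hj with hj | rfl
      · exact hfail j hj
      · exact ⟨R' i₀, hrep, fun h' => hcond.2 h' h⟩

theorem searchProg_runs (hs : Sizes l n K E a k s m) (h1 : Scalars n K E a k s m μ)
    (h2 : Tables n k m H μ) (hn0 : 0 < n) (hnm : n ≤ m * m) (hH : IsNonEdge n H) {M : ℕ}
    (hM : M + 1 ≤ 2 ^ l)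
    (hpack : ∀ (R : ℕ → ℕ → ℕ) r, (∀ j v, R j v ≤ 1) →
      (∀ i < r, ∀ j < i, ¬ Close n K E k m H (R i) (R j)) → r ≤ M)
    (h23 : ∀ v, μ 23 v = 0) (h30 : μ 30 0 = 0) (hfound : μ 2 0 = 0) :
    Runs l ω searchProg μ fun t μ' =>
      t ≤ m * m * (16 ^ k) ^ s * ((s + 2) * (n * 100 + 100) + (M + 1) * (n * 16 ^ k * 200 + 400) +
        (8 * a + 1) * (n * 200) + 400) + 20 + (m * m * 100 + n * (n * 100 + 100) + 200) * M ∧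
      (μ' 2 0 = 0 ∧ (∀ j < m * m * (16 ^ k) ^ s, FailsAt n K E a k s m H j) ∨
        μ' 2 0 = 1 ∧ Found n K E a k s m H μ') := by
  have hl := hs.pos
  have hN : m * m * (16 ^ k) ^ s ≤ 2 ^ (20 * l) := by
    refine le_pow_of_le (i := 3) ?_ (by norm_num)
    rw [pow_succ, pow_two]
    exact Nat.mul_le_mul (Nat.mul_le_mul hs.le_m hs.le_m) hs.le_D
  have fr : ∀ μ' : Mem, (∀ b, b ≠ 40 → b ∉ stepProg.writes → μ' b = μ b) →
      ∀ b, 4 ≤ b → b ≤ 16 → μ' b = μ b := fun μ' h b q1 q2 => h b (by omega) (by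
    simp [stepProg, walkProg, findProg, appendProg, greedyProg, Prog.writes, Prog.table, Prog.sum,
      Prog.count]; omega)
  unfold searchProg
  refine Runs.count_potential hl (m * m * (16 ^ k) ^ s) (SearchInv n K E a k s m H)
    (fun μ => (m * m * 100 + n * (n * 100 + 100) + 200) * μ 30 0)
    ((s + 2) * (n * 100 + 100) + (M + 1) * (n * 16 ^ k * 200 + 400) + (8 * a + 1) * (n * 200)
          + 300) (by norm_num) (by decide) rfl (fun μ' h => ?_) hN ?_ ?_ ?_
  · have := h1.congr fun b q1 q2 => fr μ' h b q1 (by omega)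
    rw [Expr.val_mul, Expr.val_var, Expr.val_var, this.val_Q, this.val_D]
  · refine ⟨fun v _ => ?_, ⟨fun _ _ => 0, 0, ⟨?_, by simp, by simp⟩, by simp, by simp⟩,
      .inl ⟨?_, by simp⟩⟩
    · rw [Mem.write_of_ne _ (by norm_num), h23]
    · rw [Mem.write_of_ne _ (by norm_num), h30]
    · rw [Mem.write_of_ne _ (by norm_num), hfound]
  · intro j hj μ' _ hfr h40 hI
    refine (stepProg_runs hs (h1.congr fun b q1 q2 => fr μ' hfr b q1 (by omega))
      (h2.congr fun b q1 q2 => fr μ' hfr b (by omega) q2) hn0 hnm hH hM hpack hj h40 hI).mono ?_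
    rintro t μ'' - - ⟨ht, e1, ⟨R, r, e2, e3, e4⟩, e5⟩
    have wr : ∀ b, b ≠ 40 → μ''.write 40 0 (j + 1) b = μ'' b := fun b hb => Mem.write_of_ne _ hb _ _
    refine ⟨?_, fun v hv => ?_, ⟨R, r, e2.congr fun b _ _ => wr b (by omega), e3, e4⟩, ?_⟩
    · rw [wr 30 (by norm_num)]; exact ht
    · rw [wr 23 (by norm_num), e1 v hv]
    · rw [wr 2 (by norm_num)]
      refine e5.imp_right fun ⟨f1, i, R, f2, f3, f4⟩ => ⟨f1, i, R, f2, f3, fun v hv => ?_⟩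
      rw [wr 3 (by norm_num), f4 v hv]
  · rintro t μ' _ _ _ ⟨_, ⟨R, r, e2, e3, e4⟩, e5⟩ ht
    refine ⟨?_, e5⟩
    have hr := hpack R r e3 e4
    rw [e2.val_r] at ht
    simp only [Expr.nodes_get, Expr.nodes_mul, Expr.nodes_lit] at ht
    have t1 : (m * m * 100 + n * (n * 100 + 100) + 200) * r ≤
      (m * m * 100 + n * (n * 100 + 100) + 200) * M := Nat.mul_le_mul_left _ hr
    have t2 : m * m * (16 ^ k) ^ s * ((s + 2) * (n * 100 + 100) +
        (M + 1) * (n * 16 ^ k * 200 + 400) + (8 * a + 1) * (n * 200) + 300 +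
          (1 + 1 + (1 + 1) + 1 + 10)) ≤ m * m * (16 ^ k) ^ s * ((s + 2) * (n * 100 + 100) +
        (M + 1) * (n * 16 ^ k * 200 + 400) + (8 * a + 1) * (n * 200) + 400) :=
      Nat.mul_le_mul_left _ (by omega)
    omega

end Pieces

end ApproxClique

/-! ### Powers and equality tests. -/

namespace RAM

variable {l : ℕ} {ω : ℕ → Bool}

/-- Variable `b` becomes the power of the value of `f` with exponent `e`. -/
def Prog.power (b i : ℕ) (e f : Expr) : Prog :=
  .seq (.set b 0 1) (.count i e (.set b 0 (.var b * f)))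

theorem Runs.power (hl : 0 < l) {b i : ℕ} {e f : Expr} {m : Mem} {Q : ℕ → Mem → Prop} (N F : ℕ)
    (hi : i ≠ 0) (hib : i ≠ b) (he : (e - .var i).ok = true) (hf : (.var b * f : Expr).ok = true)
    (hval : ∀ m', (∀ a, a ≠ i → a ≠ b → m' a = m a) → e.val m' = N ∧ f.val m' = F)
    (hF : 0 < F) (hN : N ≤ 2 ^ (20 * l)) (hS : F ^ N ≤ 2 ^ (20 * l))
    (hQ : ∀ t m', (∀ a, a ≠ i → a ≠ b → m' a = m a) → m' b 0 = F ^ N →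
      t ≤ N * (f.nodes + e.nodes + 20) + (e.nodes + 20) → Q t m') :
    Runs l ω (.power b i e f) m Q := by
  refine Runs.seq (Runs.set hl rfl rfl (fun _ => Nat.one_le_two_pow) ?_)
  change Runs l ω _ (m.write b 0 1) _
  have fr : ∀ m' : Mem, (∀ a, a ≠ i → a ∉ (Prog.set b 0 (.var b * f)).writes →
      m' a = m.write b 0 1 a) → ∀ a, a ≠ i → a ≠ b → m' a = m a := by
    intro m' h a ha hb
    rw [h a ha (by simpa [Prog.writes] using hb), Mem.write_of_ne _ hb]
  refine Runs.count hl N (fun j m' => m' b 0 = F ^ j) (f.nodes + 10) hi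
    (by simpa [Prog.writes] using hib) he (fun m' h => (hval m' (fr m' h)).1) hN ?_ ?_ ?_
  · rw [Mem.write_of_ne _ hib.symm, Mem.write_same, pow_zero]
  · intro j hj m' _ hfr hij hI
    have hv : (Expr.var b * f).val m' = F ^ (j + 1) := by
      rw [Expr.val_mul, Expr.val_var, hI, (hval m' (fr m' hfr)).2, pow_succ]
    refine Runs.set hl rfl hf (fun _ => ?_) ⟨?_, ?_⟩
    · rw [hv]
      exact (Nat.pow_le_pow_right hF hj).trans hS
    · simp only [Expr.nodes_get, Expr.nodes_mul, Expr.nodes_lit, Expr.nodes_ofNat]; omega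
    · rw [Mem.write_of_ne _ hib.symm, hv]
      exact Mem.write_same _ _ _ _
  · intro t m' _ hfr _ hI ht
    refine hQ _ m' (fr m' hfr) hI ?_
    simp only [Expr.nodes_ofNat]
    have : N * (f.nodes + 10 + (e.nodes + 10)) = N * (f.nodes + e.nodes + 20) := by ring
    omega

/-- If the values of `e` and `f` are equal then `p` else `q`. -/
def Prog.ifEq (e f : Expr) (p q : Prog) : Prog := .ite (e - f + (f - e)) q p

theorem Runs.ifEq (hl : 0 < l) {e f : Expr} {p q : Prog} {m : Mem} {Q : ℕ → Mem → Prop}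
    (he : (e - f + (f - e)).ok = true)
    (hp : e.val m = f.val m → Runs l ω p m fun t m' => Q (2 * (e.nodes + f.nodes) + 4 + t) m')
    (hq : e.val m ≠ f.val m → Runs l ω q m fun t m' => Q (2 * (e.nodes + f.nodes) + 4 + t) m') :
    Runs l ω (.ifEq e f p q) m Q := by
  have h : (e - f + (f - e)).nodes + 1 = 2 * (e.nodes + f.nodes) + 4 := by
    simp only [Expr.nodes_add, Expr.nodes_sub]; ring
  have hv : (e - f + (f - e)).val m = 0 ↔ e.val m = f.val m := by
    simp only [Expr.val_add, Expr.val_sub]; omega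
  refine Runs.ite hl he (fun hc => ?_) (fun hc => ?_)
  · rw [h]; exact hq fun h' => hc (hv.2 h')
  · rw [h]; exact hp (hv.1 hc)

end RAM

/-! ### Computing the parameters and the steps on the torus. -/

namespace ApproxClique

open RAM Finset Mixing Torus

open Expr Prog in
/-- Computes the scalars of the environment from `n`, `K`, `E`. -/
def scalarsProg : Prog :=
  .seq (.set 7 0 ((var 4 / var 5 + 1) * var 6)) <|
  .seq (.set 8 0 (5376 * var 7)) <|
  .seq (.set 13 0 (32 * var 7 + 1)) <|
  .seq (.power 9 41 (var 8) 16) <|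
  .seq (.power 10 41 (var 13) (var 9)) <|
  .seq (.count 41 (var 4) (.ite (var 4 - var 11 * var 11) (.set 11 0 (var 11 + 1)) .skip)) <|
  .set 12 0 (var 11 * var 11)

open Expr Prog in
/-- Moves the vertex `var 52` of the torus along the generator given by the last digit of
`var 53`. -/
def moveProg : Prog :=
  .seq (.set 54 0 (var 52 / var 11)) <|
  .seq (.set 55 0 (var 52 - var 52 / var 11 * var 11)) <|
  .seq (.set 56 0 (var 53 - var 53 / 16 * 16)) <|
  .seq (.set 53 0 (var 53 / 16)) <|
  .ifEq (var 56) 8 (.set 52 0 ((var 54 + var 55 - (var 54 + var 55) / var 11 * var 11) * var 11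
    + var 55)) <|
  .ifEq (var 56) 9 (.set 52 0 ((var 54 + (var 11 - var 55) -
    (var 54 + (var 11 - var 55)) / var 11 * var 11) * var 11 + var 55)) <|
  .ifEq (var 56) 10 (.set 52 0 (var 54 * var 11 + (var 55 + var 54 -
    (var 55 + var 54) / var 11 * var 11))) <|
  .ifEq (var 56) 11 (.set 52 0 (var 54 * var 11 + (var 55 + (var 11 - var 54) -
    (var 55 + (var 11 - var 54)) / var 11 * var 11))) <|
  .ifEq (var 56) 12 (.set 52 0 ((var 54 + 1 - (var 54 + 1) / var 11 * var 11) * var 11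
    + var 55)) <|
  .ifEq (var 56) 13 (.set 52 0 ((var 54 + (var 11 - 1) -
    (var 54 + (var 11 - 1)) / var 11 * var 11) * var 11 + var 55)) <|
  .ifEq (var 56) 14 (.set 52 0 (var 54 * var 11 + (var 55 + 1 -
    (var 55 + 1) / var 11 * var 11))) <|
  .ifEq (var 56) 15 (.set 52 0 (var 54 * var 11 + (var 55 + (var 11 - 1) -
    (var 55 + (var 11 - 1)) / var 11 * var 11)))
  .skip

open Expr Prog in
/-- Computes the tables of the environment. -/
def tablesProg : Prog :=
  .seq (.table 14 42 52 0 (var 4 * var 4) (.set 52 0 ((1 - get 1 (var 42)) *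
    (1 - (1 - ((var 42 / var 4 - (var 42 - var 42 / var 4 * var 4)) +
      ((var 42 - var 42 / var 4 * var 4) - var 42 / var 4))))))) <|
  .seq (.table 15 42 52 0 (var 12 * var 9)
    (.seq (.set 52 0 (var 42 / var 9)) <|
     .seq (.set 53 0 (var 42 - var 42 / var 9 * var 9)) <|
     .count 43 (var 8) moveProg)) <|
  .table 16 42 52 0 (var 4 * var 9) (.sum 52 43 (var 4)
    (get 14 (var 42 / var 9 * var 4 + var 43) * get 14 (get 15 (var 42) * var 4 + var 43)))

/-- The non-edges of the graph with the adjacency matrix `A`. -/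
def nonEdge (n : ℕ) (A : ℕ → ℕ) (u v : ℕ) : ℕ :=
  if u < n ∧ v < n ∧ u ≠ v then 1 - A (u * n + v) else 0

section Pieces

variable {l : ℕ} {ω : ℕ → Bool} {n K E a k s m : ℕ} {μ : Mem}

theorem scalarsProg_runs (hl : 0 < l) (hn0 : 0 < n) (hn : n ≤ 2 ^ l)
    (ha : (n / K + 1) * E ≤ 2 ^ l) (hk : 5376 * ((n / K + 1) * E) ≤ 2 ^ l)
    (hs : 32 * ((n / K + 1) * E) + 1 ≤ 2 ^ l) (hd : 16 ^ (5376 * ((n / K + 1) * E)) ≤ 2 ^ l)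
    (hD : (16 ^ (5376 * ((n / K + 1) * E))) ^ (32 * ((n / K + 1) * E) + 1) ≤ 2 ^ l)
    (h4 : μ 4 0 = n) (h5 : μ 5 0 = K) (h6 : μ 6 0 = E) (h11 : μ 11 0 = 0) :
    Runs l ω scalarsProg μ fun t μ' =>
      t ≤ (n + (n / K + 1) * E) * 1000000 + 1000 ∧ ∃ m, 0 < m ∧ m ≤ n ∧ n ≤ m * m ∧ m * m ≤ 4 * n ∧
      Scalars n K E ((n / K + 1) * E) (5376 * ((n / K + 1) * E)) (32 * ((n / K + 1) * E) + 1) m μ' := by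
  have h1 : ∀ x, x ≤ 2 ^ l → x ≤ 2 ^ (20 * l) := fun x hx =>
    le_pow_of_le (i := 1) (by simpa using hx) (by norm_num)
  set a := (n / K + 1) * E with hadef
  unfold scalarsProg
  have e7 : ((Expr.var 4 / .var 5 + 1) * .var 6).val μ = a := by
    simp only [Expr.val_add, Expr.val_mul, Expr.val_div, Expr.val_get, Expr.val_lit,
      Expr.val_ofNat, h4, h5, h6, hadef]
  refine Runs.seq (Runs.set hl rfl rfl (fun _ => by rw [e7]; exact h1 _ ha) ?_)
  rw [e7]
  change Runs l ω _ (μ.write 7 0 a) _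
  have e8 : (5376 * Expr.var 7).val (μ.write 7 0 a) = 5376 * a := by
    rw [Expr.val_mul, Expr.val_var, Mem.write_same, Expr.val_ofNat]
  refine Runs.seq (Runs.set hl rfl rfl (fun _ => by rw [e8]; exact h1 _ hk) ?_)
  rw [e8]
  change Runs l ω _ ((μ.write 7 0 a).write 8 0 (5376 * a)) _
  have e13 : (32 * Expr.var 7 + 1).val ((μ.write 7 0 a).write 8 0 (5376 * a)) = 32 * a + 1 := by
    rw [Expr.val_add, Expr.val_mul, Expr.val_var, Mem.write_of_ne _ (by norm_num), Mem.write_same,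
      Expr.val_ofNat, Expr.val_ofNat]
  refine Runs.seq (Runs.set hl rfl rfl (fun _ => by rw [e13]; exact h1 _ hs) ?_)
  rw [e13]
  change Runs l ω _ (((μ.write 7 0 a).write 8 0 (5376 * a)).write 13 0 (32 * a + 1)) _
  set μ₁ := ((μ.write 7 0 a).write 8 0 (5376 * a)).write 13 0 (32 * a + 1) with hμ₁
  have g13 : μ₁ 13 0 = 32 * a + 1 := Mem.write_same _ _ _ _
  have g8 : μ₁ 8 0 = 5376 * a := by
    rw [hμ₁, Mem.write_of_ne _ (by norm_num), Mem.write_same]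
  have g7 : μ₁ 7 0 = a := by
    rw [hμ₁, Mem.write_of_ne _ (by norm_num), Mem.write_of_ne _ (by norm_num), Mem.write_same]
  have fr₁ : ∀ b, b ≠ 7 → b ≠ 8 → b ≠ 13 → μ₁ b = μ b := fun b q1 q2 q3 => by
    rw [hμ₁, Mem.write_of_ne _ q3, Mem.write_of_ne _ q2, Mem.write_of_ne _ q1]
  refine Runs.seq (Runs.power hl (5376 * a) 16 (by norm_num) (by norm_num) rfl rfl
    (fun m' h => ⟨?_, rfl⟩) (by norm_num) (h1 _ hk) (h1 _ hd) ?_)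
  · rw [Expr.val_var, h 8 (by norm_num) (by norm_num), g8]
  intro t₂ μ₂ fr₂ g9 ht₂
  refine Runs.seq (Runs.power hl (32 * a + 1) (16 ^ (5376 * a)) (by norm_num) (by norm_num) rfl rfl
    (fun m' h => ⟨?_, ?_⟩) (by positivity) (h1 _ hs) (h1 _ hD) ?_)
  · rw [Expr.val_var, h 13 (by norm_num) (by norm_num), fr₂ 13 (by norm_num) (by norm_num), g13]
  · rw [Expr.val_var, h 9 (by norm_num) (by norm_num), g9]
  intro t₃ μ₃ fr₃ g10 ht₃
  have fr₃' : ∀ b, b ≠ 41 → b ≠ 9 → b ≠ 10 → μ₃ b = μ₁ b := fun b q1 q2 q3 => by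
    rw [fr₃ b q1 q3, fr₂ b q1 q2]
  have g4 : μ₃ 4 0 = n := by
    rw [fr₃' 4, fr₁ 4, h4] <;> norm_num
  refine Runs.seq (Runs.count hl n (fun j μ' => ∃ x, μ' 11 0 = x ∧ x ≤ j ∧ (n ≤ x * x ∨ x = j) ∧
    (x = 0 ∨ (x - 1) * (x - 1) < n)) 20 (by norm_num) (by decide) rfl (fun m' h => ?_) (h1 _ hn)
    ?_ ?_ ?_)
  · rw [Expr.val_var, h 4 (by norm_num) (by decide), g4]
  · refine ⟨0, ?_, le_rfl, .inr rfl, .inl rfl⟩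
    rw [Mem.write_of_ne _ (by norm_num), fr₃' 11, fr₁ 11, h11] <;> norm_num
  · rintro j hj μ' hB hfr - ⟨x, hx, hxj, hx1, hx2⟩
    have hv : (Expr.var 4 - Expr.var 11 * Expr.var 11).val μ' = n - x * x := by
      rw [Expr.val_sub, Expr.val_mul, Expr.val_var, Expr.val_var, hx,
        hfr 4 (by norm_num) (by decide), g4]
    refine Runs.ite hl rfl (fun hc => ?_) (fun hc => ?_)
    · rw [hv] at hc
      refine Runs.set hl rfl rfl (fun _ => ?_) ⟨by simp, x + 1, ?_, by omega, ?_, ?_⟩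
      · rw [Expr.val_add, Expr.val_var, hx, Expr.val_ofNat]
        have := h1 _ hn
        omega
      · rw [Mem.write_of_ne _ (by norm_num), Expr.val_add, Expr.val_var, hx]
        exact Mem.write_same _ _ _ _
      · right; omega
      · right; rw [Nat.add_sub_cancel]; omega
    · rw [hv] at hc
      refine Runs.skip ⟨by simp, x, ?_, by omega, .inl (by omega), hx2⟩
      rw [Mem.write_of_ne _ (by norm_num), hx]
  rintro t₄ μ₄ - fr₄ - ⟨x, hx, hxn, hx1, hx2⟩ ht₄
  have hxx : n ≤ x * x := by
    rcases hx1 with h | rfl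
    · exact h
    · exact Nat.le_mul_self _
  have hx0 : 0 < x := by
    rcases Nat.eq_zero_or_pos x with rfl | h
    · omega
    · exact h
  -- The loop stops increasing `x` at the first square that reaches `n`, so (x - 1)² < n.
  have hx4 : x * x ≤ 4 * n := by
    obtain ⟨y, rfl⟩ : ∃ y, x = y + 1 := ⟨x - 1, by omega⟩
    rcases hx2 with h | h
    · omega
    · rw [Nat.add_sub_cancel] at h
      have := Nat.le_mul_self y
      nlinarith
  have e12 : (Expr.var 11 * Expr.var 11).val μ₄ = x * x := by
    rw [Expr.val_mul, Expr.val_var, hx]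
  refine Runs.set hl rfl rfl (fun _ => ?_) ⟨?_, x, hx0, hxn, hxx, hx4, ?_⟩
  · rw [e12]
    refine le_pow_of_le (i := 2) ?_ (by norm_num)
    rw [pow_two]; exact Nat.mul_le_mul (hxn.trans hn) (hxn.trans hn)
  · simp only [Expr.nodes_get, Expr.nodes_add, Expr.nodes_mul, Expr.nodes_div, Expr.nodes_lit,
      Expr.nodes_ofNat] at ht₂ ht₃ ht₄ ⊢
    omega
  · have w : ∀ b, b ≠ 12 → b ≠ 41 → b ≠ 11 → μ₄.write 12 ((0 : Expr).val μ₄)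
        ((Expr.var 11 * Expr.var 11).val μ₄) b = μ₃ b := fun b q1 q2 q3 => by
      rw [Mem.write_of_ne _ q1, fr₄ b q2 (by simp [Prog.writes]; omega)]
    refine ⟨?_, ?_, ?_, ?_, ?_, ?_, ?_, ?_, ?_, ?_⟩
    · rw [w 4, g4] <;> norm_num
    · rw [w 5, fr₃' 5, fr₁ 5, h5] <;> norm_num
    · rw [w 6, fr₃' 6, fr₁ 6, h6] <;> norm_num
    · rw [w 7, fr₃' 7, g7] <;> norm_num
    · rw [w 8, fr₃' 8, g8] <;> norm_num
    · rw [w 9, fr₃ 9, g9] <;> norm_num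
    · rw [w 10, g10] <;> norm_num
    · rw [Mem.write_of_ne _ (by norm_num), hx]
    · rw [e12]; exact Mem.write_same _ _ _ _
    · rw [w 13, fr₃' 13, g13] <;> norm_num


theorem step_lt [NeZero m] {u : ℕ} (hu : u < m * m) (g : ℕ) : step m u g < m * m := by
  obtain ⟨z, rfl⟩ := exists_enc hu
  rw [step_enc]; exact enc_lt _

theorem moveProg_runs [NeZero m] (hl : 0 < l) (hm : m ≤ 2 ^ l) (h11 : μ 11 0 = m) {u c : ℕ}
    (hu : u < m * m) (h52 : μ 52 0 = u) (h53 : μ 53 0 = c) :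
    Runs l ω moveProg μ fun t μ' => t ≤ 500 ∧ μ' 52 0 = step m u (c % 16) ∧ μ' 53 0 = c / 16 := by
  have hmm : m * m ≤ 2 ^ (20 * l) := by
    refine le_pow_of_le (i := 2) ?_ (by norm_num)
    rw [pow_two]; exact Nat.mul_le_mul hm hm
  have hstep := step_lt hu (c % 16)
  unfold moveProg
  refine Runs.seq (Runs.set hl rfl rfl (fun hB => (Nat.div_le_self _ _).trans
    (hB _ (by norm_num) _)) ?_)
  have e1 : (Expr.var 52 / Expr.var 11).val μ = u / m := by
    rw [Expr.val_div, Expr.val_var, Expr.val_var, h52, h11]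
  rw [e1]
  change Runs l ω _ (μ.write 54 0 (u / m)) _
  generalize hμ₁ : μ.write 54 0 (u / m) = μ₁
  have fr₁ : ∀ b, b ≠ 54 → μ₁ b = μ b := fun b hb => by rw [← hμ₁, Mem.write_of_ne _ hb]
  have a54 : μ₁ 54 0 = u / m := by rw [← hμ₁, Mem.write_same]
  refine Runs.seq (Runs.set hl rfl rfl (fun hB => (Nat.sub_le _ _).trans
    (hB _ (by norm_num) _)) ?_)
  have e2 : (Expr.var 52 - Expr.var 52 / Expr.var 11 * Expr.var 11).val μ₁ = u % m := by
    rw [Expr.val_sub, Expr.val_mul, Expr.val_div, Expr.val_var, Expr.val_var,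
      fr₁ 52 (by norm_num), fr₁ 11 (by norm_num), h52, h11, sub_div_mul]
  rw [e2]
  change Runs l ω _ (μ₁.write 55 0 (u % m)) _
  generalize hμ₂ : μ₁.write 55 0 (u % m) = μ₂
  have fr₂ : ∀ b, b ≠ 55 → μ₂ b = μ₁ b := fun b hb => by rw [← hμ₂, Mem.write_of_ne _ hb]
  have a55 : μ₂ 55 0 = u % m := by rw [← hμ₂, Mem.write_same]
  refine Runs.seq (Runs.set hl rfl rfl (fun hB => (Nat.sub_le _ _).trans
    (hB _ (by norm_num) _)) ?_)
  have e3 : (Expr.var 53 - Expr.var 53 / 16 * 16).val μ₂ = c % 16 := by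
    rw [Expr.val_sub, Expr.val_mul, Expr.val_div, Expr.val_var, Expr.val_ofNat,
      fr₂ 53 (by norm_num), fr₁ 53 (by norm_num), h53, sub_div_mul]
  rw [e3]
  change Runs l ω _ (μ₂.write 56 0 (c % 16)) _
  generalize hμ₃ : μ₂.write 56 0 (c % 16) = μ₃
  have fr₃ : ∀ b, b ≠ 56 → μ₃ b = μ₂ b := fun b hb => by rw [← hμ₃, Mem.write_of_ne _ hb]
  have a56 : μ₃ 56 0 = c % 16 := by rw [← hμ₃, Mem.write_same]
  refine Runs.seq (Runs.set hl rfl rfl (fun hB => (Nat.div_le_self _ _).trans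
    (hB _ (by norm_num) _)) ?_)
  have e4 : (Expr.var 53 / 16).val μ₃ = c / 16 := by
    rw [Expr.val_div, Expr.val_var, Expr.val_ofNat, fr₃ 53 (by norm_num), fr₂ 53 (by norm_num),
      fr₁ 53 (by norm_num), h53]
  rw [e4]
  change Runs l ω _ (μ₃.write 53 0 (c / 16)) _
  generalize hμ₄ : μ₃.write 53 0 (c / 16) = μ₄
  have fr₄ : ∀ b, b ≠ 53 → μ₄ b = μ₃ b := fun b hb => by rw [← hμ₄, Mem.write_of_ne _ hb]
  have b53 : μ₄ 53 0 = c / 16 := by rw [← hμ₄, Mem.write_same]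
  have b52 : μ₄ 52 0 = u := by
    rw [fr₄ 52, fr₃ 52, fr₂ 52, fr₁ 52, h52] <;> norm_num
  have b11 : μ₄ 11 0 = m := by
    rw [fr₄ 11, fr₃ 11, fr₂ 11, fr₁ 11, h11] <;> norm_num
  have b54 : μ₄ 54 0 = u / m := by
    rw [fr₄ 54, fr₃ 54, fr₂ 54, a54] <;> norm_num
  have b55 : μ₄ 55 0 = u % m := by
    rw [fr₄ 55, fr₃ 55, a55] <;> norm_num
  have b56 : μ₄ 56 0 = c % 16 := by
    rw [fr₄ 56, a56]; norm_num
  clear hμ₁ hμ₂ hμ₃ hμ₄ fr₁ fr₂ fr₃ fr₄ e1 e2 e3 e4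
  have hv56 : (Expr.var 56).val μ₄ = c % 16 := b56
  have set_runs : ∀ e : Expr, e.ok = true → e.nodes ≤ 40 → ∀ g, c % 16 = g →
      e.val μ₄ = step m u g → Runs l ω (.set 52 0 e) μ₄ fun t μ' =>
        t ≤ 50 ∧ μ' 52 0 = step m u (c % 16) ∧ μ' 53 0 = c / 16 := by
    intro e he hn g hg hv
    rw [← hg] at hv
    refine Runs.set hl rfl he (fun _ => ?_) ⟨?_, ?_, ?_⟩
    · rw [hv]; exact hstep.le.trans hmm
    · simp only [Expr.nodes_ofNat]; omega
    · rw [hv]; exact Mem.write_same _ _ _ _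
    · rw [Mem.write_of_ne _ (by norm_num), b53]
  refine Runs.ifEq hl rfl (fun h8 => ?_) (fun h8 => ?_)
  · refine (set_runs _ rfl (by simp) 8 (hv56.symm.trans h8) ?_).mono fun t μ' _ _ h =>
      ⟨by simp only [Expr.nodes_get, Expr.nodes_sub, Expr.nodes_mul, Expr.nodes_div,
        Expr.nodes_lit, Expr.nodes_ofNat]; omega, h.2⟩
    simp [step, b54, b55, b11, sub_div_mul]
  refine Runs.ifEq hl rfl (fun h9 => ?_) (fun h9 => ?_)
  · refine (set_runs _ rfl (by simp) 9 (hv56.symm.trans h9) ?_).mono fun t μ' _ _ h =>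
      ⟨by simp only [Expr.nodes_get, Expr.nodes_sub, Expr.nodes_mul, Expr.nodes_div,
        Expr.nodes_lit, Expr.nodes_ofNat]; omega, h.2⟩
    simp [step, b54, b55, b11, sub_div_mul]
  refine Runs.ifEq hl rfl (fun h10 => ?_) (fun h10 => ?_)
  · refine (set_runs _ rfl (by simp) 10 (hv56.symm.trans h10) ?_).mono fun t μ' _ _ h =>
      ⟨by simp only [Expr.nodes_get, Expr.nodes_sub, Expr.nodes_mul, Expr.nodes_div,
        Expr.nodes_lit, Expr.nodes_ofNat]; omega, h.2⟩
    simp [step, b54, b55, b11, sub_div_mul]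
  refine Runs.ifEq hl rfl (fun h11 => ?_) (fun h11 => ?_)
  · refine (set_runs _ rfl (by simp) 11 (hv56.symm.trans h11) ?_).mono fun t μ' _ _ h =>
      ⟨by simp only [Expr.nodes_get, Expr.nodes_sub, Expr.nodes_mul, Expr.nodes_div,
        Expr.nodes_lit, Expr.nodes_ofNat]; omega, h.2⟩
    simp [step, b54, b55, b11, sub_div_mul]
  refine Runs.ifEq hl rfl (fun h12 => ?_) (fun h12 => ?_)
  · refine (set_runs _ rfl (by simp) 12 (hv56.symm.trans h12) ?_).mono fun t μ' _ _ h =>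
      ⟨by simp only [Expr.nodes_get, Expr.nodes_sub, Expr.nodes_mul, Expr.nodes_div,
        Expr.nodes_lit, Expr.nodes_ofNat]; omega, h.2⟩
    simp [step, b54, b55, b11, sub_div_mul]
  refine Runs.ifEq hl rfl (fun h13 => ?_) (fun h13 => ?_)
  · refine (set_runs _ rfl (by simp) 13 (hv56.symm.trans h13) ?_).mono fun t μ' _ _ h =>
      ⟨by simp only [Expr.nodes_get, Expr.nodes_sub, Expr.nodes_mul, Expr.nodes_div,
        Expr.nodes_lit, Expr.nodes_ofNat]; omega, h.2⟩
    simp [step, b54, b55, b11, sub_div_mul]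
  refine Runs.ifEq hl rfl (fun h14 => ?_) (fun h14 => ?_)
  · refine (set_runs _ rfl (by simp) 14 (hv56.symm.trans h14) ?_).mono fun t μ' _ _ h =>
      ⟨by simp only [Expr.nodes_get, Expr.nodes_sub, Expr.nodes_mul, Expr.nodes_div,
        Expr.nodes_lit, Expr.nodes_ofNat]; omega, h.2⟩
    simp [step, b54, b55, b11, sub_div_mul]
  refine Runs.ifEq hl rfl (fun h15 => ?_) (fun h15 => ?_)
  · refine (set_runs _ rfl (by simp) 15 (hv56.symm.trans h15) ?_).mono fun t μ' _ _ h =>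
      ⟨by simp only [Expr.nodes_get, Expr.nodes_sub, Expr.nodes_mul, Expr.nodes_div,
        Expr.nodes_lit, Expr.nodes_ofNat]; omega, h.2⟩
    simp [step, b54, b55, b11, sub_div_mul]
  -- The remaining digits 0, …, 7 are the copies of the identity.
  refine Runs.skip ⟨by simp, ?_, b53⟩
  rw [hv56] at h8 h9 h10 h11 h12 h13 h14 h15
  simp only [Expr.val_ofNat] at h8 h9 h10 h11 h12 h13 h14 h15
  rw [b52]
  simp [step, h8, h9, h10, h11, h12, h13, h14, h15]

end Pieces

end ApproxClique

/-! ### The tables of non-edges, macro steps and codegrees. -/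

namespace ApproxClique

open RAM Finset Mixing Torus

theorem isNonEdge_nonEdge {n : ℕ} {A : ℕ → ℕ}
    (hA : ∀ u < n, ∀ v < n, A (u * n + v) = A (v * n + u)) : IsNonEdge n (nonEdge n A) where
  symm u v := by
    unfold nonEdge
    by_cases h : u < n ∧ v < n ∧ u ≠ v
    · rw [if_pos h, if_pos ⟨h.2.1, h.1, h.2.2.symm⟩, hA u h.1 v h.2.1]
    · rw [if_neg h, if_neg fun h' => h ⟨h'.2.1, h'.1, h'.2.2.symm⟩]
  le_one u v := by unfold nonEdge; split_ifs <;> omega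
  diag u := by simp [nonEdge]
  supp u v h := by rw [nonEdge, if_neg (by omega)]

variable {l : ℕ} {ω : ℕ → Bool} {n K E a k s m : ℕ} [NeZero m] {H : ℕ → ℕ → ℕ} {μ : Mem}

/-- Codegrees are computed only for the `n * 16 ^ k` pairs joined by the expander, at order `n`
each; doing so for all pairs of vertices would take cubic time. -/
theorem tablesProg_runs (hs : Sizes l n K E a k s m) (h1 : Scalars n K E a k s m μ)
    (hn0 : 0 < n) (hnm : n ≤ m * m) (hH : IsNonEdge n H)
    (hA : ∀ u < n, ∀ v < n, H u v = nonEdge n (μ 1) u v) (h14 : ∀ i, μ 14 i = 0) :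
    Runs l ω tablesProg μ fun t μ' =>
      t ≤ n * n * 200 + m * m * 16 ^ k * (k * 1000 + 1000) + n * 16 ^ k * (n * 100 + 200) + 200 ∧
      Tables n k m H μ' := by
  have hl := hs.pos
  have hd : 0 < 16 ^ k := by positivity
  have h1' : ∀ x, x ≤ 2 ^ l → x ≤ 2 ^ (20 * l) := fun x hx =>
    le_pow_of_le (i := 1) (by simpa using hx) (by norm_num)
  have hn := h1' _ hs.le_n
  have hk := h1' _ hs.le_k
  have hnn : n * n ≤ 2 ^ (20 * l) := by
    refine le_pow_of_le (i := 2) ?_ (by norm_num)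
    rw [pow_two]; exact Nat.mul_le_mul hs.le_n hs.le_n
  have hnd : n * 16 ^ k ≤ 2 ^ (20 * l) := by
    refine le_pow_of_le (i := 2) ?_ (by norm_num)
    rw [pow_two]; exact Nat.mul_le_mul hs.le_n hs.le_d
  have hQd : m * m * 16 ^ k ≤ 2 ^ (20 * l) := by
    refine le_pow_of_le (i := 3) ?_ (by norm_num)
    rw [pow_succ, pow_two]
    exact Nat.mul_le_mul (Nat.mul_le_mul hs.le_m hs.le_m) hs.le_d
  unfold tablesProg
  refine Runs.seq (Runs.table hl (n * n) 0 (fun i => H (i / n) (i % n)) 60 (by norm_num)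
    (by norm_num) (by norm_num) (by decide) (by decide) rfl rfl (fun m' h => ⟨?_, rfl⟩) hnn ?_ ?_)
  · rw [Expr.val_mul, Expr.val_var, h 4 (by norm_num) (by norm_num) (by decide), h1.val_n]
  · intro j hj m' _ hfr _ h42
    have hu : j / n < n := (Nat.div_lt_iff_lt_mul hn0).2 hj
    have hv : j % n < n := Nat.mod_lt _ hn0
    -- The second factor is the indicator of u ≠ v, obtained from the truncated differences in both
    -- directions.
    have e : ((1 - Expr.get 1 (.var 42)) * (1 - (1 - ((.var 42 / .var 4 - (.var 42 - .var 42 /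
        .var 4 * .var 4)) + ((.var 42 - .var 42 / .var 4 * .var 4) - .var 42 / .var 4))))).val m'
        = H (j / n) (j % n) := by
      simp only [Expr.val_add, Expr.val_mul, Expr.val_get, Expr.val_lit, Expr.val_sub,
        Expr.val_ofNat, Expr.val_div, h42]
      rw [hfr 1 (by norm_num) (by norm_num) (by decide),
        hfr 4 (by norm_num) (by norm_num) (by decide), h1.val_n, sub_div_mul, hA _ hu _ hv, nonEdge,
        Nat.div_add_mod']
      by_cases h : j / n = j % n
      · rw [if_neg fun h' => h'.2.2 h, h]; simp
      · rw [if_pos ⟨hu, hv, h⟩,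
          show 1 - (1 - (j / n - j % n + (j % n - j / n))) = 1 by omega, mul_one]
    refine Runs.set hl rfl rfl (fun _ => ?_) ⟨by simp, ?_⟩
    · rw [e]; exact (hH.le_one _ _).trans Nat.one_le_two_pow
    · rw [e]; exact Mem.write_same _ _ _ _
  rintro t₁ μ₁ - fr₁ hμ₁ ht₁
  have fr₁' : ∀ b, b < 14 → μ₁ b = μ b := fun b hb =>
    fr₁ b (by omega) (by omega) (by simp [Prog.writes]; omega)
  have a1 : Scalars n K E a k s m μ₁ := h1.congr fun b _ _ => fr₁' b (by omega)
  -- All `u` are needed, since walks also visit points of the torus beyond `n`. Their rows lie past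
  -- the table, in cells that are still 0.
  have aH : ∀ u v, v < n → μ₁ 14 (u * n + v) = H u v := by
    intro u v hv
    rw [hμ₁]
    rcases lt_or_ge u n with hu | hu
    · have : (u + 1) * n ≤ n * n := Nat.mul_le_mul_right _ hu
      rw [add_mul] at this
      rw [if_pos (by omega), Nat.sub_zero, mul_comm u n, Nat.mul_add_div hn0, Nat.div_eq_of_lt hv,
        Nat.mul_add_mod, Nat.mod_eq_of_lt hv, add_zero]
    · have : n * n ≤ u * n := Nat.mul_le_mul_right _ hu
      rw [if_neg (by omega), h14, hH.supp u v hu]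
  refine Runs.seq (Runs.table hl (m * m * 16 ^ k) 0 (fun i => nbr m k (i / 16 ^ k) (i % 16 ^ k))
    (k * 520 + 60) (by norm_num) (by norm_num) (by norm_num) (by decide) (by decide) rfl rfl
    (fun m' h => ⟨?_, rfl⟩) hQd ?_ ?_)
  · have fr : ∀ b, 4 ≤ b → b ≤ 13 → m' b = μ₁ b := fun b q1 q2 => h b (by omega) (by omega) (by
      simp [moveProg, Prog.ifEq, Prog.writes, Prog.count]; omega)
    have := a1.congr fr
    rw [Expr.val_mul, Expr.val_var, Expr.val_var, this.val_Q, this.val_d]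
  · intro j hj m' _ hfr _ h42
    have fr : ∀ b, 4 ≤ b → b ≤ 13 → m' b = μ₁ b := fun b q1 q2 => hfr b (by omega) (by omega) (by
      simp [moveProg, Prog.ifEq, Prog.writes, Prog.count]; omega)
    have b1 := a1.congr fr
    have hu : j / 16 ^ k < m * m := (Nat.div_lt_iff_lt_mul hd).2 hj
    have e1 : (Expr.var 42 / Expr.var 9).val m' = j / 16 ^ k := by
      rw [Expr.val_div, Expr.val_var, Expr.val_var, h42, b1.val_d]
    refine Runs.seq (Runs.set hl rfl rfl (fun hB => (Nat.div_le_self _ _).trans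
      (hB _ (by norm_num) _)) ?_)
    rw [e1]
    change Runs l ω _ (m'.write 52 0 (j / 16 ^ k)) _
    generalize hμ₂ : m'.write 52 0 (j / 16 ^ k) = μ₂
    have fr₂ : ∀ b, b ≠ 52 → μ₂ b = m' b := fun b hb => by rw [← hμ₂, Mem.write_of_ne _ hb]
    have c52 : μ₂ 52 0 = j / 16 ^ k := by rw [← hμ₂, Mem.write_same]
    have e2 : (Expr.var 42 - Expr.var 42 / Expr.var 9 * Expr.var 9).val μ₂ = j % 16 ^ k := by
      rw [Expr.val_sub, Expr.val_mul, Expr.val_div, Expr.val_var, Expr.val_var,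
        fr₂ 42 (by norm_num), fr₂ 9 (by norm_num), h42, b1.val_d, sub_div_mul]
    refine Runs.seq (Runs.set hl rfl rfl (fun hB => (Nat.sub_le _ _).trans
      (hB _ (by norm_num) _)) ?_)
    rw [e2]
    change Runs l ω _ (μ₂.write 53 0 (j % 16 ^ k)) _
    generalize hμ₃ : μ₂.write 53 0 (j % 16 ^ k) = μ₃
    have fr₃ : ∀ b, b ≠ 53 → μ₃ b = μ₂ b := fun b hb => by rw [← hμ₃, Mem.write_of_ne _ hb]
    have d53 : μ₃ 53 0 = j % 16 ^ k := by rw [← hμ₃, Mem.write_same]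
    have d52 : μ₃ 52 0 = j / 16 ^ k := by rw [fr₃ 52 (by norm_num), c52]
    have b3 : Scalars n K E a k s m μ₃ := b1.congr fun b _ _ => by
      rw [fr₃ b (by omega), fr₂ b (by omega)]
    have fr₄ : ∀ ν : Mem, (∀ b, b ≠ 43 → b ∉ moveProg.writes → ν b = μ₃ b) →
        Scalars n K E a k s m ν := fun ν h => b3.congr fun b _ _ => h b (by omega) (by
      simp [moveProg, Prog.ifEq, Prog.writes]; omega)
    refine Runs.count hl k (fun i ν => ν 52 0 = walk 16 (step m) (j / 16 ^ k) (j % 16 ^ k) i ∧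
      ν 53 0 = j % 16 ^ k / 16 ^ i) 500 (by norm_num) (by decide) rfl (fun ν h => ?_) hk ?_ ?_ ?_
    · rw [Expr.val_var, (fr₄ ν h).val_k]
    · rw [Mem.write_of_ne _ (by norm_num), Mem.write_of_ne _ (by norm_num), d52, d53]
      simp [walk]
    · rintro i hi ν - hν - ⟨g1, g2⟩
      have hx : walk 16 (step m) (j / 16 ^ k) (j % 16 ^ k) i < m * m := nbr_lt i hu _
      refine (moveProg_runs hl hs.le_m (fr₄ ν hν).val_m hx g1 g2).mono ?_
      rintro t ν' - - ⟨q1, q2, q3⟩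
      refine ⟨q1, ?_, ?_⟩
      · rw [Mem.write_of_ne _ (by norm_num), q2]; rfl
      · rw [Mem.write_of_ne _ (by norm_num), q3, Nat.div_div_eq_div_mul, pow_succ]
    · rintro t ν - - - ⟨g1, -⟩ ht
      refine ⟨?_, g1⟩
      simp only [Expr.nodes_get, Expr.nodes_sub, Expr.nodes_mul, Expr.nodes_div, Expr.nodes_lit,
        Expr.nodes_ofNat] at ht ⊢
      omega
  rintro t₂ μ₂ - fr₂ hμ₂ ht₂
  have fr₂' : ∀ b, 4 ≤ b → b ≤ 14 → μ₂ b = μ₁ b := fun b q1 q2 => fr₂ b (by omega) (by omega) (by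
      simp [moveProg, Prog.ifEq, Prog.writes, Prog.count]; omega)
  have b1 : Scalars n K E a k s m μ₂ := a1.congr fun b q1 q2 => fr₂' b q1 (by omega)
  have bW : ∀ u < m * m, ∀ c < 16 ^ k, μ₂ 15 (u * 16 ^ k + c) = nbr m k u c := by
    intro u hu c hc
    have : (u + 1) * 16 ^ k ≤ m * m * 16 ^ k := Nat.mul_le_mul_right _ hu
    rw [add_mul] at this
    rw [hμ₂, if_pos (by omega), Nat.sub_zero, mul_comm u, Nat.mul_add_div hd, Nat.div_eq_of_lt hc,
        Nat.mul_add_mod, Nat.mod_eq_of_lt hc, add_zero]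
  have bH : ∀ u v, v < n → μ₂ 14 (u * n + v) = H u v := fun u v hv => by
    rw [fr₂' 14 (by norm_num) (by norm_num), aH u v hv]
  refine Runs.table hl (n * 16 ^ k) 0
    (fun i => codeg n H (i / 16 ^ k) (nbr m k (i / 16 ^ k) (i % 16 ^ k)))
    (n * 60 + 60) (by norm_num) (by norm_num) (by norm_num) (by decide) (by decide) rfl rfl
    (fun m' h => ⟨?_, rfl⟩) hnd ?_ ?_
  · have := b1.congr fun b _ _ => h b (by omega) (by omega) (by
      simp [Prog.sum, Prog.writes, Prog.count]; omega)
    rw [Expr.val_mul, Expr.val_var, Expr.val_var, this.val_n, this.val_d]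
  · intro j hj m' _ hfr _ h42
    have fr : ∀ b, 4 ≤ b → b ≤ 15 → m' b = μ₂ b := fun b q1 q2 => hfr b (by omega) (by omega) (by
      simp [Prog.sum, Prog.writes, Prog.count]; omega)
    have hu : j / 16 ^ k < n := (Nat.div_lt_iff_lt_mul hd).2 hj
    refine Runs.sum hl n (fun v => H (j / 16 ^ k) v * H (nbr m k (j / 16 ^ k) (j % 16 ^ k)) v)
      (by norm_num) (by norm_num) rfl rfl (fun m'' h => ?_) hn ?_ ((codeg_le hH _ _).trans hn) ?_
    · rw [Expr.val_var, h 4 (by norm_num) (by norm_num), fr 4 (by norm_num) (by norm_num),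
        b1.val_n]
    · intro v hv m'' h h43
      simp only [Expr.val_get, Expr.val_add, Expr.val_mul, Expr.val_div, Expr.val_lit, h43]
      rw [h 42 (by norm_num) (by norm_num), h42, h 4 (by norm_num) (by norm_num),
        fr 4 (by norm_num) (by norm_num), b1.val_n, h 9 (by norm_num) (by norm_num),
        fr 9 (by norm_num) (by norm_num), b1.val_d, h 14 (by norm_num) (by norm_num),
        fr 14 (by norm_num) (by norm_num), bH _ _ hv, h 15 (by norm_num) (by norm_num),
        fr 15 (by norm_num) (by norm_num)]
      have := bW _ (hu.trans_le hnm) _ (Nat.mod_lt j hd)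
      rw [Nat.div_add_mod'] at this
      rw [this, bH _ _ hv]
    · intro t m'' _ _ h52 ht
      refine ⟨?_, h52⟩
      simp only [Expr.nodes_get, Expr.nodes_add, Expr.nodes_mul, Expr.nodes_div,
        Expr.nodes_lit] at ht
      omega
  rintro t₃ μ₃ - fr₃ hμ₃ ht₃
  have fr₃' : ∀ b, 4 ≤ b → b ≤ 15 → μ₃ b = μ₂ b := fun b q1 q2 => fr₃ b (by omega) (by omega) (by
      simp [Prog.sum, Prog.writes, Prog.count]; omega)
  refine ⟨?_, fun u v hv => ?_, fun u hu c hc => ?_, fun u hu c hc => ?_⟩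
  · simp only [Expr.nodes_get, Expr.nodes_mul, Expr.nodes_lit, Expr.nodes_ofNat] at ht₁ ht₂ ht₃
    have i1 : m * m * 16 ^ k * (k * 520 + 60 + 1 + (1 + 1 + (1 + 1) + 1) + 20) ≤
      m * m * 16 ^ k * (k * 1000 + 1000) := Nat.mul_le_mul_left _ (by omega)
    have i2 : n * 16 ^ k * (n * 60 + 60 + 1 + (1 + 1 + (1 + 1) + 1) + 20) ≤
      n * 16 ^ k * (n * 100 + 200) := Nat.mul_le_mul_left _ (by omega)
    omega
  · rw [fr₃' 14 (by norm_num) (by norm_num), bH u v hv]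
  · rw [fr₃' 15 (by norm_num) (by norm_num), bW u hu c hc]
  · have : (u + 1) * 16 ^ k ≤ n * 16 ^ k := Nat.mul_le_mul_right _ hu
    rw [add_mul] at this
    rw [hμ₃, if_pos (by omega), Nat.sub_zero, mul_comm u, Nat.mul_add_div hd, Nat.div_eq_of_lt hc,
        Nat.mul_add_mod, Nat.mod_eq_of_lt hc, add_zero]

end ApproxClique

namespace ApproxClique

open RAM Finset Mixing Torus

/-! ### Correctness of the search -/

section Correctness

variable {n K E k m : ℕ} [NeZero m] {H : ℕ → ℕ → ℕ}

/-- The gap of the expander is small compared with the precision of the search. -/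
structure Precise (n K E a k m : ℕ) : Prop where
  pos_K : 0 < K
  two_le_E : 2 ≤ E
  pos_a : 0 < a
  lt : n * E < a * K
  le : n ≤ m * m
  le_four : m * m ≤ 4 * n
  gap : (383 / 384 : ℝ) ^ k * (2 ^ 11 * (a : ℝ) ^ 3) ≤ 1

/-- By the first half of `corr_bounds` the estimate never falls below the true distance, whatever
the gap of the expander. -/
theorem Close.dist2_le {S R : ℕ → ℕ} (hnm : n ≤ m * m) (hH : IsNonEdge n H) (hS : ∀ v, S v ≤ 1)
    (hR : ∀ v, R v ≤ 1) (h : Close n K E k m H S R) :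
    256 * (E : ℝ) ^ 2 * dist2 n H S R ≤ (K : ℝ) ^ 3 := by
  have h1 := (corr_bounds (m := m) (k := k) hnm hH hS hR).1
  have hd : (0 : ℝ) < (16 ^ k : ℕ) := by positivity
  have h0 := dist2_nonneg n H S R
  set pos := corrPos n (16 ^ k) (nbr m k) H S R
  set neg := corrNeg n (16 ^ k) (nbr m k) H S R
  have hQ : (0 : ℝ) < (m * m : ℕ) := by
    have := NeZero.pos m
    positivity
  -- The subtraction in `Close` is truncated; as the estimate is nonnegative, nothing is cut off.
  have hle : neg ≤ pos := by
    have h2 : 0 ≤ ((m * m : ℕ) : ℝ) * ((pos : ℝ) - neg) := (by positivity : (0 : ℝ) ≤ _).trans h1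
    have := nonneg_of_mul_nonneg_right h2 hQ
    exact_mod_cast sub_nonneg.1 this
  have h' : (512 : ℝ) * E * E * (m * m : ℕ) * ((pos : ℝ) - neg) ≤ (16 ^ k : ℕ) * K * K * K := by
    have : ((512 * E * E * (m * m) * (pos - neg) : ℕ) : ℝ) ≤ (16 ^ k * K * K * K : ℕ) := by
      exact_mod_cast h
    rw [← Nat.cast_sub hle]
    push_cast at this ⊢
    exact this
  have : 512 * (E : ℝ) ^ 2 * dist2 n H S R * (16 ^ k : ℕ) ≤ (K : ℝ) ^ 3 * (16 ^ k : ℕ) :=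
    calc 512 * (E : ℝ) ^ 2 * dist2 n H S R * (16 ^ k : ℕ)
        = 512 * (E : ℝ) ^ 2 * (dist2 n H S R * (16 ^ k : ℕ)) := by ring
      _ ≤ 512 * (E : ℝ) ^ 2 * ((m * m : ℕ) * ((pos : ℝ) - neg)) := by gcongr
      _ = 512 * E * E * (m * m : ℕ) * ((pos : ℝ) - neg) := by ring
      _ ≤ (16 ^ k : ℕ) * K * K * K := h'
      _ = _ := by ring
  have := le_of_mul_le_mul_right this hd
  have : 0 ≤ (E : ℝ) ^ 2 * dist2 n H S R := by positivity
  linarith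

-- The error term of `corr_bounds`. With m² ≤ 4n and nE ≤ aK it is reduced to the gap condition; a
-- factor 2 remains, which is absorbed by E ≥ 2.
omit [NeZero m] in
theorem Precise.error_le {a : ℕ} (hp : Precise n K E a k m) :
    1024 * (E : ℝ) ^ 2 * ((383 / 384) ^ k * (m * m : ℕ) * (n : ℝ) ^ 2) ≤ (K : ℝ) ^ 3 := by
  have ha : (0 : ℝ) < a := by exact_mod_cast hp.pos_a
  have hE : (2 : ℝ) ≤ E := by exact_mod_cast hp.two_le_E
  have h1 : (n : ℝ) * E ≤ a * K := by exact_mod_cast hp.lt.le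
  have h4 : ((m * m : ℕ) : ℝ) ≤ 4 * n := by exact_mod_cast hp.le_four
  have hg := hp.gap
  set L : ℝ := (383 / 384) ^ k with hL
  have hL0 : 0 ≤ L := by positivity
  have h3 : ((n : ℝ) * E) ^ 3 ≤ (a * K) ^ 3 := by gcongr
  have key : 1024 * (E : ℝ) ^ 2 * (L * (m * m : ℕ) * (n : ℝ) ^ 2) * ((a : ℝ) ^ 3 * E) ≤
      (K : ℝ) ^ 3 * ((a : ℝ) ^ 3 * E) :=
    calc 1024 * (E : ℝ) ^ 2 * (L * (m * m : ℕ) * (n : ℝ) ^ 2) * ((a : ℝ) ^ 3 * E)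
        ≤ 1024 * (E : ℝ) ^ 2 * (L * (4 * n) * (n : ℝ) ^ 2) * ((a : ℝ) ^ 3 * E) := by gcongr
      _ = 2 * (L * (2 ^ 11 * (a : ℝ) ^ 3)) * ((n : ℝ) * E) ^ 3 := by ring
      _ ≤ 2 * 1 * (a * K) ^ 3 := by gcongr
      _ = 2 * ((K : ℝ) ^ 3 * (a : ℝ) ^ 3) := by ring
      _ ≤ E * ((K : ℝ) ^ 3 * (a : ℝ) ^ 3) := by gcongr
      _ = _ := by ring
  exact le_of_mul_le_mul_right key (by positivity)

/-- By `error_le` the error of the estimate takes at most half of the threshold, which turns 512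
into 1024. -/
theorem Precise.lt_dist2 {a : ℕ} (hp : Precise n K E a k m) (hH : IsNonEdge n H) {S R : ℕ → ℕ}
    (hS : ∀ v, S v ≤ 1) (hR : ∀ v, R v ≤ 1) (h : ¬ Close n K E k m H S R) :
    (K : ℝ) ^ 3 / (1024 * (E : ℝ) ^ 2) < dist2 n H S R := by
  have h2 := (corr_bounds (m := m) (k := k) hp.le hH hS hR).2
  have hd : (0 : ℝ) < (16 ^ k : ℕ) := by positivity
  have hE : (0 : ℝ) < E := by exact_mod_cast (show 0 < E by have := hp.two_le_E; omega)
  set pos := corrPos n (16 ^ k) (nbr m k) H S R with hpos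
  set neg := corrNeg n (16 ^ k) (nbr m k) H S R with hneg
  have hlt : 16 ^ k * K * K * K < 512 * E * E * (m * m) * (pos - neg) := not_le.1 h
  have hle : neg ≤ pos := by
    by_contra hcon
    rw [Nat.sub_eq_zero_of_le (by omega)] at hlt
    omega
  have h' : (16 ^ k : ℕ) * (K : ℝ) ^ 3 <
      512 * (E : ℝ) ^ 2 * ((m * m : ℕ) * ((pos : ℝ) - neg)) := by
    have : ((16 ^ k * K * K * K : ℕ) : ℝ) < (512 * E * E * (m * m) * (pos - neg) : ℕ) := by
      exact_mod_cast hlt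
    rw [Nat.cast_mul (512 * E * E * (m * m)), Nat.cast_sub hle] at this
    push_cast at this ⊢
    calc (16 : ℝ) ^ k * (K : ℝ) ^ 3 = 16 ^ k * K * K * K := by ring
      _ < _ := this
      _ = _ := by ring
  have he := hp.error_le
  have h5 : (K : ℝ) ^ 3 * (16 ^ k : ℕ) < (512 * (E : ℝ) ^ 2 *
      (dist2 n H S R + (383 / 384) ^ k * (m * m : ℕ) * (n : ℝ) ^ 2)) * (16 ^ k : ℕ) :=
    calc (K : ℝ) ^ 3 * (16 ^ k : ℕ) = (16 ^ k : ℕ) * (K : ℝ) ^ 3 := by ring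
      _ < _ := h'
      _ ≤ 512 * (E : ℝ) ^ 2 * ((dist2 n H S R + (383 / 384) ^ k * (m * m : ℕ) * (n : ℝ) ^ 2)
          * (16 ^ k : ℕ)) := by gcongr
      _ = _ := by ring
  have h6 := lt_of_mul_lt_mul_right h5 hd.le
  rw [div_lt_iff₀ (by positivity)]
  linarith

/-- A separated family of sets is small. -/
theorem Precise.card_le {a P : ℕ} (hp : Precise n K E a k m) (hn : 0 < n) (hP : n ≤ K * P)
    (hH : IsNonEdge n H) (R : ℕ → ℕ → ℕ) (r : ℕ) (hR : ∀ j v, R j v ≤ 1)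
    (hsep : ∀ i < r, ∀ j < i, ¬ Close n K E k m H (R i) (R j)) :
    r ≤ 2 * 2 ^ (8192 * (P ^ 3 * E ^ 2)) := by
  have hE : 0 < E := by have := hp.two_le_E; omega
  have hP0 : 0 < P := by
    rcases Nat.eq_zero_or_pos P with rfl | h
    · omega
    · exact h
  -- The sample size t = 8192P³E² is what 8n³/t ≤ K³/(1024E²) requires when n ≤ KP.
  refine packing (θ := (K : ℝ) ^ 3 / (1024 * (E : ℝ) ^ 2)) hn (by positivity) hH.le_one hR ?_
    fun i hi j hj => hp.lt_dist2 hH (hR i) (hR j) (hsep i hi j hj)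
  have hE' : (0 : ℝ) < E := by exact_mod_cast hE
  have hP' : (0 : ℝ) < P := by exact_mod_cast hP0
  have h1 : (n : ℝ) ≤ K * P := by exact_mod_cast hP
  push_cast
  rw [div_le_div_iff₀ (by positivity) (by positivity)]
  calc 8 * (n : ℝ) ^ 3 * (1024 * (E : ℝ) ^ 2) ≤ 8 * (K * P : ℝ) ^ 3 * (1024 * (E : ℝ) ^ 2) := by
        gcongr
    _ = _ := by ring

theorem Represents.dist2_le {S R : ℕ → ℕ} (hnm : n ≤ m * m) (hH : IsNonEdge n H)
    (hS : ∀ v, S v ≤ 1) (h : Represents n K E k m H S R) :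
    256 * (E : ℝ) ^ 2 * dist2 n H S R ≤ (K : ℝ) ^ 3 := by
  rcases h.2 with rfl | hc
  · have : dist2 n H R R = 0 := by simp [dist2]
    rw [this, mul_zero]
    positivity
  · exact hc.dist2_le hnm hH hS h.1

/-- The walk from `exists_good_walk` is among those enumerated. At its number the selection succeeds
for every admissible representative: the choice s = 32a makes the sampling error at most half of
what `select_succeeds` allows (`t1`), and the gap of the expander takes at most the other half
(`t2`). -/
theorem Precise.exists_not_failsAt {a : ℕ} (hp : Precise n K E a k m) (hn : 0 < n)
    (hH : IsNonEdge n H) {A : Finset ℕ} (hA : A ⊆ range n) (hAK : A.card = K)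
    (hcl : ∀ u ∈ A, ∀ v ∈ A, H u v = 0) :
    ∃ i < m * m * (16 ^ k) ^ (32 * a + 1), ¬ FailsAt n K E a k (32 * a + 1) m H i := by
  have hE : 0 < E := by have := hp.two_le_E; omega
  have ha0 := hp.pos_a
  have hK0 := hp.pos_K
  have hAne : A.Nonempty := Finset.card_pos.1 (by omega)
  obtain ⟨u, hu, c, hc, h1, h2⟩ := exists_good_walk (m := m) (k := k) hp.le hH hA hAne hcl
    (s := 32 * a) (by omega)
  set D := (16 ^ k) ^ (32 * a + 1) with hD
  have hD0 : 0 < D := by positivity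
  have hlt : u * D + c < m * m * D := by
    have : (u + 1) * D ≤ m * m * D := Nat.mul_le_mul_right _ hu
    rw [add_mul] at this
    omega
  refine ⟨u * D + c, hlt, ?_⟩
  rintro ⟨R, hrep, hfail⟩
  refine hfail ?_
  have hcand : cand n k m (32 * a + 1) H (u * D + c) = fun v => if v < n then
      common H (walk (16 ^ k) (nbr m k) u c) (32 * a + 1) v else 0 := by
    funext v
    rw [cand, ← hD, mul_comm u D, Nat.mul_add_div hD0, Nat.div_eq_of_lt hc, Nat.mul_add_mod,
      Nat.mod_eq_of_lt hc, add_zero]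
  have hd := hrep.dist2_le hp.le hH (cand_le_one _ _ _ _ _ _)
  refine select_succeeds hn hH hrep.1 hE hp.lt (A := A) (fun v hv => ?_) hAK hd ?_
  · have hvn := mem_range.1 (hA hv)
    rw [hcand]
    exact ⟨hvn, by beta_reduce; rw [if_pos hvn]; exact h1 v hv⟩
  · rw [hcand]
    rw [hAK] at h2
    have ha : (1 : ℝ) ≤ a := by exact_mod_cast ha0
    have hE' : (1 : ℝ) ≤ E := by exact_mod_cast hE
    have hK : (0 : ℝ) < K := by exact_mod_cast hK0
    have hnE : (n : ℝ) * E ≤ a * K := by exact_mod_cast hp.lt.le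
    have h4 : ((m * m : ℕ) : ℝ) ≤ 4 * n := by exact_mod_cast hp.le_four
    have hg := hp.gap
    set L : ℝ := (383 / 384) ^ k with hL
    have hL0 : 0 ≤ L := by positivity
    have t1 : 16 * (E : ℝ) * (n * (K * (1 / (32 * a : ℕ)))) ≤ (K : ℝ) ^ 2 / 2 := by
      push_cast
      have e : 16 * (E : ℝ) * (n * (K * (1 / (32 * a)))) = (n * E) * K / (2 * a) := by
        field_simp; ring
      rw [e, div_le_div_iff₀ (by positivity) (by norm_num)]
      have := mul_le_mul_of_nonneg_right hnE hK.le
      nlinarith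
    have t2 : 16 * (E : ℝ) * (n * (K * (L * (m * m : ℕ) / K))) ≤ (K : ℝ) ^ 2 / 2 := by
      have e : 16 * (E : ℝ) * (n * (K * (L * (m * m : ℕ) / K))) = 16 * E * n * L * (m * m : ℕ) := by
        field_simp
      rw [e]
      have h5 : 16 * (E : ℝ) * n * L * (m * m : ℕ) * (32 * (a : ℝ) ^ 3) ≤
          (K : ℝ) ^ 2 * (a : ℝ) ^ 3 :=
        calc 16 * (E : ℝ) * n * L * (m * m : ℕ) * (32 * (a : ℝ) ^ 3)
            ≤ 16 * (E : ℝ) * n * L * (4 * n) * (32 * (a : ℝ) ^ 3) := by gcongr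
          _ = (n : ℝ) ^ 2 * E * (L * (2 ^ 11 * (a : ℝ) ^ 3)) := by ring
          _ ≤ (n : ℝ) ^ 2 * E * 1 := by gcongr
          _ ≤ (n : ℝ) ^ 2 * E * E := by gcongr
          _ = (n * E : ℝ) ^ 2 := by ring
          _ ≤ (a * K : ℝ) ^ 2 := by gcongr
          _ = (K : ℝ) ^ 2 * a ^ 2 * 1 := by ring
          _ ≤ (K : ℝ) ^ 2 * a ^ 2 * a := by gcongr
          _ = _ := by ring
      have h6 : 16 * (E : ℝ) * n * L * (m * m : ℕ) * 32 ≤ (K : ℝ) ^ 2 := by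
        refine le_of_mul_le_mul_right ?_ (show (0 : ℝ) < (a : ℝ) ^ 3 by positivity)
        linarith
      have h7 : 0 ≤ 16 * (E : ℝ) * n * L * (m * m : ℕ) := by positivity
      linarith
    calc _ ≤ 16 * (E : ℝ) * (n * (K * (1 / (32 * a : ℕ) + L * (m * m : ℕ) / K))) := by
          gcongr
      _ = 16 * (E : ℝ) * (n * (K * (1 / (32 * a : ℕ)))) +
          16 * (E : ℝ) * (n * (K * (L * (m * m : ℕ) / K))) := by ring
      _ ≤ _ := by linarith

/-- A successful search finds a dense set. -/
theorem Precise.dense_of_found {a s : ℕ} (hp : Precise n K E a k m) (hn : 0 < n)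
    (hH : IsNonEdge n H) {μ : Mem} (h : Found n K E a k s m H μ) :
    ∃ D ⊆ range n, (∀ v < n, μ 3 v ≠ 0 ↔ v ∈ D) ∧ D.card = K ∧
      E * ∑ u ∈ D, ∑ v ∈ D, H u v ≤ K * (K - 1) := by
  obtain ⟨i, R, hrep, hsucc, hout⟩ := h
  have hE : 0 < E := by have := hp.two_le_E; omega
  have hsub := select_subset hn K (cand n k m s H i) (fun v => 8 * E * miss n H R v) (8 * a * n)
  refine ⟨_, fun v hv => mem_range.2 (hsub v hv).1, fun v hv => ?_, hsucc.1,
    dense_of_close hH hsub hE hsucc.1 (hrep.dist2_le hp.le hH (cand_le_one _ _ _ _ _ _)) hsucc.2⟩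
  rw [hout v hv]
  split_ifs with h <;> simp [h]

end Correctness

end ApproxClique

/-! ### The main program and its number of ticks. -/

namespace ApproxClique

open RAM Finset Mixing Torus

/-- Everything after the scalars `n`, `K`, `E` are known. -/
def mainProg : Prog := .seq scalarsProg (.seq tablesProg searchProg)

/-- An exponent that bounds the logarithms of all numbers that occur. -/
def logBound (n Z : ℕ) : ℕ := Nat.size n + 1000000 * Z

theorem le_pow_logBound {n Z x c : ℕ} (hx : x ≤ c * Z) (hc : c ≤ 1000000) :
    2 ^ x ≤ 2 ^ logBound n Z :=
  Nat.pow_le_pow_right (by norm_num) (by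
    have := Nat.mul_le_mul_right Z hc
    unfold logBound; omega)

/-- `X` bounds everything that does not depend on `n`. There are `q * D` walks with order `n` ticks
each, and at most `M` representatives with order n² ticks each, so that no term exceeds n² in its
dependence on `n`. -/
theorem time_le {n a k s q d D M X : ℕ} (hn : 1 ≤ n) (hX : 1 ≤ X) (hq : q ≤ 4 * n) (hd : d ≤ X)
    (hD : D ≤ X) (hM : M ≤ X) (hM' : M + 1 ≤ X) (hMd : (M + 1) * d ≤ X) (hk : k + 1 ≤ X)
    (hs : s + 2 ≤ X) (ha : 8 * a + 1 ≤ X) :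
    ((n + a) * 1000000 + 1000) + ((n * n * 200 + q * d * (k * 1000 + 1000) +
      n * d * (n * 100 + 200) + 200) +
      (q * D * ((s + 2) * (n * 100 + 100) + (M + 1) * (n * d * 200 + 400) + (8 * a + 1) * (n * 200)
        + 400) + 20 + (q * 100 + n * (n * 100 + 100) + 200) * M)) ≤ n ^ 2 * X ^ 3 * 10000000 := by
  set U := n ^ 2 * X ^ 3 with hU
  have hn2 : n ≤ n ^ 2 := Nat.le_self_pow (by norm_num) n
  have hX2 : X ^ 2 ≤ X ^ 3 := Nat.pow_le_pow_right hX (by norm_num)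
  have hX1 : X ≤ X ^ 2 := Nat.le_self_pow (by norm_num) X
  have u2 : n ^ 2 * X ^ 2 ≤ U := Nat.mul_le_mul_left _ hX2
  have u1 : n ^ 2 * X ≤ n ^ 2 * X ^ 2 := Nat.mul_le_mul_left _ hX1
  have u0 : n ^ 2 ≤ n ^ 2 * X := Nat.le_mul_of_pos_right _ hX
  have v2 : n * X ^ 2 ≤ n ^ 2 * X ^ 2 := Nat.mul_le_mul_right _ hn2
  have v1 : n * X ≤ n ^ 2 * X := Nat.mul_le_mul_right _ hn2
  have w1 : X ≤ n * X := Nat.le_mul_of_pos_left _ hn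
  have b1 : q * d * (k * 1000 + 1000) ≤ 4000 * (n * X ^ 2) :=
    calc q * d * (k * 1000 + 1000) = q * d * ((k + 1) * 1000) := by ring
      _ ≤ 4 * n * X * (X * 1000) := by gcongr
      _ = _ := by ring
  have b2 : n * d * (n * 100 + 200) ≤ 300 * (n ^ 2 * X) :=
    calc n * d * (n * 100 + 200) ≤ n * X * (n * 300) := by gcongr; omega
      _ = _ := by ring
  have b3 : (s + 2) * (n * 100 + 100) ≤ 200 * (n * X) :=
    calc (s + 2) * (n * 100 + 100) ≤ X * (n * 200) := by gcongr; omega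
      _ = _ := by ring
  have b4 : (M + 1) * (n * d * 200 + 400) ≤ 600 * (n * X) :=
    calc (M + 1) * (n * d * 200 + 400) = (M + 1) * d * n * 200 + (M + 1) * 400 := by ring
      _ ≤ X * n * 200 + X * 400 := by gcongr
      _ ≤ X * n * 200 + n * X * 400 := by gcongr
      _ = _ := by ring
  have b5 : (8 * a + 1) * (n * 200) ≤ 200 * (n * X) :=
    calc (8 * a + 1) * (n * 200) ≤ X * (n * 200) := by gcongr
      _ = _ := by ring
  have b6 : q * D * ((s + 2) * (n * 100 + 100) + (M + 1) * (n * d * 200 + 400) +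
      (8 * a + 1) * (n * 200) + 400) ≤ 5600 * (n ^ 2 * X ^ 2) :=
    calc _ ≤ 4 * n * X * (1400 * (n * X)) := by gcongr; omega
      _ = _ := by ring
  have b7 : (q * 100 + n * (n * 100 + 100) + 200) * M ≤ 800 * (n ^ 2 * X) :=
    calc _ ≤ (800 * n ^ 2) * X := by gcongr; nlinarith
      _ = _ := by ring
  have b8 : n * n = n ^ 2 := (pow_two n).symm
  have b9 : X ≤ U := by linarith
  have b10 : n ≤ U := by linarith
  calc _ ≤ (U + U) * 1000000 + 1000 * U + ((U * 200 + 4000 * U + 300 * U + 200 * U) +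
        (5600 * U + 20 * U + 800 * U)) := by
        gcongr ?_ * _ + ?_ + ((?_ * _ + ?_ + ?_ + ?_) + (?_ + ?_ + ?_)) <;> linarith
    _ = 2012120 * U := by ring
    _ ≤ U * 10000000 := by linarith

theorem mainProg_runs {n K E : ℕ} {ω : ℕ → Bool} {μ : Mem} {A : Finset ℕ} (hn : 0 < n)
    (hK : 0 < K) (hKn : K ≤ n) (hE : 2 ≤ E)
    (hsymm : ∀ u < n, ∀ v < n, μ 1 (u * n + v) = μ 1 (v * n + u))
    (hA : A ⊆ range n) (hAK : A.card = K) (hcl : ∀ u ∈ A, ∀ v ∈ A, nonEdge n (μ 1) u v = 0)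
    (h4 : μ 4 0 = n) (h5 : μ 5 0 = K) (h6 : μ 6 0 = E) (h0 : ∀ b, b = 2 ∨ 7 ≤ b → ∀ i, μ b i = 0) :
    Runs (logBound n ((n / K + 1) ^ 3 * E ^ 2)) ω mainProg μ fun t μ' =>
      t ≤ n ^ 2 * (2 ^ (1000000 * ((n / K + 1) ^ 3 * E ^ 2))) ^ 3 * 10000000 ∧ μ' 2 0 = 1 ∧
      ∃ D ⊆ range n, (∀ v < n, μ' 3 v ≠ 0 ↔ v ∈ D) ∧ D.card = K ∧
      E * ∑ u ∈ D, ∑ v ∈ D, nonEdge n (μ 1) u v ≤ K * (K - 1) := by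
  set P := n / K + 1 with hP
  set Z := P ^ 3 * E ^ 2 with hZ
  set l := logBound n Z with hl
  set a := P * E with ha
  have hP0 : 0 < P := Nat.succ_pos _
  have hE0 : 0 < E := by omega
  have ha0 : 0 < a := Nat.mul_pos hP0 hE0
  -- The codes of walks have length of order a² = P²E²; the exponent P³E² of the packing bound
  -- dominates it.
  have haa : a * a ≤ Z :=
    calc a * a = P ^ 2 * E ^ 2 := by rw [ha]; ring
      _ ≤ P ^ 3 * E ^ 2 := Nat.mul_le_mul_right _ (Nat.pow_le_pow_right hP0 (by norm_num))
  have haZ : a ≤ Z := (Nat.le_mul_self a).trans haa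
  have hZ0 : 0 < Z := ha0.trans_le haZ
  have hl0 : 0 < l := by rw [hl, logBound]; omega
  have hnl : n ≤ 2 ^ l := (Nat.lt_size_self n).le.trans
    (Nat.pow_le_pow_right (by norm_num) (by rw [hl, logBound]; omega))
  have two : ∀ x, x ≤ 2 ^ x := fun x => Nat.lt_two_pow_self.le
  have s_a : a ≤ 2 ^ l := (two a).trans (le_pow_logBound (c := 1) (by omega) (by norm_num))
  have s_k : 5376 * a ≤ 2 ^ l :=
    (two _).trans (le_pow_logBound (c := 5376) (Nat.mul_le_mul_left _ haZ) (by norm_num))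
  have s_s : 32 * a + 1 ≤ 2 ^ l :=
    (two _).trans (le_pow_logBound (c := 33) (by omega) (by norm_num))
  have e16 : ∀ x, 16 ^ x = 2 ^ (4 * x) := fun x => by rw [pow_mul]; norm_num
  have s_d : 16 ^ (5376 * a) ≤ 2 ^ l := by
    rw [e16]; exact le_pow_logBound (c := 21504) (by omega) (by norm_num)
  -- 709632 = 4 · 5376 · 33, from `a * a ≤ Z` and `a ≤ Z`.
  have hDx : 4 * (5376 * a) * (32 * a + 1) ≤ 709632 * Z := by nlinarith
  have s_D : (16 ^ (5376 * a)) ^ (32 * a + 1) ≤ 2 ^ l := by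
    rw [e16, ← pow_mul]; exact le_pow_logBound hDx (by norm_num)
  have s_E : E ≤ 2 ^ l := by
    have : E ≤ a := Nat.le_mul_of_pos_left _ hP0
    omega
  set M := 2 * 2 ^ (8192 * Z) with hM
  have hM2 : M + 1 ≤ 2 ^ (8194 * Z) := by
    have e1 : 2 ^ (8192 * Z + 2) ≤ 2 ^ (8194 * Z) :=
      Nat.pow_le_pow_right (by norm_num) (by omega)
    rw [pow_add] at e1
    have := Nat.two_pow_pos (8192 * Z)
    omega
  have s_M : M + 1 ≤ 2 ^ l := hM2.trans (le_pow_logBound (c := 8194) le_rfl (by norm_num))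
  have hnP : n < K * P := by
    rw [hP]; exact Nat.lt_mul_div_succ n hK
  have hH := isNonEdge_nonEdge hsymm
  set H := nonEdge n (μ 1) with hHdef
  set k := 5376 * a with hk
  set s := 32 * a + 1 with hs
  unfold mainProg
  refine Runs.seq ((scalarsProg_runs hl0 hn hnl s_a s_k s_s s_d s_D h4 h5 h6
    (h0 11 (by norm_num) 0)).mono ?_)
  rintro t₁ μ₁ - fr₁ ⟨ht₁, m, hm0, hmn, hnm, hm4, g₁⟩
  have : NeZero m := ⟨hm0.ne'⟩
  have hsz : Sizes l n K E a k s m := ⟨hl0, hnl, hKn.trans hnl, s_E, s_a, s_k, s_s, s_d, s_D,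
    hmn.trans hnl⟩
  have hprec : Precise n K E a k m := ⟨hK, hE, ha0, by
    calc n * E < K * P * E := Nat.mul_lt_mul_of_pos_right hnP hE0
      _ = a * K := by rw [ha]; ring, hnm, hm4, gap_pow_le⟩
  have fr₁' : ∀ b, b < 7 ∨ 14 ≤ b ∧ b < 40 → μ₁ b = μ b := fun b hb => fr₁ b (by
    simp [scalarsProg, Prog.writes, Prog.power, Prog.count]; omega)
  refine Runs.seq ((tablesProg_runs hsz g₁ hn hnm hH (fun u _ v _ => by
    rw [fr₁' 1 (by norm_num)]) (fun i => by rw [fr₁' 14 (by norm_num), h0 14 (by norm_num)])).mono ?_)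
  rintro t₂ μ₂ - fr₂ ⟨ht₂, g₂⟩
  have fr₂' : ∀ b, b < 14 ∨ 17 ≤ b ∧ b < 40 → μ₂ b = μ₁ b := fun b hb => fr₂ b (by
    simp [tablesProg, moveProg, Prog.ifEq, Prog.writes, Prog.table, Prog.sum, Prog.count]; omega)
  refine (searchProg_runs hsz (g₁.congr fun b _ _ => fr₂' b (by omega)) g₂ hn hnm hH s_M
    (fun R r => hprec.card_le hn hnP.le hH R r) (fun v => ?_) ?_ ?_).mono ?_
  · rw [fr₂' 23 (by norm_num), fr₁' 23 (by norm_num), h0 23 (by norm_num)]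
  · rw [fr₂' 30 (by norm_num), fr₁' 30 (by norm_num), h0 30 (by norm_num)]
  · rw [fr₂' 2 (by norm_num), fr₁' 2 (by norm_num), h0 2 (by norm_num)]
  rintro t₃ μ₃ - - ⟨ht₃, hres⟩
  have hres' : μ₃ 2 0 = 1 ∧ Found n K E a k s m H μ₃ := by
    rcases hres with ⟨-, h⟩ | h
    · obtain ⟨i, hi, hnot⟩ := hprec.exists_not_failsAt hn hH hA hAK hcl
      exact absurd (h i hi) hnot
    · exact h
  refine ⟨?_, hres'.1, hprec.dense_of_found hn hH hres'.2⟩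
  set X := 2 ^ (1000000 * Z) with hX
  have toX : ∀ {x c : ℕ}, x ≤ c * Z → c ≤ 1000000 → 2 ^ x ≤ X := fun {x c} hx hc =>
    Nat.pow_le_pow_right (by norm_num) (hx.trans (Nat.mul_le_mul_right Z hc))
  have X_a : 8 * a + 1 ≤ X := (two _).trans (toX (c := 9) (by omega) (by norm_num))
  have X_k : k + 1 ≤ X := (two _).trans (toX (c := 5377) (by omega) (by norm_num))
  have X_s : s + 2 ≤ X := (two _).trans (toX (c := 35) (by omega) (by norm_num))
  have X_d : 16 ^ k ≤ X := by
    rw [e16]; exact toX (c := 21504) (by omega) (by norm_num)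
  have X_dM : (M + 1) * 16 ^ k ≤ X := by
    rw [e16]
    refine (Nat.mul_le_mul_right _ hM2).trans ?_
    rw [← pow_add]; exact toX (c := 29698) (by omega) (by norm_num)
  have X_D : (16 ^ k) ^ s ≤ X := by
    rw [e16, ← pow_mul]; exact toX hDx (by norm_num)
  have X_1 : 1 ≤ X := Nat.one_le_two_pow
  have d_1 : 1 ≤ 16 ^ k := Nat.one_le_pow _ _ (by norm_num)
  have X_M : M + 1 ≤ X := (Nat.le_mul_of_pos_right _ d_1).trans X_dM
  change t₁ ≤ (n + a) * 1000000 + 1000 at ht₁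
  have := time_le hn X_1 hm4 X_d X_D ((Nat.le_succ M).trans X_M) X_M X_dM X_k X_s X_a
  omega

end ApproxClique

namespace ApproxClique

open RAM Finset Mixing Torus

/-! ### Input and output -/

theorem eq_natAbs_div {q : ℚ} (hq : 0 < q) : q = (q.num.natAbs : ℚ) / q.den := by
  have hnum : (q.num.natAbs : ℤ) = q.num := Int.natAbs_of_nonneg (Rat.num_nonneg.2 hq.le)
  conv_lhs => rw [← Rat.num_div_den q, ← hnum]
  rw [Int.cast_natCast]

theorem ceil_mul_eq {ρ : ℚ} (hρ : 0 < ρ) (n : ℕ) :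
    ⌈ρ * n⌉₊ = (ρ.num.natAbs * n + (ρ.den - 1)) / ρ.den := by
  have hq : 0 < ρ.den := ρ.den_pos
  have hq' : (0 : ℚ) < ρ.den := by exact_mod_cast hq
  refine eq_of_forall_ge_iff fun k => ?_
  rw [Nat.ceil_le, ← Nat.lt_add_one_iff (n := k), Nat.div_lt_iff_lt_mul hq]
  have : ρ * n ≤ k ↔ ρ.num.natAbs * n ≤ k * ρ.den := by
    conv_lhs => rw [eq_natAbs_div hρ, div_mul_eq_mul_div, div_le_iff₀ hq']
    exact_mod_cast Iff.rfl
  rw [this, add_mul, one_mul]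
  omega

/-- The program works with this integer in place of 1/ε: a fraction 1/E of non-edges is less than ε.
-/
theorem inv_lt_of_den_div {ε : ℚ} (hε : 0 < ε) : 1 / ε < (ε.den / ε.num.natAbs + 1 : ℕ) := by
  have hp : 0 < ε.num.natAbs := Int.natAbs_pos.2 (Rat.num_pos.2 hε).ne'
  have hp' : (0 : ℚ) < ε.num.natAbs := by exact_mod_cast hp
  conv_lhs => rw [eq_natAbs_div hε]
  rw [one_div_div, div_lt_iff₀ hp', mul_comm]
  exact_mod_cast Nat.lt_mul_div_succ ε.den hp

theorem den_div_le {ε : ℚ} (hε : 0 < ε) : ((ε.den / ε.num.natAbs : ℕ) : ℚ) ≤ 1 / ε := by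
  conv_rhs => rw [eq_natAbs_div hε]
  rw [one_div_div]
  exact Nat.cast_div_le

theorem two_le_den_div {ε : ℚ} (hε : 0 < ε) (hε1 : ε < 1) : 2 ≤ ε.den / ε.num.natAbs + 1 := by
  have h := inv_lt_of_den_div hε
  have h1 : 1 < 1 / ε := by rw [lt_div_iff₀ hε]; linarith
  have : (1 : ℚ) < (ε.den / ε.num.natAbs + 1 : ℕ) := h1.trans h
  have : 1 < ε.den / ε.num.natAbs + 1 := by exact_mod_cast this
  omega

section

variable {n : ℕ} (G : SimpleGraph (Fin n)) (ρ ε : ℚ)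

theorem initial_adj [DecidableRel G.Adj] (u v : Fin n) :
    (initial G ρ ε).mem 1 (u * n + v) = if G.Adj u v then 1 else 0 := by
  have hn : 0 < n := u.pos
  have key : (∃ u' v' : Fin n, G.Adj u' v' ∧ (u : ℕ) * n + v = u' * n + v') ↔ G.Adj u v := by
    refine ⟨?_, fun h => ⟨u, v, h, rfl⟩⟩
    rintro ⟨u', v', h, e⟩
    have e1 := congrArg (· / n) e
    have e2 := congrArg (· % n) e
    simp only [mul_comm _ n, Nat.mul_add_div hn, Nat.div_eq_of_lt v.2, Nat.div_eq_of_lt v'.2,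
      Nat.mul_add_mod, Nat.mod_eq_of_lt v.2, Nat.mod_eq_of_lt v'.2, add_zero] at e1 e2
    rwa [Fin.ext e1, Fin.ext e2]
  unfold initial
  simp only [one_ne_zero, if_false, if_true, key]

theorem nonEdge_initial [DecidableRel G.Adj] (u v : Fin n) :
    nonEdge n ((initial G ρ ε).mem 1) u v = if u ≠ v ∧ ¬ G.Adj u v then 1 else 0 := by
  rw [nonEdge, initial_adj]
  by_cases h : u = v
  · simp [h]
  · have : (u : ℕ) ≠ v := fun e => h (Fin.ext e)
    rw [if_pos ⟨u.2, v.2, this⟩]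
    by_cases h' : G.Adj u v <;> simp [h, h']

/-- The handshake lemma for the graph formed by the edges inside `D`. -/
theorem two_mul_edgesIn [DecidableRel G.Adj] (D : Finset (Fin n)) :
    2 * edgesIn G D = ∑ u ∈ D, ∑ v ∈ D, if G.Adj u v then 1 else 0 := by
  classical
  let G' : SimpleGraph (Fin n) :=
    { Adj := fun u v => G.Adj u v ∧ u ∈ D ∧ v ∈ D
      symm := ⟨fun u v h => ⟨h.1.symm, h.2.2, h.2.1⟩⟩
      loopless := ⟨fun u h => G.loopless.irrefl u h.1⟩ }
  have h1 : edgesIn G D = G'.edgeFinset.card := by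
    rw [edgesIn, ← Set.ncard_coe_finset]
    congr 1
    ext e
    induction e with
    | _ u v =>
      simp [G', SimpleGraph.mem_edgeSet]
  rw [h1, ← G'.sum_degrees_eq_twice_card_edges]
  have h2 : ∀ u, G'.degree u = if u ∈ D then ∑ v ∈ D, if G.Adj u v then 1 else 0 else 0 := by
    intro u
    rw [← SimpleGraph.card_neighborFinset_eq_degree]
    split_ifs with h
    · rw [← Finset.card_filter]
      congr 1
      ext v
      simp [G', h, and_comm]
    · rw [Finset.card_eq_zero]
      ext v
      simp [G', h]
  simp_rw [h2]
  rw [Finset.sum_ite_mem, Finset.univ_inter]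

/-- A set with few non-edges is an approximate clique. -/
theorem isApproxClique_of_sum_le [DecidableRel G.Adj] {D : Finset (Fin n)} {E : ℕ} (hε : 0 < ε)
    (hE : 1 / ε < E) (hD : D.card = ⌈ρ * n⌉₊)
    (h : E * ∑ u ∈ D, ∑ v ∈ D, (if u ≠ v ∧ ¬ G.Adj u v then 1 else 0) ≤ D.card * (D.card - 1)) :
    IsApproxClique G ρ ε D := by
  refine ⟨hD, ?_⟩
  have h1 := two_mul_edgesIn G D
  -- Every ordered pair of distinct elements of `D` is either an edge or a non-edge.
  have h2 : (∑ u ∈ D, ∑ v ∈ D, if G.Adj u v then 1 else 0) +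
      ∑ u ∈ D, ∑ v ∈ D, (if u ≠ v ∧ ¬ G.Adj u v then 1 else 0) = D.card * (D.card - 1) := by
    rw [← Finset.sum_add_distrib]
    have : ∀ u ∈ D, ((∑ v ∈ D, if G.Adj u v then 1 else 0) +
        ∑ v ∈ D, if u ≠ v ∧ ¬ G.Adj u v then 1 else 0) = D.card - 1 := by
      intro u hu
      rw [← Finset.sum_add_distrib, ← Finset.card_erase_of_mem hu, Finset.card_eq_sum_ones,
        ← Finset.add_sum_erase D _ hu]
      have h0 : ((if G.Adj u u then 1 else 0) + if u ≠ u ∧ ¬ G.Adj u u then 1 else 0) = 0 := by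
        simp
      rw [h0, zero_add]
      refine Finset.sum_congr rfl fun v hv => ?_
      have hne : u ≠ v := (Finset.ne_of_mem_erase hv).symm
      by_cases h' : G.Adj u v <;> simp [h', hne]
    rw [Finset.sum_congr rfl this, Finset.sum_const, smul_eq_mul]
  set X := ∑ u ∈ D, ∑ v ∈ D, (if u ≠ v ∧ ¬ G.Adj u v then 1 else 0) with hX
  rw [← h1] at h2
  have h3 : (2 * edgesIn G D + X : ℚ) = 2 * (D.card.choose 2 : ℚ) := by
    have := Nat.choose_two_right D.card
    have h4 : D.card * (D.card - 1) = 2 * D.card.choose 2 := by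
      rw [this]; exact (Nat.mul_div_cancel' (Nat.even_mul_pred_self _).two_dvd).symm
    rw [h4] at h2
    exact_mod_cast h2
  have h5 : (E : ℚ) * X ≤ 2 * (D.card.choose 2 : ℚ) := by
    rw [← h3]
    have : E * X ≤ 2 * edgesIn G D + X := by rw [h2]; exact h
    exact_mod_cast this
  have hX0 : (0 : ℚ) ≤ X := by positivity
  have h6 : (X : ℚ) ≤ ε * (2 * (D.card.choose 2 : ℚ)) := by
    calc (X : ℚ) = ε * (1 / ε * X) := by field_simp
      _ ≤ ε * (E * X) := by gcongr
      _ ≤ _ := by gcongr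
  linarith

end

end ApproxClique

/-! ### Reading the fractions, and the total running time. -/

namespace ApproxClique

open RAM Finset Mixing Torus

theorem len_le_of_le {x b : ℕ} (h : x ≤ 2 ^ b) : len x ≤ b + 2 := by
  have : x < 2 ^ (b + 1) := h.trans_lt (Nat.pow_lt_pow_right (by norm_num) (Nat.lt_succ_self b))
  have := Nat.size_le.2 this
  unfold len
  omega

open Expr Prog in
/-- Computes `n`, `K`, `E` from the input. -/
def inputProg : Prog :=
  .seq (.set 4 0 (var 0)) <|
  .seq (.set 5 0 ((get 0 1 * var 0 + (get 0 2 - 1)) / get 0 2)) <|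
  .set 6 0 (get 0 4 / get 0 3 + 1)

/-- The numerators and denominators may be far longer than the tick allows, so the three assignments
that handle them are charged directly; this is the source of the summand linear in their lengths. -/
theorem inputProg_exec (ω : ℕ → Bool) (μ : Mem) (pos : ℕ) {n p q p' q' β : ℕ} (h0 : μ 0 0 = n)
    (h1 : μ 0 1 = p) (h2 : μ 0 2 = q) (h3 : μ 0 3 = p') (h4 : μ 0 4 = q')
    (hβ : Nat.size n + (Nat.size p + Nat.size q) + (Nat.size p' + Nat.size q') ≤ β) :
    ∃ T, Exec ω inputProg ⟨μ, pos⟩ T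
      ⟨((μ.write 4 0 n).write 5 0 ((p * n + (q - 1)) / q)).write 6 0 (q' / p' + 1), pos⟩ ∧
      T ≤ 100 * (β + 10) := by
  have w1 : (Expr.val μ (Expr.var 0)) = n := h0
  have w2 : Expr.val (μ.write 4 0 n) ((Expr.get 0 1 * .var 0 + (Expr.get 0 2 - 1)) / Expr.get 0 2)
      = (p * n + (q - 1)) / q := by
    simp only [Expr.val_add, Expr.val_mul, Expr.val_get, Expr.val_lit, Expr.val_sub,
        Expr.val_ofNat, Expr.val_div]
    rw [Mem.write_of_ne _ (by norm_num), h0, h1, h2]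
  have w3 : Expr.val ((μ.write 4 0 n).write 5 0 ((p * n + (q - 1)) / q))
      (Expr.get 0 4 / Expr.get 0 3 + 1) = q' / p' + 1 := by
    simp only [Expr.val_add, Expr.val_get, Expr.val_ofNat, Expr.val_div]
    rw [Mem.write_of_ne _ (by norm_num), Mem.write_of_ne _ (by norm_num), h3, h4]
  have step1 := Exec.set (ω := ω) 4 0 (.var 0) ⟨μ, pos⟩
  have step2 := Exec.set (ω := ω) 5 0 ((Expr.get 0 1 * .var 0 + (Expr.get 0 2 - 1)) / Expr.get 0 2)
    ⟨μ.write 4 0 n, pos⟩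
  have step3 := Exec.set (ω := ω) 6 0 (Expr.get 0 4 / Expr.get 0 3 + 1)
    ⟨(μ.write 4 0 n).write 5 0 ((p * n + (q - 1)) / q), pos⟩
  simp only [w1, w2, w3] at step1 step2 step3
  refine ⟨_, .seq step1 (.seq step2 step3), ?_⟩
  have pw : ∀ x, Nat.size x ≤ β → x ≤ 2 ^ β := fun x hx =>
    (Nat.lt_size_self x).le.trans (Nat.pow_le_pow_right (by norm_num) hx)
  have hb : 2 ^ β ≤ 2 ^ (β + 2) := Nat.pow_le_pow_right (by norm_num) (by omega)
  have hb2 : 2 ^ (β + 2) = 4 * 2 ^ β := by rw [pow_add]; ring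
  have hb0 : 1 ≤ 2 ^ β := Nat.one_le_two_pow
  have n0 := pw n (by omega)
  have n1 := pw p (by omega)
  have n2 := pw q (by omega)
  have n3 := pw p' (by omega)
  have n4 := pw q' (by omega)
  have n5 : p * n ≤ 2 ^ β := by
    calc p * n ≤ 2 ^ Nat.size p * 2 ^ Nat.size n :=
          Nat.mul_le_mul (Nat.lt_size_self p).le (Nat.lt_size_self n).le
      _ ≤ 2 ^ β := by rw [← pow_add]; exact Nat.pow_le_pow_right (by norm_num) (by omega)
  have L : ∀ x, x ≤ 2 ^ (β + 2) → len x ≤ β + 4 := fun x hx => len_le_of_le hx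
  have l0 := L n (by omega)
  have l1 := L p (by omega)
  have l2 := L q (by omega)
  have l3 := L p' (by omega)
  have l4 := L q' (by omega)
  have l5 := L (p * n) (by omega)
  have l6 := L (q - 1) (by omega)
  have l7 := L (p * n + (q - 1)) (by omega)
  have l8 := L ((p * n + (q - 1)) / q) ((Nat.div_le_self _ _).trans (by omega))
  have l9 := L (q' / p') ((Nat.div_le_self _ _).trans (by omega))
  have l10 := L (q' / p' + 1) ((Nat.succ_le_succ (Nat.div_le_self _ _)).trans (by omega))
  have c0 : len 0 ≤ β + 4 := L 0 (by omega)
  have c1 : len 1 ≤ β + 4 := L 1 (by omega)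
  have c2 : len 2 ≤ β + 4 := L 2 (by omega)
  have c3 : len 3 ≤ β + 4 := L 3 (by omega)
  have c4 : len 4 ≤ β + 4 := L 4 (by omega)
  have cost_bin : ∀ (m : Mem) (e f : Expr), (e + f).cost m = e.cost m + f.cost m + len (e.val m) +
      len (f.val m) ∧ (e - f).cost m = e.cost m + f.cost m + len (e.val m) + len (f.val m) ∧
      (e * f).cost m = e.cost m + f.cost m + len (e.val m) + len (f.val m) ∧
      (e / f).cost m = e.cost m + f.cost m + len (e.val m) + len (f.val m) :=
    fun m e f => ⟨rfl, rfl, rfl, rfl⟩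
  have cost_get : ∀ (m : Mem) (a : ℕ) (e : Expr), (Expr.get a e).cost m =
      e.cost m + len (e.val m) + len (m a (e.val m)) := fun _ _ _ => rfl
  have cost_lit : ∀ (m : Mem) (c : ℕ), (Expr.lit c).cost m = len c := fun _ _ => rfl
  have k0 : ∀ m : Mem, (0 : Expr).cost m = len 0 := fun _ => rfl
  have k1 : ∀ m : Mem, (1 : Expr).cost m = len 1 := fun _ => rfl
  have k2 : ∀ m : Mem, (2 : Expr).cost m = len 2 := fun _ => rfl
  have k3 : ∀ m : Mem, (3 : Expr).cost m = len 3 := fun _ => rfl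
  have k4 : ∀ m : Mem, (4 : Expr).cost m = len 4 := fun _ => rfl
  have f1 : μ.write 4 0 n 0 = μ 0 := Mem.write_of_ne _ (by norm_num) _ _
  have f2 : (μ.write 4 0 n).write 5 0 ((p * n + (q - 1)) / q) 0 = μ 0 := by
    rw [Mem.write_of_ne _ (by norm_num), f1]
  simp only [cost_bin, cost_get, cost_lit, k0, k1, k2, k3, k4, Expr.val_add, Expr.val_mul,
    Expr.val_get, Expr.val_lit, Expr.val_sub, Expr.val_ofNat, Expr.val_div, f1, f2, h0, h1, h2, h3,
    h4]
  omega

/-- The whole program. -/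
def cliqueProg : Prog := .ite (.var 0) (.seq inputProg mainProg) (.set 2 0 1)

theorem one_le_logb (n : ℕ) : (1 : ℝ) ≤ Real.logb 2 ((n : ℝ) + 2) := by
  rw [Real.le_logb_iff_rpow_le (by norm_num) (by positivity), Real.rpow_one]
  linarith [(Nat.cast_nonneg n : (0 : ℝ) ≤ n)]

theorem size_le_logb (n : ℕ) : (Nat.size n : ℝ) ≤ 2 * Real.logb 2 ((n : ℝ) + 2) := by
  have h1 := one_le_logb n
  rcases Nat.eq_zero_or_pos (Nat.size n) with h | h
  · rw [h]; push_cast; linarith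
  · have h2 : 2 ^ (Nat.size n - 1) ≤ n := Nat.lt_size.1 (by omega)
    have h3 : ((Nat.size n - 1 : ℕ) : ℝ) ≤ Real.logb 2 ((n : ℝ) + 2) := by
      rw [Real.le_logb_iff_rpow_le (by norm_num) (by positivity), Real.rpow_natCast]
      have : ((2 ^ (Nat.size n - 1) : ℕ) : ℝ) ≤ n := by exact_mod_cast h2
      push_cast at this
      linarith
    rw [Nat.cast_sub h] at h3
    push_cast at h3
    linarith

/-- Put x = 2^(1000000Z). The number of ticks brings in x³, and a tick is at most a multiple of x
log₂(n + 2), so one logarithm and x⁴ appear. As Z ≤ 32/(ρ³ε²), the exponent of x⁴ is at most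
128000000/(ρ³ε²), well within what `C` allows. -/
theorem time_le_timeBound {n P E b T₁ T₂ t C : ℕ} {ρ ε : ℚ} (hC : 10 ^ 13 ≤ C) (hn : 0 < n)
    (hρ : 0 < ρ) (hε : 0 < ε) (hP : (P : ℚ) ≤ 2 / ρ) (hE : (E : ℚ) ≤ 2 / ε)
    (hb : ratBits ρ + ratBits ε = b) (hT₁ : T₁ ≤ 100 * (Nat.size n + b + 10))
    (ht : t ≤ n ^ 2 * (2 ^ (1000000 * (P ^ 3 * E ^ 2))) ^ 3 * 10000000)
    (hT₂ : T₂ ≤ t * tick (logBound n (P ^ 3 * E ^ 2))) :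
    (T₁ + T₂ + 100 * (Nat.size n + 1) : ℕ) ≤ (C : ℝ) * ((n : ℝ) ^ 2 *
      (2 : ℝ) ^ ((C : ℝ) / ((ρ : ℝ) ^ 3 * (ε : ℝ) ^ 2)) * Real.logb 2 ((n : ℝ) + 2) ^ C
        + (ratBits ρ + ratBits ε : ℕ)) := by
  have hρ' : (0 : ℝ) < ρ := by exact_mod_cast hρ
  have hε' : (0 : ℝ) < ε := by exact_mod_cast hε
  have hn' : (1 : ℝ) ≤ n := by exact_mod_cast hn
  have hC' : (10 : ℝ) ^ 13 ≤ C := by exact_mod_cast hC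
  have hP' : (P : ℝ) ≤ 2 / ρ := by exact_mod_cast hP
  have hE' : (E : ℝ) ≤ 2 / ε := by exact_mod_cast hE
  set Z := P ^ 3 * E ^ 2 with hZ
  set Λ := Real.logb 2 ((n : ℝ) + 2) with hΛ
  have hΛ1 : 1 ≤ Λ := one_le_logb n
  have hsize : (Nat.size n : ℝ) ≤ 2 * Λ := size_le_logb n
  have hZr : (Z : ℝ) ≤ 32 / ((ρ : ℝ) ^ 3 * (ε : ℝ) ^ 2) := by
    rw [hZ]
    push_cast
    calc (P : ℝ) ^ 3 * (E : ℝ) ^ 2 ≤ (2 / ρ) ^ 3 * (2 / ε) ^ 2 := by gcongr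
      _ = _ := by field_simp; norm_num
  set x : ℝ := 2 ^ (1000000 * Z) with hx
  have hx1 : 1 ≤ x := one_le_pow₀ (by norm_num)
  have hZx : (1000000 * Z : ℝ) ≤ x := by
    have : ((1000000 * Z : ℕ) : ℝ) ≤ ((2 ^ (1000000 * Z) : ℕ) : ℝ) := by
      exact_mod_cast Nat.lt_two_pow_self.le
    rw [hx]
    push_cast at this
    exact this
  set B : ℝ := (2 : ℝ) ^ ((C : ℝ) / ((ρ : ℝ) ^ 3 * (ε : ℝ) ^ 2)) with hB
  have hxB : x ^ 4 ≤ B := by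
    rw [hx, ← pow_mul, hB, ← Real.rpow_natCast]
    refine Real.rpow_le_rpow_of_exponent_le (by norm_num) ?_
    have : (128000000 : ℝ) ≤ C := le_trans (by norm_num) hC'
    push_cast
    calc (1000000 * Z * 4 : ℝ) = 4000000 * Z := by ring
      _ ≤ 4000000 * (32 / ((ρ : ℝ) ^ 3 * (ε : ℝ) ^ 2)) := by gcongr
      _ = 128000000 / ((ρ : ℝ) ^ 3 * (ε : ℝ) ^ 2) := by ring
      _ ≤ _ := by gcongr
  have hΛC : Λ ≤ Λ ^ C := le_self_pow₀ hΛ1 (by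
    rintro rfl
    norm_num at hC)
  clear_value B Λ x
  have hB0 : 0 ≤ B := (by positivity : (0 : ℝ) ≤ x ^ 4).trans hxB
  have e1 : (t : ℝ) ≤ (n : ℝ) ^ 2 * x ^ 3 * 10000000 := by
    have : (t : ℝ) ≤ ((n ^ 2 * (2 ^ (1000000 * Z)) ^ 3 * 10000000 : ℕ) : ℝ) := by exact_mod_cast ht
    rw [hx]
    push_cast at this
    exact this
  have e2 : (tick (logBound n Z) : ℝ) ≤ 40000 * (Λ * x) := by
    unfold tick logBound
    push_cast
    have : Λ ≤ Λ * x := le_mul_of_one_le_right (by linarith) hx1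
    have : x ≤ Λ * x := le_mul_of_one_le_left (by linarith) hΛ1
    linarith
  have e3 : (T₂ : ℝ) ≤ 400000000000 * ((n : ℝ) ^ 2 * B * Λ) := by
    calc (T₂ : ℝ) ≤ t * tick (logBound n Z) := by exact_mod_cast hT₂
      _ ≤ ((n : ℝ) ^ 2 * x ^ 3 * 10000000) * (40000 * (Λ * x)) := by gcongr
      _ = 400000000000 * ((n : ℝ) ^ 2 * x ^ 4 * Λ) := by ring
      _ ≤ _ := by gcongr
  have e4 : Λ ≤ (n : ℝ) ^ 2 * B * Λ := by
    have h1 : 1 ≤ x ^ 4 := one_le_pow₀ hx1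
    have h2 : 1 ≤ (n : ℝ) ^ 2 := one_le_pow₀ hn'
    have h3 : 1 ≤ (n : ℝ) ^ 2 * B := one_le_mul_of_one_le_of_one_le h2 (h1.trans hxB)
    exact le_mul_of_one_le_left (by linarith) h3
  have e5 : (T₁ : ℝ) ≤ 100 * (Nat.size n + b + 10) := by exact_mod_cast hT₁
  have e6 : (n : ℝ) ^ 2 * B * Λ ≤ (n : ℝ) ^ 2 * B * Λ ^ C := by gcongr
  have hb0 : (0 : ℝ) ≤ b := Nat.cast_nonneg b
  rw [hb]
  push_cast
  have e7 : 0 ≤ (n : ℝ) ^ 2 * B * Λ ^ C + b := by positivity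
  calc (T₁ : ℝ) + T₂ + 100 * (Nat.size n + 1)
      ≤ (10 : ℝ) ^ 13 * ((n : ℝ) ^ 2 * B * Λ ^ C + b) := by linarith
    _ ≤ _ := by gcongr

end ApproxClique

/-! ### Correctness of the whole program on graphs. -/

namespace ApproxClique

open RAM Finset Mixing Torus

/-- Without vertices the main summand of the time bound is 0, and the time is paid for by the bits
of the fractions, of which the denominator of `ρ` supplies at least one. The empty output is
correct. -/
theorem exec_zero (ω : ℕ → Bool) (G : SimpleGraph (Fin 0)) (ρ ε : ℚ) {C : ℕ}
    (hC : 10 ^ 13 ≤ C) :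
    ∃ t s, Exec ω cliqueProg (initial G ρ ε) t s ∧ t ≤ timeBound C 0 ρ ε ∧ Correct G ρ ε s := by
  have h0 : (Expr.var 0).val (initial G ρ ε).mem = 0 := rfl
  refine ⟨_, _, .ite_false _ h0 (.set _ _ _ _), ?_, ?_, ?_, ?_⟩
  · refine Nat.le_floor ?_
    have hb : 1 ≤ ratBits ρ := by
      have : 0 < Nat.size ρ.den := Nat.size_pos.2 ρ.den_pos
      unfold ratBits; omega
    have hcost : (Expr.var 0).cost (initial G ρ ε).mem + len ((Expr.var 0).val (initial G ρ ε).mem)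
        + ((0 : Expr).cost (initial G ρ ε).mem + (1 : Expr).cost (initial G ρ ε).mem +
          len ((0 : Expr).val (initial G ρ ε).mem) + len ((1 : Expr).val (initial G ρ ε).mem))
        ≤ 1000 := by
      have l0 : len 0 ≤ 2 := len_le_of_le (b := 0) (by norm_num)
      have l1 : len 1 ≤ 2 := len_le_of_le (b := 0) (by norm_num)
      change len 0 + len 0 + len 0 + len 0 + (len 0 + len 1 + len 0 + len 1) ≤ 1000
      omega
    refine (Nat.cast_le.2 hcost).trans ?_
    have hC' : (1000 : ℝ) ≤ C := le_trans (by norm_num) (Nat.cast_le (α := ℝ).2 hC)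
    have hb' : (1 : ℝ) ≤ (ratBits ρ + ratBits ε : ℕ) := by
      exact_mod_cast (by omega : 1 ≤ ratBits ρ + ratBits ε)
    have h1 : (0 : ℝ) ≤ ((0 : ℕ) : ℝ) ^ 2 * (2 : ℝ) ^ ((C : ℝ) / ((ρ : ℝ) ^ 3 * (ε : ℝ) ^ 2))
        * Real.logb 2 (((0 : ℕ) : ℝ) + 2) ^ C := by
      simp
    calc ((1000 : ℕ) : ℝ) ≤ (C : ℝ) * 1 := by push_cast; linarith
      _ ≤ _ := by gcongr; linarith
  · change Mem.write (initial G ρ ε).mem 2 0 1 2 0 ≠ 0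
    rw [Mem.write_same]; norm_num
  · have : output 0 ⟨(initial G ρ ε).mem.write 2 ((0 : Expr).val (initial G ρ ε).mem)
      ((1 : Expr).val (initial G ρ ε).mem), (initial G ρ ε).pos⟩ = ∅ :=
      Finset.eq_empty_of_isEmpty _
    rw [this]; simp
  · have : output 0 ⟨(initial G ρ ε).mem.write 2 ((0 : Expr).val (initial G ρ ε).mem)
      ((1 : Expr).val (initial G ρ ε).mem), (initial G ρ ε).pos⟩ = ∅ :=
      Finset.eq_empty_of_isEmpty _
    rw [this]; simp

theorem exec_pos (ω : ℕ → Bool) {n : ℕ} (hn : 0 < n) (G : SimpleGraph (Fin n)) {ρ ε : ℚ} {C : ℕ}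
    (hC : 10 ^ 13 ≤ C) (hρ : 0 < ρ) (hρ1 : ρ < 1) (hε : 0 < ε) (hε1 : ε < 1)
    (hG : HasClique G ρ) :
    ∃ t s, Exec ω cliqueProg (initial G ρ ε) t s ∧ t ≤ timeBound C n ρ ε ∧ Correct G ρ ε s := by
  classical
  have hn' : (0 : ℚ) < n := by exact_mod_cast hn
  set K := ⌈ρ * n⌉₊ with hK
  set E := ε.den / ε.num.natAbs + 1 with hE
  have hK0 : 0 < K := Nat.ceil_pos.2 (by positivity)
  have hKn : K ≤ n := Nat.ceil_le.2 (by nlinarith)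
  have hKρ : ρ * n ≤ K := Nat.le_ceil _
  have hE2 : 2 ≤ E := two_le_den_div hε hε1
  set μ₀ := (initial G ρ ε).mem with hμ₀
  obtain ⟨T₁, hx₁, hT₁⟩ := inputProg_exec ω μ₀ 0 (n := n) (p := ρ.num.natAbs) (q := ρ.den)
    (p' := ε.num.natAbs) (q' := ε.den) (β := Nat.size n + (ratBits ρ + ratBits ε)) rfl rfl rfl rfl
    rfl (by unfold ratBits; omega)
  rw [← ceil_mul_eq hρ n, ← hK, ← hE] at hx₁
  set μ := ((μ₀.write 4 0 n).write 5 0 K).write 6 0 E with hμ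
  have fr : ∀ b, b ≠ 4 → b ≠ 5 → b ≠ 6 → μ b = μ₀ b := fun b h1 h2 h3 => by
    rw [hμ, Mem.write_of_ne _ h3, Mem.write_of_ne _ h2, Mem.write_of_ne _ h1]
  have hμ1 : μ 1 = μ₀ 1 := fr 1 (by norm_num) (by norm_num) (by norm_num)
  have hzero : ∀ b, 2 ≤ b → ∀ i, μ₀ b i = 0 := fun b hb i => by
    rw [hμ₀]
    simp only [initial]
    rw [if_neg (by omega), if_neg (by omega)]
  have hsymm : ∀ u < n, ∀ v < n, μ 1 (u * n + v) = μ 1 (v * n + u) := by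
    intro u hu v hv
    have h1 := initial_adj G ρ ε ⟨u, hu⟩ ⟨v, hv⟩
    have h2 := initial_adj G ρ ε ⟨v, hv⟩ ⟨u, hu⟩
    rw [hμ1, hμ₀]
    simp only [G.adj_comm ⟨v, hv⟩ ⟨u, hu⟩] at h2
    exact h1.trans h2.symm
  obtain ⟨A₀, hA₀, hA₀K⟩ := hG
  have hcard : K ≤ A₀.card := Nat.ceil_le.2 (by exact_mod_cast hA₀K)
  -- The clique is trimmed to exactly `K` vertices, as the analysis of the search requires.
  obtain ⟨A₁, hA₁, hA₁K⟩ := Finset.exists_subset_card_eq hcard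
  have hrun := mainProg_runs (ω := ω) (μ := μ) (A := A₁.map Fin.valEmbedding) hn hK0 hKn hE2 hsymm
    (fun v hv => by
      obtain ⟨w, -, rfl⟩ := Finset.mem_map.1 hv
      exact mem_range.2 w.2) (by rw [Finset.card_map, hA₁K])
    (by
      intro u hu v hv
      obtain ⟨u, hu', rfl⟩ := Finset.mem_map.1 hu
      obtain ⟨v, hv', rfl⟩ := Finset.mem_map.1 hv
      rw [hμ1]
      change nonEdge n ((initial G ρ ε).mem 1) u v = 0
      rw [nonEdge_initial, if_neg]
      rintro ⟨h1, h2⟩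
      exact h2 (hA₀ (hA₁ hu') (hA₁ hv') h1))
    (by rw [hμ, Mem.write_of_ne _ (by norm_num), Mem.write_of_ne _ (by norm_num), Mem.write_same])
    (by rw [hμ, Mem.write_of_ne _ (by norm_num), Mem.write_same])
    (by rw [hμ, Mem.write_same])
    (fun b hb i => by rw [fr b (by omega) (by omega) (by omega), hzero b (by omega)])
  have hle_l : ∀ x, x ≤ n → x ≤ 2 ^ (20 * logBound n ((n / K + 1) ^ 3 * E ^ 2)) := fun x hx =>
    hx.trans ((Nat.lt_size_self n).le.trans (Nat.pow_le_pow_right (by norm_num) (by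
      unfold logBound; omega)))
  have hEl : E ≤ 2 ^ (20 * logBound n ((n / K + 1) ^ 3 * E ^ 2)) := by
    have h1 : E ≤ (n / K + 1) ^ 3 * E ^ 2 :=
      calc E ≤ E ^ 2 := Nat.le_self_pow (by norm_num) E
        _ ≤ _ := Nat.le_mul_of_pos_left _ (by positivity)
    exact Nat.lt_two_pow_self.le.trans (Nat.pow_le_pow_right (by norm_num) (by
      unfold logBound; omega))
  -- Once `n`, `K` and `E` have been extracted, the long numbers remain only in bank 0, which `Bdd`
  -- exempts.
  have hB : Bdd (logBound n ((n / K + 1) ^ 3 * E ^ 2)) μ := by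
    refine Bdd.write (Bdd.write (Bdd.write ?_ (hle_l n le_rfl) _ _) (hle_l K hKn) _ _) hEl _ _
    intro b hb i
    rcases Nat.lt_or_ge b 2 with h | h
    · obtain rfl : b = 1 := by omega
      refine le_trans ?_ Nat.one_le_two_pow
      rw [hμ₀]
      simp only [initial, one_ne_zero, if_false, if_true]
      split_ifs <;> norm_num
    · rw [hzero b h]; exact Nat.zero_le _
  obtain ⟨t, T₂, μ', hx₂, hT₂, -, -, ht, hfound, D, hD, hout, hDK, hdense⟩ := hrun hB 0
  have hc : (Expr.var 0).val μ₀ ≠ 0 := hn.ne'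
  refine ⟨_, ⟨μ', 0⟩, .ite_true (s := ⟨μ₀, 0⟩) _ hc (.seq hx₁ hx₂), ?_, ?_, ?_⟩
  · refine Nat.le_floor ?_
    have hPle : ((n / K + 1 : ℕ) : ℚ) ≤ 2 / ρ := by
      have h1 : ((n / K : ℕ) : ℚ) ≤ 1 / ρ := by
        refine Nat.cast_div_le.trans ?_
        rw [div_le_div_iff₀ (by exact_mod_cast hK0) hρ]
        linarith
      have h2 : 1 ≤ 1 / ρ := by rw [le_div_iff₀ hρ]; linarith
      have h3 : 2 / ρ = 1 / ρ + 1 / ρ := by ring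
      push_cast at h1 ⊢
      linarith
    have hEle : (E : ℚ) ≤ 2 / ε := by
      have h1 := den_div_le hε
      have h2 : 1 ≤ 1 / ε := by rw [le_div_iff₀ hε]; linarith
      have h3 : 2 / ε = 1 / ε + 1 / ε := by ring
      rw [hE]
      push_cast at h1 ⊢
      linarith
    have htime := time_le_timeBound (C := C) hC hn hρ hε hPle hEle rfl hT₁ ht hT₂
    refine le_trans (Nat.cast_le.2 ?_) htime
    have l0 : len 0 ≤ 2 := len_le_of_le (b := 0) (by norm_num)
    change len 0 + len 0 + len n + len n + (T₁ + T₂) ≤ _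
    unfold len at l0 ⊢
    omega
  · change μ' 2 0 ≠ 0
    rw [hfound]; norm_num
  · have hDout : (output n ⟨μ', 0⟩).map Fin.valEmbedding = D := by
      ext v
      simp only [output, Finset.mem_map, Finset.mem_filter, Finset.mem_univ, true_and]
      constructor
      · rintro ⟨w, hw, rfl⟩
        exact (hout w w.2).1 hw
      · intro hv
        have hvn := mem_range.1 (hD hv)
        exact ⟨⟨v, hvn⟩, (hout v hvn).2 hv, rfl⟩
    have hcardD : (output n ⟨μ', 0⟩).card = K := by
      rw [← hDK, ← hDout, Finset.card_map]
    refine isApproxClique_of_sum_le G ρ ε hε (inv_lt_of_den_div hε) hcardD ?_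
    rw [hcardD, ← hE]
    rw [← hDout, Finset.sum_map] at hdense
    simp only [Finset.sum_map, Fin.valEmbedding_apply, hμ1, hμ₀, nonEdge_initial] at hdense
    exact hdense

theorem exec_cliqueProg (ω : ℕ → Bool) (n : ℕ) (ρ ε : ℚ) (G : SimpleGraph (Fin n)) {C : ℕ}
    (hC : 10 ^ 13 ≤ C) (hρ : 0 < ρ) (hρ1 : ρ < 1) (hε : 0 < ε) (hε1 : ε < 1)
    (hG : HasClique G ρ) :
    ∃ t s, Exec ω cliqueProg (initial G ρ ε) t s ∧ t ≤ timeBound C n ρ ε ∧ Correct G ρ ε s := by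
  rcases Nat.eq_zero_or_pos n with rfl | hn
  · exact exec_zero ω G ρ ε hC
  · exact exec_pos ω hn G hC hρ hρ1 hε hε1 hG

end ApproxClique

theorem theorem1p2 :
    -- a Las Vegas algorithm with error probability exponentially small in the number of vertices
    (∃ (p : RAM.Prog) (C : ℕ) (c : ℝ), 0 < c ∧
      ∀ (n : ℕ) (ρ ε : ℚ) (G : SimpleGraph (Fin n)),
        0 < ρ → ρ < 1 → 0 < ε → ε < 1 → ApproxClique.HasClique G ρ →
        RAM.LasVegas p (ApproxClique.initial G ρ ε) ApproxClique.Bot (ApproxClique.Correct G ρ ε)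
          (ApproxClique.timeBound C n ρ ε) ((2 : ℝ) ^ (-(c * (n : ℝ))))) ∧
    -- a deterministic algorithm whose advice depends only on the number of vertices; a run with
    -- time bound `T` is given the first `T` bits of the advice
    (∃ (p : RAM.Prog) (C : ℕ) (advice : ℕ → ℕ → Bool),
      ∀ (n : ℕ) (ρ ε : ℚ) (G : SimpleGraph (Fin n)),
        0 < ρ → ρ < 1 → 0 < ε → ε < 1 → ApproxClique.HasClique G ρ →
        ∃ (t : ℕ) (s : RAM.State),
          RAM.Exec (RAM.tape fun i : Fin (ApproxClique.timeBound C n ρ ε) => advice n i) p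
            (ApproxClique.initial G ρ ε) t s ∧
          t ≤ ApproxClique.timeBound C n ρ ε ∧ ApproxClique.Correct G ρ ε s) := by
  obtain ⟨C, hC⟩ : ∃ C : ℕ, 10 ^ 13 ≤ C := ⟨_, le_rfl⟩
  -- The program is correct with every tape, so constant advice suffices for the second part, and
  -- any rate `c > 0` would do in the first.
  refine ⟨⟨ApproxClique.cliqueProg, C, 1, one_pos, fun n ρ ε G h1 h2 h3 h4 h5 => ⟨fun r => ?_, ?_⟩⟩,
    ⟨ApproxClique.cliqueProg, C, fun _ _ => false, fun n ρ ε G h1 h2 h3 h4 h5 =>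
      ApproxClique.exec_cliqueProg _ n ρ ε G hC h1 h2 h3 h4 h5⟩⟩
  · obtain ⟨t, s, hx, ht, hs⟩ :=
      ApproxClique.exec_cliqueProg (RAM.tape r) n ρ ε G hC h1 h2 h3 h4 h5
    exact ⟨t, s, hx, ht, .inr hs⟩
  -- A run is determined by its tape, so a failing run would coincide with the correct one.
  · have hempty : {r : Fin (ApproxClique.timeBound C n ρ ε) → Bool | ∃ t s,
        RAM.Exec (RAM.tape r) ApproxClique.cliqueProg (ApproxClique.initial G ρ ε) t s ∧
          ApproxClique.Bot s} = ∅ := by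
      refine Set.eq_empty_of_forall_notMem ?_
      rintro r ⟨t, s, hx, hbot⟩
      obtain ⟨t', s', hx', -, hs'⟩ :=
        ApproxClique.exec_cliqueProg (RAM.tape r) n ρ ε G hC h1 h2 h3 h4 h5
      obtain ⟨-, rfl⟩ := hx.unique hx'
      exact hs'.1 hbot
    rw [hempty, Set.ncard_empty]
    simp only [Nat.cast_zero, zero_div]
    positivity
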